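/- **Proposition 4.1.** *Setting.* An $N\times N$ graph grid diagram $g$ is an $N\times N$ grid of squares, some carrying markings, with exactly one $O$ or $O^*$ and at least one $X$ in each row and column, and with no $X$ in the square of an $O$ or $O^*$. It is viewed on the torus, with vertical circles $\beta_k$ and horizontal circles $\alpha_l$. Let $\mathbb O=\{O_1,\dots,O_N\}$ be the set of $O$- and $O^*$-markings, $\mathbb X$ the set of $X$-markings. A weight $\omega:\mathbb O\cup\mathbb X\to\mathbb Z$ (coming from a balanced coloring) is a map such that for each $O_i$ the weights of the $X$'s in its row, and those of the $X$'s in its column, add up to $\omega(O_i)$. With $\mathbb F=\mathbb Z/2$, $CF^-(g,\omega)$ is the free $\mathbb F[U_1,\dots,U_N]$-module on the states (bijections $\mathbf x$ between the horizontal and the vertical circles, viewed as sets of $N$ intersection points), with $$\partial^-\mathbf x=\sum_{\mathbf y}\ \sum_{r\in \mathrm{Rect}^\circ(\mathbf x,\mathbf y),\ r\cap\mathbb X=\emptyset}U_1^{O_1(r)}\cdots U_N^{O_N(r)}\,\mathbf y ,$$ where $\mathrm{Rect}^\circ(\mathbf x,\mathbf y)$ is the set of empty rectangles from $\mathbf x$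 to $\mathbf y$ on the torus (those whose lower left and upper right corners are in $\mathbf x$, whose other two corners are in $\mathbf y$, and whose interior contains no point of $\mathbf x$ or $\mathbf y$, where $\mathbf x$ and $\mathbf y$ agree away from the corners) and $O_i(r)=1$ if $O_i\in r$, $O_i(r)=0$ otherwise. Cut the torus along one vertical and one horizontal circle to obtain a planar picture in $[0,N)^2$. For finite sets $P,Q$ of points let $\mathcal I(P,Q)$ be the number of pairs $p\in P$, $q\in Q$ with $p$ strictly to the left of and strictly below $q$, and let $\mathcal J(P,Q)=\frac12(\mathcal I(P,Q)+\mathcal I(Q,P))$, both extended bilinearly to formal sums. The gradings are $M(\mathbf x)=\mathcal J(\mathbf x-\mathbb O,\mathbf x-\mathbb O)+1$ and $A(\mathbf x)=\mathcal J(\mathbf x,\sum_j\omega(X_j)X_j-\sum_i\omega(O_i)O_i)$, extended by $M(U_i)=-2$, $A(U_i)=-\omega(O_i)$; $A$ is considered only up to an overall constant. *Statement.* Let $g$ be an $(n+1)\times(n+1)$ graph grid diagram with weight $\omega$, and let $c=\alpha_i\cap\beta_j$ be an intersection point such that, in the $2\times2$ block of squares around $c$, the upper left and the lower right squares contain an $X$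 and one of the other two squares contains a marking $A$ which is an $O$ or an $O^*$. Assume that * there is just one $X$ in the row containing $A$, or just one $X$ in the column containing $A$; * outside the block, no $X$ in one of the two rows adjacent to $\alpha_i$ lies in the same column as an $X$ in the other one; * outside the block, no $X$ in one of the two columns adjacent to $\beta_j$ lies in the same row as an $X$ in the other one. Let $g'$ be obtained by deleting $A$, merging the two rows adjacent to $\alpha_i$ into one row and merging the two columns adjacent to $\beta_j$ into one column (so that the block becomes one square, with one $X$), and suppose that $g'$ is an $n\times n$ graph grid diagram. Let $\omega'$ be the weight of $g'$ which agrees with $\omega$ on all markings outside the merged block (the weight of the $X$ in the merged block is then determined). Label the markings so that $A=O_{n+1}$ and so that $O_1,\dots,O_n$ are the markings of $g'$. Then $CF^-(g,\omega)$ and $CF^-(g',\omega')$ are bigraded chain complexes, for every choice of the cuts, and there is a quasi-isomorphism $CF^-(g,\omega)\to CF^-(g',\omega')$ of chain complexes over $\mathbb F[U_1,\dots,U_n]$ which preserves the Maslov grading and shifts the Alexander grading by a constant. -/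

import Mathlib

noncomputable section

/-! ### Bigraded chain complexes -/

/-- The homology `ker d / im d` of a differential `d` on an abelian group. -/
abbrev DiffHomology {C : Type*} [AddCommGroup C] (d : C →+ C) : Type _ :=
  d.ker ⧸ (d.range.addSubgroupOf d.ker)

/-- The map induced on homology by a homomorphism that commutes with the differentials. -/
def diffHomologyMap {C C' : Type*} [AddCommGroup C] [AddCommGroup C'] (d : C →+ C) (d' : C' →+ C')
    (f : C →+ C') (h : ∀ z, f (d z) = d' (f z)) : DiffHomology d →+ DiffHomology d' :=
  QuotientAddGroup.map _ _
    (AddMonoidHom.mk' (fun z : d.ker => (⟨f z.1, by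
        have hz : d z.1 = 0 := z.2
        rw [AddMonoidHom.mem_ker, ← h, hz, map_zero]⟩ : d'.ker))
      (fun a b => Subtype.ext (by simp)))
    (by
      rintro ⟨z, hz⟩ hz'
      rw [AddSubgroup.mem_addSubgroupOf] at hz'
      obtain ⟨w, hw⟩ := hz'
      change d w = z at hw
      subst hw
      rw [AddSubgroup.mem_comap, AddSubgroup.mem_addSubgroupOf]
      exact ⟨f w, (h w).symm⟩)

/-- `f` is a quasi-isomorphism: a chain map that induces an isomorphism on homology. -/
def IsQuasiIso {C C' : Type*} [AddCommGroup C] [AddCommGroup C'] (d : C →+ C) (d' : C' →+ C')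
    (f : C →+ C') : Prop :=
  ∃ h : ∀ z, f (d z) = d' (f z), Function.Bijective (diffHomologyMap d d' f h)

/-- `(C, ∂)` is a bigraded chain complex over `𝔽[U_k : k ∈ σ]`, `𝔽 = ℤ/2`: the pieces `C_{m,s}`
split `C` as an `𝔽`-vector space, `U_k` has degree `(-2, -w k)`, and `∂` is a linear map of degree
`(-1, 0)` with `∂ ∘ ∂ = 0`.  The first degree is an integer; the second one is allowed to be
rational, since it is only meaningful up to an overall constant. -/
structure IsBigradedComplex {σ C : Type*} [AddCommGroup C] [Module (MvPolynomial σ (ZMod 2)) C]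
    [Module (ZMod 2) C] (d : C →ₗ[MvPolynomial σ (ZMod 2)] C)
    (gr : ℤ → ℚ → Submodule (ZMod 2) C) (w : σ → ℤ) : Prop where
  splits : DirectSum.IsInternal (fun p : ℤ × ℚ => gr p.1 p.2)
  smul_mem : ∀ (k : σ) (m : ℤ) (s : ℚ), ∀ z ∈ gr m s,
    (MvPolynomial.X k : MvPolynomial σ (ZMod 2)) • z ∈ gr (m - 2) (s - w k)
  sq_zero : ∀ z, d (d z) = 0
  d_mem : ∀ (m : ℤ) (s : ℚ), ∀ z ∈ gr m s, d z ∈ gr (m - 1) s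

/-! ### Graph grid diagrams and weights -/

/-- An `N × N` graph grid diagram.  Columns are numbered from left to right and rows from bottom to
top, and the square `(k, l)` is the one in column `k` and row `l`.  There is exactly one
`O` or `O*` in each row and column, the one in column `k` lying in row `O k`; there is at least one
`X` in each row and column; `X`'s do not share a square with an `O` or `O*`.
(The chain complex does not distinguish `O` from `O*`, so both are recorded by `O`.)
The diagram is regarded as a diagram on the torus: `β_k` (resp. `α_l`) denotes the circle along the
left side of column `k` (resp. along the bottom side of row `l`), indices being cyclic. -/
structure GraphGrid (N : ℕ) where
  O : Equiv.Perm (Fin N)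
  X : Finset (Fin N × Fin N)
  X_col : ∀ k, ∃ l, (k, l) ∈ X
  X_row : ∀ l, ∃ k, (k, l) ∈ X
  disj : ∀ k, (k, O k) ∉ X

/-- A weight on the markings of `g` that comes from a balanced colouring: `onO k` is the weight of
the `O` or `O*` in column `k`, `onX s` the weight of the `X` in the square `s` (and `0` if there is
none).  The `X`'s in the row and those in the column of an `O*` lie on the edges on the two sides
(outgoing, incoming) of the corresponding vertex, and the weights on either side add up to the
weight of the `O*`; for an `O` in the interior of an edge there is one `X` on either side,
of the same weight. -/
structure GraphGrid.Weight {N : ℕ} (g : GraphGrid N) where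
  onO : Fin N → ℤ
  onX : Fin N × Fin N → ℤ
  supp : ∀ s, s ∉ g.X → onX s = 0
  col_balance : ∀ k, onO k = ∑ l, onX (k, l)
  row_balance : ∀ k, onO k = ∑ c, onX (c, g.O k)

namespace GraphGrid

variable {N : ℕ}

/-! ### States, rectangles, and the chain complex -/

/-- A state: a bijection between the vertical and the horizontal circles; `x k` is the index of
the horizontal circle whose intersection with `β_k` belongs to the state. -/
abbrev State (_g : GraphGrid N) : Type := Equiv.Perm (Fin N)

/-- Going in the positive direction from the circle `a` one meets the strip `k` (between the
circles `k` and `k + 1`) before the circle `b`. -/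
def Between (a b k : Fin N) : Prop := k - a < b - a

/-- The square `s` lies in the rectangle on the torus whose lower left corner is `β_a ∩ α_c` and
whose upper right corner is `β_b ∩ α_d`. -/
def RectHas (a b c d : Fin N) (s : Fin N × Fin N) : Prop := Between a b s.1 ∧ Between c d s.2

/-- The point `β_k ∩ α_l`, `p = (k, l)`, lies in the interior of the rectangle with lower left corner
`β_a ∩ α_c` and upper right corner `β_b ∩ α_d`. -/
def RectInt (a b c d : Fin N) (p : Fin N × Fin N) : Prop :=
  RectHas a b c d p ∧ p.1 ≠ a ∧ p.2 ≠ c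

open Classical in
/-- The empty rectangles from `x` to `y` that contain no `X`.  A rectangle from `x` to `y` is given
by the pair of vertical circles `(a, b)` containing its left and its right side: its lower left
and upper right corners `(a, x a)`, `(b, x b)` belong to `x`, the other two corners `(a, x b)` and
`(b, x a)` belong to `y`, and `x` and `y` agree elsewhere.  (Then a point of `y` in the interior is
also a point of `x`.) -/
def rects (g : GraphGrid N) (x y : g.State) : Finset (Fin N × Fin N) :=
  Finset.univ.filter fun r =>
    r.1 ≠ r.2 ∧ y = x * Equiv.swap r.1 r.2 ∧
    (∀ k, ¬ RectInt r.1 r.2 (x r.1) (x r.2) (k, x k)) ∧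
    ∀ s ∈ g.X, ¬ RectHas r.1 r.2 (x r.1) (x r.2) s

open Classical in
/-- `∏ U_k ^ O_k(r)` for the rectangle `r` between `β_{r.1}` and `β_{r.2}` starting at the
state `x`.  The variable `U_k` belongs to the `O` or `O*` in column `k`. -/
def rectMonomial (g : GraphGrid N) (x : g.State) (r : Fin N × Fin N) :
    MvPolynomial (Fin N) (ZMod 2) :=
  ∏ k, if RectHas r.1 r.2 (x r.1) (x r.2) (k, g.O k) then MvPolynomial.X k else 1

/-- The module `CF⁻(g)`, free over `𝔽[U_k]` on the states of `g`. -/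
abbrev CF (g : GraphGrid N) : Type := g.State →₀ MvPolynomial (Fin N) (ZMod 2)

/-- The differential `∂⁻`. -/
def diff (g : GraphGrid N) : g.CF →ₗ[MvPolynomial (Fin N) (ZMod 2)] g.CF :=
  Finsupp.linearCombination _ fun x : g.State =>
    ∑ y : g.State, Finsupp.single y (∑ r ∈ g.rects x y, g.rectMonomial x r)

/-! ### The gradings -/

/-- `𝓘(A, B)`, extended bilinearly to formal sums of points of the plane. -/
def countI (A B : (ℤ × ℤ) →₀ ℤ) : ℤ :=
  A.sum fun p m => B.sum fun q n => if p.1 < q.1 ∧ p.2 < q.2 then m * n else 0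

/-- `𝓙(A, B) = (𝓘(A, B) + 𝓘(B, A)) / 2`. -/
def countJ (A B : (ℤ × ℤ) →₀ ℤ) : ℚ := ((countI A B : ℚ) + (countI B A : ℚ)) / 2

/-- The point `β_{p.1} ∩ α_{p.2}` in the planar realization obtained by cutting the torus along
`β_{c.1}` and `α_{c.2}`.  All planar coordinates are doubled in order to be integers. -/
def latticePt (c p : Fin N × Fin N) : ℤ × ℤ :=
  (2 * ((p.1 - c.1).val : ℤ), 2 * ((p.2 - c.2).val : ℤ))

/-- The centre of the square `s` in the same planar realization. -/
def squarePt (c s : Fin N × Fin N) : ℤ × ℤ :=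
  (2 * ((s.1 - c.1).val : ℤ) + 1, 2 * ((s.2 - c.2).val : ℤ) + 1)

/-- The state `x` as a formal sum of points. -/
def stateSum (g : GraphGrid N) (c : Fin N × Fin N) (x : g.State) : (ℤ × ℤ) →₀ ℤ :=
  ∑ k, Finsupp.single (latticePt c (k, x k)) 1

/-- The set of `O`'s and `O*`'s as a formal sum of points. -/
def oSum (g : GraphGrid N) (c : Fin N × Fin N) : (ℤ × ℤ) →₀ ℤ :=
  ∑ k, Finsupp.single (squarePt c (k, g.O k)) 1

/-- The formal sum `∑ ω(X_j) X_j - ∑ ω(O_i) O_i`. -/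
def weightSum (g : GraphGrid N) (ω : g.Weight) (c : Fin N × Fin N) : (ℤ × ℤ) →₀ ℤ :=
  ∑ s ∈ g.X, Finsupp.single (squarePt c s) (ω.onX s) -
    ∑ k, Finsupp.single (squarePt c (k, g.O k)) (ω.onO k)

/-- The Maslov grading of a state, `𝓙(x - 𝕆, x - 𝕆) + 1`; as `𝓙(A, A) = 𝓘(A, A)`, it is an
integer. -/
def maslov (g : GraphGrid N) (c : Fin N × Fin N) (x : g.State) : ℤ :=
  countI (g.stateSum c x - g.oSum c) (g.stateSum c x - g.oSum c) + 1

theorem maslov_eq (g : GraphGrid N) (c : Fin N × Fin N) (x : g.State) :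
    (g.maslov c x : ℚ) = countJ (g.stateSum c x - g.oSum c) (g.stateSum c x - g.oSum c) + 1 := by
  simp only [maslov, countJ]
  push_cast
  ring

/-- The Alexander grading of a state. -/
def alexander (g : GraphGrid N) (ω : g.Weight) (c : Fin N × Fin N) (x : g.State) : ℚ :=
  countJ (g.stateSum c x) (g.weightSum ω c)

/-- The piece of `CF⁻(g, ω)` of Maslov grading `m` and Alexander grading `s`: the span of the
elements `U^e · x` with `M(x) - 2 |e| = m` and `A(x) - ∑ e_k ω(O_k) = s`. -/
def graded (g : GraphGrid N) (ω : g.Weight) (c : Fin N × Fin N) (m : ℤ) (s : ℚ) :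
    Submodule (ZMod 2) g.CF :=
  Submodule.span (ZMod 2)
    {z | ∃ (x : g.State) (e : Fin N →₀ ℕ),
      g.maslov c x - 2 * ∑ k, (e k : ℤ) = m ∧
      g.alexander ω c x - ∑ k, (e k : ℚ) * (ω.onO k : ℚ) = s ∧
      z = Finsupp.single x (MvPolynomial.monomial e 1)}

/-! ### The destabilization-like move -/

/-- `g'` is obtained from `g` by the destabilization-like move at the `O` or `O*` in column `a`
(called `A`).  The intersection point of the circles in question is the centre of the `2 × 2` block
formed by the columns `j, j + 1` and the rows `i, i + 1`.  The upper left and the lower right square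
of the block contain an `X`, and `A` is in one of the other two squares.  The move
deletes `A`, merges the columns `j, j + 1` into one and merges the rows `i, i + 1` into one; in
particular the block becomes a single square, which contains an `X`.  Here `Fin.predAbove j` is the
monotone map that identifies `j` and `j + 1`, and `Fin.succAbove a` enumerates all columns
except `a`. -/
structure IsDestabilization {n : ℕ} (g : GraphGrid (n + 1)) (g' : GraphGrid n)
    (i j : Fin n) (a : Fin (n + 1)) : Prop where
  posA : (a = j.castSucc ∧ g.O a = i.castSucc) ∨ (a = j.succ ∧ g.O a = i.succ)
  upperLeft : (j.castSucc, i.succ) ∈ g.X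
  lowerRight : (j.succ, i.castSucc) ∈ g.X
  O_eq : ∀ k, g'.O k = i.predAbove (g.O (a.succAbove k))
  X_eq : g'.X = g.X.image fun s => (j.predAbove s.1, i.predAbove s.2)

/-- The weight `ω'` of `g'` is induced by `ω`: all markings outside the merged block keep their
weights.  (The weight of the `X` in the merged block is then determined by balance; it is the sum of
the weights of the `X`'s of the block minus the weight of `A`.) -/
structure IsInducedWeight {n : ℕ} {g : GraphGrid (n + 1)} {g' : GraphGrid n}
    (i j : Fin n) (a : Fin (n + 1)) (ω : g.Weight) (ω' : g'.Weight) : Prop where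
  onO_eq : ∀ k, ω'.onO k = ω.onO (a.succAbove k)
  onX_eq : ∀ s ∈ g.X, (j.predAbove s.1, i.predAbove s.2) ≠ (j, i) →
    ω'.onX (j.predAbove s.1, i.predAbove s.2) = ω.onX s

end GraphGrid

end

/-!
The quasi-isomorphism is the counterpart of the destabilization map of grid homology. Write `C` for
`CF⁻(g)`, let `A` be the deleted marking, `U_a` its variable, and let `t` be the square of the `X`
of the block that is the only `X` in its row or in its column, the line being one through `A`. A
rectangle that avoids all `X`'s outside `t` contains each of `t` and `A` at most once; let `∂_{pq}`
count the empty rectangles of multiplicity `p` at `t` and `q` at `A`, without recording `U_a`. Then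
`∂⁻ = ∂₀₀ + U_a ∂₀₁`, and cutting the domains of juxtaposed rectangles in the other way
(`sum_isEmptyPair`) gives, for the sums of compositions with total multiplicities `(p, q)`, the
contributions of the annuli of width one only (`sum_selMap_selMap`): nothing for `(0, 0)` and `(0,
1)`, an element `u` that does not involve `U_a` for `(1, 0)`, and `1` for `(1, 1)`, where exactly
the annulus through `t` and `A` counts.

Let `I` be the quotient of `C` spanned by the states that contain the centre of the block. How a
rectangle meets the four squares of the block determines whether its two ends contain the centre
(`isInner_cases`). Consequently `∂₀₁` factors through `I` and has its image in the kernel of `C →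
I`, `∂₁₀` vanishes on the states containing the centre, and `∂₁₁` has its image in the kernel. The
relations above then say that `π ∂₁₀`, with `π : C → I` the projection, commutes with the
differentials up to multiplication by `U_a + u`, that it maps `∂₀₁` back to the identity of `I`, and
that on the kernel of `π` the map `∂₁₁` is a homotopy between the identity and `∂₀₁ π ∂₁₀` (the
lemmas of the namespace `IsBlock`).

Removing the centre identifies `I`, with its differential and with `u` substituted for `U_a`, with
`CF⁻(g')` (`IsDestabilization.innerProj_diff_single`); after the substitution `π ∂₁₀` becomes a
chain map `destabMap`, which is onto on homology because `∂₀₁` lifts a set of representatives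
compatibly with the differentials. A cycle in its kernel can be changed by a boundary so that its
image under `π ∂₁₀` vanishes; as `U_a + u` is not a zero divisor, its image under `π` then vanishes
too, and `∂₁₁` exhibits it as a boundary (`IsBlock.exists_diff_eq`, `IsDestabilization.isQuasiIso`).

For the gradings, the change along a rectangle on the torus is expressed through the markings and
points it contains, for any cut (`maslov_sub_maslov_swap`, `alexander_sub_alexander_swap`); for the
second one it is used that the weights in each row and column add up to zero. A function on the
states with no change along rectangles is constant, which gives the comparison of the gradings of
the two diagrams: in the Maslov grading the centre of the block and `A` cancel, and in the Alexander
grading the weights of `g'` are the sums of the weights of `g` in the merged squares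
(`IsDestabilization.sum_fiber`). This is where the hypotheses on the `X`'s outside the block enter.
-/

noncomputable section

namespace GraphGrid

/-! ### Cyclic intervals -/

section Arcs

variable {N : ℕ}

theorem between_iff (a b k : Fin N) :
    Between a b k ↔ (a.1 ≤ k.1 ∧ k.1 < b.1) ∨ (b.1 < a.1 ∧ (a.1 ≤ k.1 ∨ k.1 < b.1)) := by
  have ha := a.2
  have hb := b.2
  have hk := k.2
  unfold Between
  rw [Fin.lt_def]
  rcases le_or_gt a k with h1 | h1 <;> rcases le_or_gt a b with h2 | h2
  all_goals
    first | rw [Fin.coe_sub_iff_le.2 h1] | rw [Fin.coe_sub_iff_lt.2 h1]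
    first | rw [Fin.coe_sub_iff_le.2 h2] | rw [Fin.coe_sub_iff_lt.2 h2]
    simp only [Fin.le_def, Fin.lt_def] at h1 h2
    omega

theorem not_between_right (a b : Fin N) : ¬ Between a b b := by
  rw [between_iff]; omega

theorem between_left {a b : Fin N} (h : a ≠ b) : Between a b a := by
  rw [between_iff]; have := Fin.val_ne_of_ne h; omega

theorem between_swap {a b : Fin N} (h : a ≠ b) (k : Fin N) : Between b a k ↔ ¬ Between a b k := by
  rw [between_iff, between_iff]; have := Fin.val_ne_of_ne h; omega

/-- For three distinct circles, `Between` is the cyclic order. -/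
theorem between_comm {a b c : Fin N} (hab : a ≠ b) (hac : a ≠ c) (hbc : b ≠ c) :
    Between a b c ↔ ¬ Between a c b := by
  rw [between_iff, between_iff]
  have := Fin.val_ne_of_ne hab; have := Fin.val_ne_of_ne hac; have := Fin.val_ne_of_ne hbc
  omega

theorem between_rotate {a b c : Fin N} (hab : a ≠ b) (hac : a ≠ c) (hbc : b ≠ c) :
    Between a b c ↔ Between c a b := by
  rw [between_iff, between_iff]
  have := Fin.val_ne_of_ne hab; have := Fin.val_ne_of_ne hac; have := Fin.val_ne_of_ne hbc
  omega

/-- The cyclic order of three circles is determined by one instance of `Between`. -/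
theorem between_cyclic {a b c : Fin N} (hab : a ≠ b) (hac : a ≠ c) (hbc : b ≠ c) :
    (Between a b c ↔ ¬ Between a c b) ∧ (Between a b c ↔ Between c a b) ∧
      (Between a c b ↔ Between b a c) ∧ (Between b c a ↔ Between a b c) ∧
      (Between c b a ↔ Between a c b) :=
  ⟨between_comm hab hac hbc, between_rotate hab hac hbc, between_rotate hac hab hbc.symm,
    between_rotate hbc hab.symm hac.symm, between_rotate hbc.symm hac.symm hab.symm⟩

theorem between_split {a b c : Fin N} (h : Between a b c) (k : Fin N) :
    Between a b k ↔ Between a c k ∨ Between c b k := by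
  rw [between_iff] at *; rw [between_iff, between_iff]; omega

theorem between_disjoint {a b c : Fin N} (h : Between a b c) (k : Fin N) :
    ¬ (Between a c k ∧ Between c b k) := by
  rw [between_iff] at *; rw [between_iff]; omega

theorem between_of_cross_right {a b c d : Fin N} (h : Between a b c) (h' : ¬ Between a b d)
    (hbd : b ≠ d) : Between c d b := by
  rw [between_iff] at *; have := Fin.val_ne_of_ne hbd; omega

theorem between_of_cross_left {a b c d : Fin N} (h : ¬ Between a b c) (h' : Between a b d)
    (had : a ≠ d) : Between c d a := by
  rw [between_iff] at *; have := Fin.val_ne_of_ne had; omega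

open Classical in
/-- The indicator function of the strips met on the way from the circle `a` to the circle `b`. -/
def arc (a b k : Fin N) : ℕ := if Between a b k then 1 else 0

theorem arc_split {a b c : Fin N} (h : Between a b c) (k : Fin N) :
    arc a b k = arc a c k + arc c b k := by
  have h1 := between_split h k
  have h2 := between_disjoint h k
  unfold arc
  split_ifs <;> tauto

theorem arc_add_swap {a b : Fin N} (h : a ≠ b) (k : Fin N) : arc a b k + arc b a k = 1 := by
  have h1 := between_swap h k
  unfold arc
  split_ifs <;> tauto

end Arcs

/-! ### Empty rectangles and their domains -/

section Rectangles

variable {N : ℕ}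

/-- The domain of a rectangle starting at `x`: the multiplicity with which it covers each square. -/
def rectDomain (x : Equiv.Perm (Fin N)) (r : Fin N × Fin N) (s : Fin N × Fin N) : ℕ :=
  arc r.1 r.2 s.1 * arc (x r.1) (x r.2) s.2

/-- The rectangle between `β_{r.1}` and `β_{r.2}` starting at `x` is nondegenerate and has no point
of `x` in its interior. Whether it contains markings is not taken into account. -/
def IsEmptyRect (x : Equiv.Perm (Fin N)) (r : Fin N × Fin N) : Prop :=
  r.1 ≠ r.2 ∧ ∀ k, k ≠ r.1 → k ≠ r.2 →
    ¬ (Between r.1 r.2 k ∧ Between (x r.1) (x r.2) (x k))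

theorem isEmptyRect_iff (x : Equiv.Perm (Fin N)) (r : Fin N × Fin N) :
    IsEmptyRect x r ↔ r.1 ≠ r.2 ∧ ∀ k, ¬ RectInt r.1 r.2 (x r.1) (x r.2) (k, x k) := by
  unfold IsEmptyRect RectInt RectHas
  refine and_congr_right fun _ => forall_congr' fun k => ?_
  constructor
  · rintro h ⟨⟨h1, h2⟩, h3, -⟩
    refine h h3 ?_ ⟨h1, h2⟩
    rintro rfl
    exact not_between_right _ _ h1
  · rintro h h1 - h2
    exact h ⟨h2, h1, fun h => h1 (x.injective h)⟩

/-- Two consecutive empty rectangles, the first one starting at `x`. -/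
def IsEmptyPair (x : Equiv.Perm (Fin N)) (q : (Fin N × Fin N) × (Fin N × Fin N)) : Prop :=
  IsEmptyRect x q.1 ∧ IsEmptyRect (x * Equiv.swap q.1.1 q.1.2) q.2

/-- The state reached by two consecutive rectangles. -/
def pairEnd (x : Equiv.Perm (Fin N)) (q : (Fin N × Fin N) × (Fin N × Fin N)) :
    Equiv.Perm (Fin N) :=
  x * Equiv.swap q.1.1 q.1.2 * Equiv.swap q.2.1 q.2.2

/-- The domain of the juxtaposition of two consecutive rectangles. -/
def pairDomain (x : Equiv.Perm (Fin N)) (q : (Fin N × Fin N) × (Fin N × Fin N)) :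
    Fin N × Fin N → ℕ :=
  rectDomain x q.1 + rectDomain (x * Equiv.swap q.1.1 q.1.2) q.2

open Equiv in
theorem swap_mul_apply_left (x : Perm (Fin N)) (a b : Fin N) : (x * swap a b) a = x b := by simp

open Equiv in
theorem swap_mul_apply_right (x : Perm (Fin N)) (a b : Fin N) : (x * swap a b) b = x a := by simp

open Equiv in
theorem swap_mul_apply_of_ne (x : Perm (Fin N)) {a b k : Fin N} (ha : k ≠ a) (hb : k ≠ b) :
    (x * swap a b) k = x k := by
  simp [swap_apply_of_ne_of_ne ha hb]

variable {x : Equiv.Perm (Fin N)} {a b c d : Fin N}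

theorem isEmptyRect_iff_of_agree {z : Equiv.Perm (Fin N)} {S : Set (Fin N)} {p q t : Fin N}
    (hz : ∀ k, k ∉ S → z k = x k) (hS : ∀ k, k ∈ S ↔ k = p ∨ k = q ∨ k = t)
    (hpq : p ≠ q) (htp : t ≠ p) (htq : t ≠ q) :
    IsEmptyRect z (p, q) ↔ ¬ (Between p q t ∧ Between (z p) (z q) (z t)) ∧
      ∀ k, k ∉ S → ¬ (Between p q k ∧ Between (z p) (z q) (x k)) := by
  unfold IsEmptyRect
  refine ⟨fun h => ⟨h.2 t htp htq, fun k hk => ?_⟩, fun h => ⟨hpq, fun k h1 h2 => ?_⟩⟩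
  · rw [← hz k hk]
    rw [hS, not_or, not_or] at hk
    exact h.2 k hk.1 hk.2.1
  · by_cases hk : k = t
    · subst hk; exact h.1
    · have hkS : k ∉ S := by rw [hS]; tauto
      rw [hz k hkS]; exact h.2 k hkS

/-- Emptiness of two consecutive rectangles whose sides lie on the three circles in `S`: the circles
in `S` and the remaining ones are treated separately. -/
theorem isEmptyPair_iff_of_mem {S : Set (Fin N)} {p q t p' q' t' : Fin N}
    (hS : ∀ k, k ∈ S ↔ k = p ∨ k = q ∨ k = t) (hS' : ∀ k, k ∈ S ↔ k = p' ∨ k = q' ∨ k = t')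
    (hpq : p ≠ q) (htp : t ≠ p) (htq : t ≠ q) (hpq' : p' ≠ q') (htp' : t' ≠ p')
    (htq' : t' ≠ q') {y : Equiv.Perm (Fin N)} (hy : y = x * Equiv.swap p q) :
    IsEmptyPair x ((p, q), (p', q')) ↔
      (¬ (Between p q t ∧ Between (x p) (x q) (x t)) ∧
        ∀ k, k ∉ S → ¬ (Between p q k ∧ Between (x p) (x q) (x k))) ∧
      (¬ (Between p' q' t' ∧ Between (y p') (y q') (y t')) ∧
        ∀ k, k ∉ S → ¬ (Between p' q' k ∧ Between (y p') (y q') (x k))) := by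
  subst hy
  have hz : ∀ k, k ∉ S → (x * Equiv.swap p q) k = x k := fun k hk => by
    rw [hS, not_or, not_or] at hk
    exact swap_mul_apply_of_ne x hk.1 hk.2.1
  rw [← isEmptyRect_iff_of_agree (fun _ _ => rfl) hS hpq htp htq,
    ← isEmptyRect_iff_of_agree hz hS' hpq' htp' htq']
  rfl

/-- Two rectangles stacked along their left sides, the upper one being narrower: the L-shaped domain
is also cut by the vertical line. -/
theorem isEmptyPair_left_narrow (hab : a ≠ b) (hac : a ≠ c) (hbc : b ≠ c) (h : Between a b c) :
    IsEmptyPair x ((a, b), (a, c)) ↔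
      IsEmptyPair x ((a, c), (c, b)) ∧ Between (x a) (x c) (x b) := by
  have xab := x.injective.ne hab
  have xac := x.injective.ne hac
  have xbc := x.injective.ne hbc
  obtain ⟨f1, f2, f3, f4, f5⟩ := between_cyclic hab hac hbc
  obtain ⟨g1, g2, g3, g4, g5⟩ := between_cyclic xab xac xbc
  have hS : ∀ k, k ∈ ({a, b, c} : Set (Fin N)) ↔ k = a ∨ k = b ∨ k = c := fun k => by simp
  rw [isEmptyPair_iff_of_mem (fun k => (hS k).trans (by grind only))
      (fun k => (hS k).trans (by grind only)) hab hac.symm hbc.symm hac hab.symm hbc rfl,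
    isEmptyPair_iff_of_mem (fun k => (hS k).trans (by grind only))
      (fun k => (hS k).trans (by grind only)) hac hab.symm hbc hbc.symm hac hab rfl]
  simp only [swap_mul_apply_left, swap_mul_apply_right,
    swap_mul_apply_of_ne x hac.symm hbc.symm, swap_mul_apply_of_ne x hab.symm hbc]
  clear hS
  have e1 := between_split (show Between a b c from by grind only)
  have e2 := @between_split _ (x a) (x c) (x b)
  constructor
  · rintro ⟨⟨h1, h2⟩, ⟨h3, h4⟩⟩
    have hx : Between (x a) (x c) (x b) := by clear h2 h4 e1 e2; grind only
    have e2 := e2 (by clear h2 h4 e1 e2; grind only)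
    refine ⟨⟨⟨by clear h2 h4 e1 e2; grind only, fun k hk => ?_⟩,
      by clear h2 h4 e1 e2; grind only, fun k hk => ?_⟩, hx⟩ <;>
    · have := h2 k hk; have := h4 k hk; have := e1 k; have := e2 (x k)
      clear h2 h4 e1 e2 f1 f2 f3 f4 f5 g1 g2 g3 g4 g5 h1 h3; grind only
  · rintro ⟨⟨⟨h1, h2⟩, ⟨h3, h4⟩⟩, hx⟩
    have e2 := e2 (by clear h2 h4 e1 e2; grind only)
    refine ⟨⟨by clear h2 h4 e1 e2; grind only, fun k hk => ?_⟩,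
      by clear h2 h4 e1 e2; grind only, fun k hk => ?_⟩ <;>
    · have := h2 k hk; have := h4 k hk; have := e1 k; have := e2 (x k)
      clear h2 h4 e1 e2 f1 f2 f3 f4 f5 g1 g2 g3 g4 g5 h1 h3; grind only

theorem isEmptyPair_left_narrow_domain (hab : a ≠ b) (hac : a ≠ c) (hbc : b ≠ c)
    (h : Between a b c) (hx : Between (x a) (x c) (x b)) :
    pairDomain x ((a, b), (a, c)) = pairDomain x ((a, c), (c, b)) := by
  funext s
  simp only [pairDomain, rectDomain, Pi.add_apply, swap_mul_apply_left, swap_mul_apply_right,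
    swap_mul_apply_of_ne x hac.symm hbc.symm, swap_mul_apply_of_ne x hab.symm hbc]
  rw [arc_split h, arc_split hx]
  ring

theorem isEmptyPair_left_narrow_end (hab : a ≠ b) (hac : a ≠ c) (hbc : b ≠ c) :
    pairEnd x ((a, b), (a, c)) = pairEnd x ((a, c), (c, b)) := by
  unfold pairEnd
  ext k
  simp only [Equiv.Perm.mul_apply, Equiv.swap_apply_def]
  grind

/-- Two rectangles stacked along their left sides, the upper one being wider. -/
theorem isEmptyPair_left_wide (hab : a ≠ b) (hac : a ≠ c) (hbc : b ≠ c) (h : ¬ Between a b c) :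
    IsEmptyPair x ((a, b), (a, c)) ↔
      IsEmptyPair x ((b, c), (a, b)) ∧ ¬ Between (x b) (x c) (x a) := by
  have xab := x.injective.ne hab
  have xac := x.injective.ne hac
  have xbc := x.injective.ne hbc
  obtain ⟨f1, f2, f3, f4, f5⟩ := between_cyclic hab hac hbc
  obtain ⟨g1, g2, g3, g4, g5⟩ := between_cyclic xab xac xbc
  have hS : ∀ k, k ∈ ({a, b, c} : Set (Fin N)) ↔ k = a ∨ k = b ∨ k = c := fun k => by simp
  rw [isEmptyPair_iff_of_mem (fun k => (hS k).trans (by grind only))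
      (fun k => (hS k).trans (by grind only)) hab hac.symm hbc.symm hac hab.symm hbc rfl,
    isEmptyPair_iff_of_mem (fun k => (hS k).trans (by grind only))
      (fun k => (hS k).trans (by grind only)) hbc hab hac hab hac.symm hbc.symm rfl]
  simp only [swap_mul_apply_left, swap_mul_apply_right,
    swap_mul_apply_of_ne x hac.symm hbc.symm, swap_mul_apply_of_ne x hab hac]
  clear hS
  have e1 := between_split (show Between a c b from by grind only)
  have e2 := @between_split _ (x a) (x c) (x b)
  constructor
  · rintro ⟨⟨h1, h2⟩, ⟨h3, h4⟩⟩
    have hx : ¬ Between (x b) (x c) (x a) := by clear h2 h4 e1 e2; grind only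
    have e2 := e2 (by clear h2 h4 e1 e2; grind only)
    refine ⟨⟨⟨by clear h2 h4 e1 e2; grind only, fun k hk => ?_⟩,
      by clear h2 h4 e1 e2; grind only, fun k hk => ?_⟩, hx⟩ <;>
    · have := h2 k hk; have := h4 k hk; have := e1 k; have := e2 (x k)
      clear h2 h4 e1 e2 f1 f2 f3 f4 f5 g1 g2 g3 g4 g5 h1 h3; grind only
  · rintro ⟨⟨⟨h1, h2⟩, ⟨h3, h4⟩⟩, hx⟩
    have e2 := e2 (by clear h2 h4 e1 e2; grind only)
    refine ⟨⟨by clear h2 h4 e1 e2; grind only, fun k hk => ?_⟩,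
      by clear h2 h4 e1 e2; grind only, fun k hk => ?_⟩ <;>
    · have := h2 k hk; have := h4 k hk; have := e1 k; have := e2 (x k)
      clear h2 h4 e1 e2 f1 f2 f3 f4 f5 g1 g2 g3 g4 g5 h1 h3; grind only

theorem isEmptyPair_left_wide_domain (hab : a ≠ b) (hac : a ≠ c) (hbc : b ≠ c)
    (h : ¬ Between a b c) (hx : ¬ Between (x b) (x c) (x a)) :
    pairDomain x ((a, b), (a, c)) = pairDomain x ((b, c), (a, b)) := by
  rw [← between_comm hac hab hbc.symm] at h
  rw [between_rotate (x.injective.ne hbc) (x.injective.ne hab.symm) (x.injective.ne hac.symm),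
    ← between_comm (x.injective.ne hac) (x.injective.ne hab) (x.injective.ne hbc.symm)] at hx
  funext s
  simp only [pairDomain, rectDomain, Pi.add_apply, swap_mul_apply_left,
    swap_mul_apply_of_ne x hac.symm hbc.symm, swap_mul_apply_of_ne x hab hac]
  rw [arc_split h, arc_split hx]
  ring

theorem isEmptyPair_left_wide_end (hac : a ≠ c) (hbc : b ≠ c) :
    pairEnd x ((a, b), (a, c)) = pairEnd x ((b, c), (a, b)) := by
  unfold pairEnd
  ext k
  simp only [Equiv.Perm.mul_apply, Equiv.swap_apply_def]
  grind

/-- Two rectangles stacked along their right sides, the lower one being narrower. -/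
theorem isEmptyPair_right_narrow (hab : a ≠ b) (hac : a ≠ c) (hbc : b ≠ c) (h : Between a b c) :
    IsEmptyPair x ((a, b), (c, b)) ↔
      IsEmptyPair x ((c, b), (a, c)) ∧ Between (x c) (x b) (x a) := by
  have xab := x.injective.ne hab
  have xac := x.injective.ne hac
  have xbc := x.injective.ne hbc
  obtain ⟨f1, f2, f3, f4, f5⟩ := between_cyclic hab hac hbc
  obtain ⟨g1, g2, g3, g4, g5⟩ := between_cyclic xab xac xbc
  have hS : ∀ k, k ∈ ({a, b, c} : Set (Fin N)) ↔ k = a ∨ k = b ∨ k = c := fun k => by simp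
  rw [isEmptyPair_iff_of_mem (fun k => (hS k).trans (by grind only))
      (fun k => (hS k).trans (by grind only)) hab hac.symm hbc.symm hbc.symm hac hab rfl,
    isEmptyPair_iff_of_mem (fun k => (hS k).trans (by grind only))
      (fun k => (hS k).trans (by grind only)) hbc.symm hac hab hac hab.symm hbc rfl]
  simp only [swap_mul_apply_left, swap_mul_apply_right,
    swap_mul_apply_of_ne x hac.symm hbc.symm, swap_mul_apply_of_ne x hac hab]
  clear hS
  have e1 := between_split (show Between a b c from by grind only)
  have e2 := @between_split _ (x c) (x b) (x a)
  constructor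
  · rintro ⟨⟨h1, h2⟩, ⟨h3, h4⟩⟩
    have hx : Between (x c) (x b) (x a) := by clear h2 h4 e1 e2; grind only
    have e2 := e2 (by clear h2 h4 e1 e2; grind only)
    refine ⟨⟨⟨by clear h2 h4 e1 e2; grind only, fun k hk => ?_⟩,
      by clear h2 h4 e1 e2; grind only, fun k hk => ?_⟩, hx⟩ <;>
    · have := h2 k hk; have := h4 k hk; have := e1 k; have := e2 (x k)
      clear h2 h4 e1 e2 f1 f2 f3 f4 f5 g1 g2 g3 g4 g5 h1 h3; grind only
  · rintro ⟨⟨⟨h1, h2⟩, ⟨h3, h4⟩⟩, hx⟩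
    have e2 := e2 (by clear h2 h4 e1 e2; grind only)
    refine ⟨⟨by clear h2 h4 e1 e2; grind only, fun k hk => ?_⟩,
      by clear h2 h4 e1 e2; grind only, fun k hk => ?_⟩ <;>
    · have := h2 k hk; have := h4 k hk; have := e1 k; have := e2 (x k)
      clear h2 h4 e1 e2 f1 f2 f3 f4 f5 g1 g2 g3 g4 g5 h1 h3; grind only

theorem isEmptyPair_right_narrow_domain (hab : a ≠ b) (hac : a ≠ c) (hbc : b ≠ c)
    (h : Between a b c) (hx : Between (x c) (x b) (x a)) :
    pairDomain x ((a, b), (c, b)) = pairDomain x ((c, b), (a, c)) := by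
  funext s
  simp only [pairDomain, rectDomain, Pi.add_apply, swap_mul_apply_left, swap_mul_apply_right,
    swap_mul_apply_of_ne x hac.symm hbc.symm, swap_mul_apply_of_ne x hac hab]
  rw [arc_split h, arc_split hx]
  ring

theorem isEmptyPair_right_narrow_end (hab : a ≠ b) (hac : a ≠ c) :
    pairEnd x ((a, b), (c, b)) = pairEnd x ((c, b), (a, c)) := by
  unfold pairEnd
  ext k
  simp only [Equiv.Perm.mul_apply, Equiv.swap_apply_def]
  grind

/-- Two rectangles stacked along their right sides, the lower one being wider. -/
theorem isEmptyPair_right_wide (hab : a ≠ b) (hac : a ≠ c) (hbc : b ≠ c) (h : ¬ Between a b c) :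
    IsEmptyPair x ((a, b), (c, b)) ↔
      IsEmptyPair x ((c, a), (a, b)) ∧ ¬ Between (x c) (x a) (x b) := by
  have xab := x.injective.ne hab
  have xac := x.injective.ne hac
  have xbc := x.injective.ne hbc
  obtain ⟨f1, f2, f3, f4, f5⟩ := between_cyclic hab hac hbc
  obtain ⟨g1, g2, g3, g4, g5⟩ := between_cyclic xab xac xbc
  have hS : ∀ k, k ∈ ({a, b, c} : Set (Fin N)) ↔ k = a ∨ k = b ∨ k = c := fun k => by simp
  rw [isEmptyPair_iff_of_mem (fun k => (hS k).trans (by grind only))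
      (fun k => (hS k).trans (by grind only)) hab hac.symm hbc.symm hbc.symm hac hab rfl,
    isEmptyPair_iff_of_mem (fun k => (hS k).trans (by grind only))
      (fun k => (hS k).trans (by grind only)) hac.symm hbc hab.symm hab hac.symm hbc.symm rfl]
  simp only [swap_mul_apply_left, swap_mul_apply_right,
    swap_mul_apply_of_ne x hac.symm hbc.symm, swap_mul_apply_of_ne x hbc hab.symm]
  clear hS
  have e1 := between_split (show Between c b a from by grind only)
  have e2 := @between_split _ (x c) (x b) (x a)
  constructor
  · rintro ⟨⟨h1, h2⟩, ⟨h3, h4⟩⟩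
    have hx : ¬ Between (x c) (x a) (x b) := by clear h2 h4 e1 e2; grind only
    have e2 := e2 (by clear h2 h4 e1 e2; grind only)
    refine ⟨⟨⟨by clear h2 h4 e1 e2; grind only, fun k hk => ?_⟩,
      by clear h2 h4 e1 e2; grind only, fun k hk => ?_⟩, hx⟩ <;>
    · have := h2 k hk; have := h4 k hk; have := e1 k; have := e2 (x k)
      clear h2 h4 e1 e2 f1 f2 f3 f4 f5 g1 g2 g3 g4 g5 h1 h3; grind only
  · rintro ⟨⟨⟨h1, h2⟩, ⟨h3, h4⟩⟩, hx⟩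
    have e2 := e2 (by clear h2 h4 e1 e2; grind only)
    refine ⟨⟨by clear h2 h4 e1 e2; grind only, fun k hk => ?_⟩,
      by clear h2 h4 e1 e2; grind only, fun k hk => ?_⟩ <;>
    · have := h2 k hk; have := h4 k hk; have := e1 k; have := e2 (x k)
      clear h2 h4 e1 e2 f1 f2 f3 f4 f5 g1 g2 g3 g4 g5 h1 h3; grind only

theorem isEmptyPair_right_wide_domain (hab : a ≠ b) (hac : a ≠ c) (hbc : b ≠ c)
    (h : ¬ Between a b c) (hx : ¬ Between (x c) (x a) (x b)) :
    pairDomain x ((a, b), (c, b)) = pairDomain x ((c, a), (a, b)) := by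
  rw [between_rotate hab hac hbc, ← between_comm hbc.symm hac.symm hab.symm] at h
  rw [← between_comm (x.injective.ne hbc.symm) (x.injective.ne hac.symm)
    (x.injective.ne hab.symm)] at hx
  funext s
  simp only [pairDomain, rectDomain, Pi.add_apply, swap_mul_apply_right,
    swap_mul_apply_of_ne x hac.symm hbc.symm, swap_mul_apply_of_ne x hbc hab.symm]
  rw [arc_split h, arc_split hx]
  ring

theorem isEmptyPair_right_wide_end (hab : a ≠ b) (hac : a ≠ c) (hbc : b ≠ c) :
    pairEnd x ((a, b), (c, b)) = pairEnd x ((c, a), (a, b)) := by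
  unfold pairEnd
  ext k
  simp only [Equiv.Perm.mul_apply, Equiv.swap_apply_def]
  grind

end Rectangles

/-! ### Pairs of consecutive rectangles -/

section Juxtaposition

variable {N : ℕ} {x : Equiv.Perm (Fin N)} {a b c d : Fin N}

/-- Consecutive empty rectangles with four different vertical sides commute. -/
theorem isEmptyPair_comm (hac : a ≠ c) (had : a ≠ d) (hbc : b ≠ c) (hbd : b ≠ d)
    (h : IsEmptyPair x ((a, b), (c, d))) : IsEmptyPair x ((c, d), (a, b)) := by
  obtain ⟨⟨hab, h1⟩, ⟨hcd, h2⟩⟩ := h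
  simp only at hab h1 hcd h2
  have xac := x.injective.ne hac
  have xad := x.injective.ne had
  have xbc := x.injective.ne hbc
  have xbd := x.injective.ne hbd
  have h2a := h2 a hac had
  have h2b := h2 b hbc hbd
  have h1c := h1 c hac.symm hbc.symm
  have h1d := h1 d had.symm hbd.symm
  simp only [swap_mul_apply_left, swap_mul_apply_right,
    swap_mul_apply_of_ne x hac.symm hbc.symm, swap_mul_apply_of_ne x had.symm hbd.symm]
    at h2a h2b h2
  refine ⟨⟨hcd, fun k hkc hkd => ?_⟩, ⟨hab, fun k hka hkb => ?_⟩⟩ <;> simp only at *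
  · rintro ⟨k1, k2⟩
    by_cases hka : k = a
    · subst hka
      exact h1d ⟨between_of_cross_right k1 (fun h => h2b ⟨h, k2⟩) hbd.symm,
        between_of_cross_right k2 (fun h => h2a ⟨k1, h⟩) xbd.symm⟩
    by_cases hkb : k = b
    · subst hkb
      exact h1c ⟨between_of_cross_left (fun h => h2a ⟨h, k2⟩) k1 hbc.symm,
        between_of_cross_left (fun h => h2b ⟨k1, h⟩) k2 xbc.symm⟩
    have := h2 k hkc hkd
    rw [swap_mul_apply_of_ne x hka hkb] at this
    exact this ⟨k1, k2⟩
  · rw [swap_mul_apply_of_ne x hac had, swap_mul_apply_of_ne x hbc hbd]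
    rintro ⟨k1, k2⟩
    by_cases hkc : k = c
    · subst hkc
      rw [swap_mul_apply_left] at k2
      exact h2b ⟨between_of_cross_right k1 (fun h => h1d ⟨h, k2⟩) hbd,
        between_of_cross_left (fun h => h1c ⟨k1, h⟩) k2 xad⟩
    by_cases hkd : k = d
    · subst hkd
      rw [swap_mul_apply_right] at k2
      exact h2a ⟨between_of_cross_left (fun h => h1c ⟨h, k2⟩) k1 had,
        between_of_cross_right k2 (fun h => h1d ⟨k1, h⟩) xbd⟩
    rw [swap_mul_apply_of_ne x hkc hkd] at k2
    exact h1 k hka hkb ⟨k1, k2⟩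

theorem isEmptyPair_comm_domain (hac : a ≠ c) (had : a ≠ d) (hbc : b ≠ c) (hbd : b ≠ d) :
    pairDomain x ((a, b), (c, d)) = pairDomain x ((c, d), (a, b)) := by
  funext s
  simp only [pairDomain, rectDomain, Pi.add_apply, swap_mul_apply_of_ne x hac.symm hbc.symm,
    swap_mul_apply_of_ne x had.symm hbd.symm, swap_mul_apply_of_ne x hac had,
    swap_mul_apply_of_ne x hbc hbd]
  ring

theorem isEmptyPair_comm_end (hac : a ≠ c) (had : a ≠ d) (hbc : b ≠ c) (hbd : b ≠ d) :
    pairEnd x ((a, b), (c, d)) = pairEnd x ((c, d), (a, b)) := by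
  unfold pairEnd
  ext k
  simp only [Equiv.Perm.mul_apply, Equiv.swap_apply_def]
  grind

/-- The two rectangles of a pair have the same vertical sides; such pairs are the
decompositions of annuli. -/
def IsAnnular (q : (Fin N × Fin N) × (Fin N × Fin N)) : Prop :=
  q.2 = q.1 ∨ q.2 = q.1.swap

open Classical in
/-- The other decomposition of the domain of a pair of consecutive empty rectangles that is not
an annulus. -/
def recut (x : Equiv.Perm (Fin N)) :
    (Fin N × Fin N) × (Fin N × Fin N) → (Fin N × Fin N) × (Fin N × Fin N)
  | ((a, b), (c, d)) =>
    if c = a then (if Between a b d then ((a, d), (d, b)) else ((b, d), (a, b)))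
    else if d = b then (if Between a b c then ((c, b), (a, c)) else ((c, a), (a, b)))
    else if c = b then
      (if Between (x a) (x b) (x d) then ((a, d), (a, b)) else ((b, d), (a, d)))
    else if d = a then
      (if Between (x a) (x b) (x c) then ((c, b), (a, b)) else ((c, a), (c, b)))
    else ((c, d), (a, b))

/-- Recutting is a fixed point free involution that preserves the final state and the domain. If the
rectangles share one side, the domain is L-shaped and is cut at its concave corner in the other
direction. -/
theorem recut_spec {q : (Fin N × Fin N) × (Fin N × Fin N)} (hq : IsEmptyPair x q)
    (hn : ¬ IsAnnular q) :
    IsEmptyPair x (recut x q) ∧ ¬ IsAnnular (recut x q) ∧ recut x (recut x q) = q ∧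
      recut x q ≠ q ∧ pairEnd x (recut x q) = pairEnd x q ∧
      pairDomain x (recut x q) = pairDomain x q := by
  obtain ⟨⟨a, b⟩, ⟨c, d⟩⟩ := q
  have hab : a ≠ b := hq.1.1
  have hcd : c ≠ d := hq.2.1
  simp only [IsAnnular, Prod.swap, Prod.mk.injEq] at hn
  by_cases h1 : c = a
  · subst h1
    have hbd : b ≠ d := fun h => hn (by simp [h])
    by_cases h2 : Between c b d
    · obtain ⟨h3, h4⟩ := (isEmptyPair_left_narrow hab hcd hbd h2).1 hq
      have e : recut x ((c, b), (c, d)) = ((c, d), (d, b)) := by simp [recut, h2]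
      rw [e]
      refine ⟨h3, ?_, ?_, ?_, (isEmptyPair_left_narrow_end hab hcd hbd).symm,
        (isEmptyPair_left_narrow_domain hab hcd hbd h2 h4).symm⟩
      · simp only [IsAnnular, Prod.swap, Prod.mk.injEq]; grind
      · simp [recut, h4, hcd.symm, hbd]
      · simp only [ne_eq, Prod.mk.injEq]; grind
    · obtain ⟨h3, h4⟩ := (isEmptyPair_left_wide hab hcd hbd h2).1 hq
      have e : recut x ((c, b), (c, d)) = ((b, d), (c, b)) := by simp [recut, h2]
      rw [e]
      refine ⟨h3, ?_, ?_, ?_, (isEmptyPair_left_wide_end hcd hbd).symm,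
        (isEmptyPair_left_wide_domain hab hcd hbd h2 h4).symm⟩
      · simp only [IsAnnular, Prod.swap, Prod.mk.injEq]; grind
      · simp [recut, h4, hab, hbd, hcd]
      · simp only [ne_eq, Prod.mk.injEq]; grind
  by_cases h2 : d = b
  · subst h2
    have hac : a ≠ c := fun h => h1 h.symm
    by_cases h2 : Between a d c
    · obtain ⟨h3, h4⟩ := (isEmptyPair_right_narrow hab hac hcd.symm h2).1 hq
      have e : recut x ((a, d), (c, d)) = ((c, d), (a, c)) := by simp [recut, h2, h1]
      rw [e]
      refine ⟨h3, ?_, ?_, ?_, (isEmptyPair_right_narrow_end hab hac).symm,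
        (isEmptyPair_right_narrow_domain hab hac hcd.symm h2 h4).symm⟩
      · simp only [IsAnnular, Prod.swap, Prod.mk.injEq]; grind
      · simp [recut, h4, hab, hac, hcd]
      · simp only [ne_eq, Prod.mk.injEq]; grind
    · obtain ⟨h3, h4⟩ := (isEmptyPair_right_wide hab hac hcd.symm h2).1 hq
      have e : recut x ((a, d), (c, d)) = ((c, a), (a, d)) := by simp [recut, h2, h1]
      rw [e]
      refine ⟨h3, ?_, ?_, ?_, (isEmptyPair_right_wide_end hab hac hcd.symm).symm,
        (isEmptyPair_right_wide_domain hab hac hcd.symm h2 h4).symm⟩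
      · simp only [IsAnnular, Prod.swap, Prod.mk.injEq]; grind
      · simp [recut, h4, hab.symm, hac]
      · simp only [ne_eq, Prod.mk.injEq]; grind
  by_cases h3 : c = b
  · subst h3
    have had : a ≠ d := fun h => hn (by simp [h])
    by_cases h4 : Between (x a) (x c) (x d)
    · have e : recut x ((a, c), (c, d)) = ((a, d), (a, c)) := by simp [recut, h4, h1, h2]
      have h5 : Between a d c := by
        by_contra h5
        rw [← between_comm hab had hcd] at h5
        exact hq.1.2 d had.symm hcd.symm ⟨h5, h4⟩
      rw [e]
      refine ⟨(isEmptyPair_left_narrow had hab hcd.symm h5).2 ⟨hq, h4⟩, ?_, ?_, ?_,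
        isEmptyPair_left_narrow_end had hab hcd.symm,
        isEmptyPair_left_narrow_domain had hab hcd.symm h5 h4⟩
      · simp only [IsAnnular, Prod.swap, Prod.mk.injEq]; grind
      · simp [recut, h5]
      · simp only [ne_eq, Prod.mk.injEq]; grind
    · have e : recut x ((a, c), (c, d)) = ((c, d), (a, d)) := by simp [recut, h4, h1, h2]
      have h5 : ¬ Between c d a := by
        intro h5
        refine hq.2.2 a hab had ⟨h5, ?_⟩
        simp only [swap_mul_apply_left, swap_mul_apply_right,
          swap_mul_apply_of_ne x had.symm hcd.symm]
        rwa [between_comm (x.injective.ne had) (x.injective.ne hab) (x.injective.ne hcd.symm)]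
      rw [e]
      refine ⟨(isEmptyPair_right_wide hcd hab.symm had.symm h5).2 ⟨hq, h4⟩, ?_, ?_, ?_,
        isEmptyPair_right_wide_end hcd hab.symm had.symm,
        isEmptyPair_right_wide_domain hcd hab.symm had.symm h5 h4⟩
      · simp only [IsAnnular, Prod.swap, Prod.mk.injEq]; grind
      · simp [recut, h5, hab]
      · simp only [ne_eq, Prod.mk.injEq]; grind
  by_cases h4 : d = a
  · subst h4
    have hbc : b ≠ c := fun h => h3 h.symm
    by_cases h5 : Between (x d) (x b) (x c)
    · have e : recut x ((d, b), (c, d)) = ((c, b), (d, b)) := by simp [recut, h5, h1, h2, h3]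
      have h6 : Between c b d := by
        by_contra h6
        rw [between_rotate hbc.symm hcd hab.symm, ← between_comm hab hcd.symm hbc] at h6
        exact hq.1.2 c hcd hbc.symm ⟨h6, h5⟩
      rw [e]
      refine ⟨(isEmptyPair_right_narrow hbc.symm hcd hab.symm h6).2 ⟨hq, h5⟩, ?_, ?_, ?_,
        isEmptyPair_right_narrow_end hbc.symm hcd,
        isEmptyPair_right_narrow_domain hbc.symm hcd hab.symm h6 h5⟩
      · simp only [IsAnnular, Prod.swap, Prod.mk.injEq]; grind
      · simp [recut, h6, hcd.symm]
      · simp only [ne_eq, Prod.mk.injEq]; grind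
    · have e : recut x ((d, b), (c, d)) = ((c, d), (c, b)) := by simp [recut, h5, h1, h2, h3]
      have h6 : ¬ Between c d b := by
        intro h6
        refine hq.2.2 b hbc hab.symm ⟨h6, ?_⟩
        simp only [swap_mul_apply_left, swap_mul_apply_right,
          swap_mul_apply_of_ne x hcd hbc.symm]
        rwa [between_rotate (x.injective.ne hbc.symm) (x.injective.ne hcd)
          (x.injective.ne hab.symm), between_comm (x.injective.ne hcd.symm) (x.injective.ne hab)
          (x.injective.ne hbc.symm)]
      rw [e]
      refine ⟨(isEmptyPair_left_wide hcd hbc.symm hab h6).2 ⟨hq, h5⟩, ?_, ?_, ?_,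
        isEmptyPair_left_wide_end hbc.symm hab,
        isEmptyPair_left_wide_domain hcd hbc.symm hab h6 h5⟩
      · simp only [IsAnnular, Prod.swap, Prod.mk.injEq]; grind
      · simp [recut, h6]
      · simp only [ne_eq, Prod.mk.injEq]; grind
  · have hac : a ≠ c := fun h => h1 h.symm
    have had : a ≠ d := fun h => h4 h.symm
    have hbc : b ≠ c := fun h => h3 h.symm
    have hbd : b ≠ d := fun h => h2 h.symm
    have e : recut x ((a, b), (c, d)) = ((c, d), (a, b)) := by simp [recut, h1, h2, h3, h4]
    rw [e]
    refine ⟨isEmptyPair_comm hac had hbc hbd hq, ?_, ?_, ?_,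
      (isEmptyPair_comm_end hac had hbc hbd).symm,
      (isEmptyPair_comm_domain hac had hbc hbd).symm⟩
    · simp only [IsAnnular, Prod.swap, Prod.mk.injEq]; grind
    · simp [recut, hac, had, hbc, hbd]
    · simp only [ne_eq, Prod.mk.injEq]; grind

end Juxtaposition

/-! ### Annuli of width one -/

section Annuli

variable {N : ℕ} {x : Equiv.Perm (Fin N)} {a b : Fin N}

/-- The domain of the vertical annulus of width one to the right of `β_k`. -/
def columnDomain (k : Fin N) (s : Fin N × Fin N) : ℕ := if s.1 = k then 1 else 0

/-- The domain of the horizontal annulus of height one above `α_l`. -/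
def rowDomain (l : Fin N) (s : Fin N × Fin N) : ℕ := if s.2 = l then 1 else 0

theorem val_finRotate {n : ℕ} (a : Fin (n + 2)) :
    (finRotate (n + 2) a).1 = if a.1 = n + 1 then 0 else a.1 + 1 := by
  rw [coe_finRotate]
  simp [Fin.ext_iff]

theorem between_finRotate {n : ℕ} (a k : Fin (n + 2)) :
    Between a (finRotate (n + 2) a) k ↔ k = a := by
  rw [between_iff, val_finRotate, Fin.ext_iff]
  split_ifs <;> omega

theorem finRotate_ne {n : ℕ} (a : Fin (n + 2)) : a ≠ finRotate (n + 2) a := by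
  rw [ne_eq, Fin.ext_iff, val_finRotate]
  split_ifs <;> omega

theorem forall_not_between_iff {n : ℕ} {a b : Fin (n + 2)} (h : a ≠ b) :
    (∀ k, k ≠ a → k ≠ b → ¬ Between a b k) ↔ b = finRotate (n + 2) a := by
  refine ⟨fun H => ?_, ?_⟩
  · by_contra hb
    refine H _ (finRotate_ne a).symm (Ne.symm hb) ?_
    rw [Fin.ext_iff, val_finRotate] at hb
    have := Fin.val_ne_of_ne h
    rw [between_iff, val_finRotate]
    split_ifs at * <;> omega
  · rintro rfl k hk - h
    exact hk ((between_finRotate a k).1 h)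

theorem isEmptyPair_self_iff {n : ℕ} {x : Equiv.Perm (Fin (n + 2))} (a b : Fin (n + 2)) :
    IsEmptyPair x ((a, b), (a, b)) ↔ b = finRotate (n + 2) a := by
  constructor
  · rintro ⟨⟨hab, h1⟩, ⟨-, h2⟩⟩
    refine (forall_not_between_iff hab).1 fun k hka hkb h => ?_
    have h1 := h1 k hka hkb
    have h2 := h2 k hka hkb
    simp only [swap_mul_apply_left, swap_mul_apply_right, swap_mul_apply_of_ne x hka hkb] at h2
    have h3 := between_swap (x.injective.ne hab) (x k)
    tauto
  · intro h
    have hab : a ≠ b := h ▸ finRotate_ne a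
    have h := (forall_not_between_iff hab).2 h
    exact ⟨⟨hab, fun k hka hkb h1 => h k hka hkb h1.1⟩,
      ⟨hab, fun k hka hkb h1 => h k hka hkb h1.1⟩⟩

theorem isEmptyPair_swap_iff {n : ℕ} {x : Equiv.Perm (Fin (n + 2))} (a b : Fin (n + 2)) :
    IsEmptyPair x ((a, b), (b, a)) ↔ x b = finRotate (n + 2) (x a) := by
  constructor
  · rintro ⟨⟨hab, h1⟩, ⟨-, h2⟩⟩
    refine (forall_not_between_iff (x.injective.ne hab)).1 fun l hla hlb h => ?_
    obtain ⟨k, rfl⟩ := x.surjective l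
    have hka : k ≠ a := fun h => hla (by rw [h])
    have hkb : k ≠ b := fun h => hlb (by rw [h])
    have h1 := h1 k hka hkb
    have h2 := h2 k hkb hka
    simp only [swap_mul_apply_left, swap_mul_apply_right, swap_mul_apply_of_ne x hka hkb] at h2
    have h3 := between_swap hab k
    tauto
  · intro h
    have hab : a ≠ b := by
      rintro rfl
      exact finRotate_ne _ h
    have h := (forall_not_between_iff (x.injective.ne hab)).2 h
    refine ⟨⟨hab, fun k hka hkb h1 =>
      h _ (x.injective.ne hka) (x.injective.ne hkb) h1.2⟩,
      ⟨hab.symm, fun k hkb hka h1 => h _ (x.injective.ne hka) (x.injective.ne hkb) ?_⟩⟩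
    simpa only [swap_mul_apply_left, swap_mul_apply_right,
      swap_mul_apply_of_ne x hka hkb] using h1.2

theorem pairEnd_self (q : Fin N × Fin N) : pairEnd x (q, q) = x := by
  simp [pairEnd, mul_assoc]

theorem pairEnd_swap (q : Fin N × Fin N) : pairEnd x (q, q.swap) = x := by
  simp [pairEnd, mul_assoc, Equiv.swap_comm q.2 q.1]

theorem pairDomain_self (hab : a ≠ b) (s : Fin N × Fin N) :
    pairDomain x ((a, b), (a, b)) s = arc a b s.1 := by
  simp only [pairDomain, rectDomain, Pi.add_apply, swap_mul_apply_left, swap_mul_apply_right]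
  rw [← mul_add, arc_add_swap (x.injective.ne hab), mul_one]

theorem pairDomain_swap (hab : a ≠ b) (s : Fin N × Fin N) :
    pairDomain x ((a, b), (b, a)) s = arc (x a) (x b) s.2 := by
  simp only [pairDomain, rectDomain, Pi.add_apply, swap_mul_apply_left, swap_mul_apply_right]
  rw [← add_mul, arc_add_swap hab, one_mul]

open Classical in
/-- The sum, over all pairs of consecutive empty rectangles starting at `x`, of a quantity that
depends only on the final state and on the total domain. Each domain that is not an annulus is
cut into two rectangles in exactly two ways, so in characteristic two only the annuli of width one
contribute. -/
theorem sum_isEmptyPair {M : Type*} [AddCommMonoid M] (hM : ∀ m : M, m + m = 0)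
    (x : Equiv.Perm (Fin N)) (F : Equiv.Perm (Fin N) → (Fin N × Fin N → ℕ) → M) :
    ∑ q with IsEmptyPair x q, F (pairEnd x q) (pairDomain x q) =
      ∑ k, F x (columnDomain k) + ∑ l, F x (rowDomain l) := by
  have hnon : ∑ q with IsEmptyPair x q ∧ ¬ IsAnnular q, F (pairEnd x q) (pairDomain x q) = 0 := by
    refine Finset.sum_involution (fun q _ => recut x q) ?_ ?_ ?_ ?_
    · intro q hq
      obtain ⟨h1, h2⟩ := (Finset.mem_filter.1 hq).2
      obtain ⟨-, -, -, -, h3, h4⟩ := recut_spec h1 h2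
      rw [h3, h4, hM]
    · intro q hq _
      obtain ⟨h1, h2⟩ := (Finset.mem_filter.1 hq).2
      exact (recut_spec h1 h2).2.2.2.1
    · intro q hq
      obtain ⟨h1, h2⟩ := (Finset.mem_filter.1 hq).2
      exact Finset.mem_filter.2 ⟨Finset.mem_univ _, (recut_spec h1 h2).1, (recut_spec h1 h2).2.1⟩
    · intro q hq
      obtain ⟨h1, h2⟩ := (Finset.mem_filter.1 hq).2
      exact (recut_spec h1 h2).2.2.1
  have hsplit : ∑ q with IsEmptyPair x q, F (pairEnd x q) (pairDomain x q) =
      ∑ q with IsEmptyPair x q ∧ IsAnnular q, F (pairEnd x q) (pairDomain x q) := by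
    rw [← Finset.sum_filter_add_sum_filter_not (Finset.univ.filter (IsEmptyPair x)) IsAnnular,
      Finset.filter_filter, Finset.filter_filter, hnon, add_zero]
  rw [hsplit]
  match N, x, F with
  | 0, x, F => simp
  | 1, x, F =>
    rw [Finset.filter_false_of_mem]
    · have : columnDomain (0 : Fin 1) = rowDomain 0 := by
        funext s
        simp [columnDomain, rowDomain, Subsingleton.elim s.1 0, Subsingleton.elim s.2 0]
      simp [this, hM]
    · rintro q - ⟨⟨⟨h, -⟩, -⟩, -⟩
      exact h (Subsingleton.elim _ _)
  | n + 2, x, F =>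
    have hdisj : ∑ q with IsEmptyPair x q ∧ IsAnnular q, F (pairEnd x q) (pairDomain x q) =
        ∑ q with IsEmptyPair x q ∧ q.2 = q.1, F (pairEnd x q) (pairDomain x q) +
        ∑ q with IsEmptyPair x q ∧ q.2 = q.1.swap, F (pairEnd x q) (pairDomain x q) := by
      rw [← Finset.sum_union]
      · refine Finset.sum_congr ?_ fun _ _ => rfl
        ext q
        simp only [Finset.mem_filter, Finset.mem_univ, true_and, Finset.mem_union]
        unfold IsAnnular
        tauto
      · rw [Finset.disjoint_filter]
        rintro q - ⟨⟨⟨h, -⟩, -⟩, h1⟩ ⟨-, h2⟩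
        exact h (congrArg Prod.fst (h1.symm.trans h2))
    rw [hdisj]
    congr 1
    · refine (Finset.sum_bij (fun k _ => ((k, finRotate (n + 2) k), (k, finRotate (n + 2) k)))
        ?_ ?_ ?_ ?_).symm
      · intro k _
        simp [isEmptyPair_self_iff]
      · intro k _ k' _ h
        exact congrArg (fun q => q.1.1) h
      · rintro ⟨⟨a, b⟩, q⟩ hq
        obtain ⟨h1, h2⟩ := (Finset.mem_filter.1 hq).2
        simp only at h2
        subst h2
        rw [isEmptyPair_self_iff] at h1
        exact ⟨a, Finset.mem_univ _, by rw [← h1]⟩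
      · intro k _
        rw [pairEnd_self]
        congr 1
        funext s
        rw [pairDomain_self (finRotate_ne k)]
        unfold arc columnDomain
        simp only [between_finRotate]
    · refine (Finset.sum_bij (fun l _ =>
        ((x.symm l, x.symm (finRotate (n + 2) l)), (x.symm (finRotate (n + 2) l), x.symm l)))
        ?_ ?_ ?_ ?_).symm
      · intro k _
        simp [isEmptyPair_swap_iff]
      · intro k _ k' _ h
        exact x.symm.injective (congrArg (fun q => q.1.1) h)
      · rintro ⟨⟨a, b⟩, q⟩ hq
        obtain ⟨h1, h2⟩ := (Finset.mem_filter.1 hq).2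
        simp only [Prod.swap] at h2
        subst h2
        rw [isEmptyPair_swap_iff] at h1
        refine ⟨x a, Finset.mem_univ _, ?_⟩
        rw [← h1]
        simp
      · intro l _
        refine congr_arg₂ F (pairEnd_swap _).symm ?_
        funext s
        rw [pairDomain_swap (x.symm.injective.ne (finRotate_ne l))]
        unfold arc rowDomain
        simp only [Equiv.apply_symm_apply, between_finRotate]

end Annuli

/-! ### Maps counting empty rectangles -/

section RectMap

variable {N : ℕ} {R : Type*} [CommRing R]

open Classical in
/-- The linear map on the free module on the states that counts all empty rectangles, each with a
coefficient that depends on its domain. -/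
def rectMap (φ : (Fin N × Fin N → ℕ) → R) :
    (Equiv.Perm (Fin N) →₀ R) →ₗ[R] (Equiv.Perm (Fin N) →₀ R) :=
  Finsupp.linearCombination R fun x =>
    ∑ r with IsEmptyRect x r, Finsupp.single (x * Equiv.swap r.1 r.2) (φ (rectDomain x r))

open Classical in
theorem rectMap_single (φ : (Fin N × Fin N → ℕ) → R) (x : Equiv.Perm (Fin N)) (p : R) :
    rectMap φ (Finsupp.single x p) =
      ∑ r with IsEmptyRect x r,
        Finsupp.single (x * Equiv.swap r.1 r.2) (p * φ (rectDomain x r)) := by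
  rw [rectMap, Finsupp.linearCombination_single, Finset.smul_sum]
  simp

open Classical in
theorem rectMap_rectMap_single (φ ψ : (Fin N × Fin N → ℕ) → R) (x : Equiv.Perm (Fin N)) :
    rectMap ψ (rectMap φ (Finsupp.single x 1)) =
      ∑ q with IsEmptyPair x q, Finsupp.single (pairEnd x q)
        (φ (rectDomain x q.1) * ψ (rectDomain (x * Equiv.swap q.1.1 q.1.2) q.2)) := by
  rw [rectMap_single, map_sum]
  simp only [rectMap_single, one_mul]
  rw [Finset.sum_sigma']
  refine Finset.sum_bij' (fun q _ => (q.1, q.2)) (fun q _ => ⟨q.1, q.2⟩) ?_ ?_ ?_ ?_ ?_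
  · rintro ⟨r, r'⟩ h
    simp only [Finset.mem_sigma, Finset.mem_filter, Finset.mem_univ, true_and] at h
    exact Finset.mem_filter.2 ⟨Finset.mem_univ _, h⟩
  · rintro ⟨r, r'⟩ h
    simp only [Finset.mem_sigma, Finset.mem_filter, Finset.mem_univ, true_and]
    exact (Finset.mem_filter.1 h).2
  · intro _ _; rfl
  · intro _ _; rfl
  · intro _ _; rfl

/-- If `w` applied to the domain of two consecutive rectangles is a sum of products of coefficients
of the two rectangles, then the corresponding sum of compositions is multiplication by the
contributions of the annuli of width one. -/
theorem sum_rectMap_comp [CharP R 2] {ι : Type*} (T : Finset ι)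
    (φ ψ : ι → (Fin N × Fin N → ℕ) → R) (w : (Fin N × Fin N → ℕ) → R)
    (hw : ∀ D D', ∑ t ∈ T, φ t D * ψ t D' = w (D + D')) (z : Equiv.Perm (Fin N) →₀ R) :
    ∑ t ∈ T, rectMap (ψ t) (rectMap (φ t) z) =
      (∑ k, w (columnDomain k) + ∑ l, w (rowDomain l)) • z := by
  classical
  have key : ∑ t ∈ T, rectMap (ψ t) ∘ₗ rectMap (φ t) =
      (∑ k, w (columnDomain k) + ∑ l, w (rowDomain l)) • LinearMap.id := by
    refine Finsupp.lhom_ext' fun x => LinearMap.ext_ring ?_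
    simp only [LinearMap.comp_apply, LinearMap.sum_apply, Finsupp.lsingle_apply,
      rectMap_rectMap_single, LinearMap.smul_apply, LinearMap.id_apply]
    rw [Finset.sum_comm]
    have := sum_isEmptyPair (M := Equiv.Perm (Fin N) →₀ R)
      (fun m => by ext y; exact CharTwo.add_self_eq_zero _) x
      (fun y D => Finsupp.single y (w D))
    rw [← Finsupp.single_finsetSum, ← Finsupp.single_finsetSum, ← Finsupp.single_add] at this
    rw [Finsupp.smul_single, smul_eq_mul, mul_one, ← this]
    refine Finset.sum_congr rfl fun q _ => ?_
    rw [← Finsupp.single_finsetSum, hw]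
    rfl
  have := LinearMap.congr_fun key z
  simpa using this

end RectMap

/-! ### The differential -/

section Differential

variable {N : ℕ} (g : GraphGrid N)

open Classical in
/-- The coefficient with which a rectangle contributes to `∂⁻`. -/
def diffCoeff (D : Fin N × Fin N → ℕ) : MvPolynomial (Fin N) (ZMod 2) :=
  if ∀ s ∈ g.X, D s = 0 then ∏ k, MvPolynomial.X k ^ D (k, g.O k) else 0

open Classical in
theorem rectDomain_apply (x : Equiv.Perm (Fin N)) (r s : Fin N × Fin N) :
    rectDomain x r s = if RectHas r.1 r.2 (x r.1) (x r.2) s then 1 else 0 := by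
  unfold rectDomain arc RectHas
  split_ifs <;> simp_all

theorem rectDomain_eq_zero_iff (x : Equiv.Perm (Fin N)) (r s : Fin N × Fin N) :
    rectDomain x r s = 0 ↔ ¬ RectHas r.1 r.2 (x r.1) (x r.2) s := by
  rw [rectDomain_apply]
  split_ifs <;> simp_all

theorem diff_eq_rectMap : g.diff = rectMap g.diffCoeff := by
  classical
  refine Finsupp.lhom_ext' fun x => LinearMap.ext_ring ?_
  rw [LinearMap.comp_apply, LinearMap.comp_apply, Finsupp.lsingle_apply, rectMap_single, diff,
    Finsupp.linearCombination_single, one_smul]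
  have h : ∀ y : g.State, Finsupp.single y (∑ r ∈ g.rects x y, g.rectMonomial x r) =
      ∑ r with IsEmptyRect x r, if y = x * Equiv.swap r.1 r.2 then
        Finsupp.single y (1 * g.diffCoeff (rectDomain x r)) else 0 := by
    intro y
    rw [Finsupp.single_finsetSum, ← Finset.sum_filter, Finset.filter_filter]
    refine Finset.sum_subset_zero_on_sdiff ?_ ?_ ?_
    · intro r hr
      obtain ⟨h1, h2, h3, h4⟩ := (Finset.mem_filter.1 hr).2
      exact Finset.mem_filter.2 ⟨Finset.mem_univ _, (isEmptyRect_iff x r).2 ⟨h1, h3⟩, h2⟩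
    · intro r hr
      obtain ⟨hr1, hr2⟩ := Finset.mem_sdiff.1 hr
      obtain ⟨h1, h2⟩ := (Finset.mem_filter.1 hr1).2
      have h3 := (isEmptyRect_iff x r).1 h1
      rw [one_mul, diffCoeff, if_neg, Finsupp.single_zero]
      intro h4
      refine hr2 (Finset.mem_filter.2 ⟨Finset.mem_univ _, h3.1, h2, h3.2, fun s hs => ?_⟩)
      exact (rectDomain_eq_zero_iff x r s).1 (h4 s hs)
    · intro r hr
      obtain ⟨h1, h2, h3, h4⟩ := (Finset.mem_filter.1 hr).2
      rw [one_mul, diffCoeff, if_pos fun s hs => (rectDomain_eq_zero_iff x r s).2 (h4 s hs),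
        rectMonomial]
      congr 1
      refine Finset.prod_congr rfl fun k _ => ?_
      rw [rectDomain_apply]
      split_ifs <;> simp
  simp only [h]
  rw [Finset.sum_comm]
  refine Finset.sum_congr rfl fun r _ => ?_
  rw [Finset.sum_ite_eq' Finset.univ, if_pos (Finset.mem_univ _)]

theorem diffCoeff_add (D D' : Fin N × Fin N → ℕ) :
    g.diffCoeff D * g.diffCoeff D' = g.diffCoeff (D + D') := by
  unfold diffCoeff
  by_cases h : ∀ s ∈ g.X, D s = 0
  · by_cases h' : ∀ s ∈ g.X, D' s = 0
    · rw [if_pos h, if_pos h', if_pos fun s hs => by simp [h s hs, h' s hs],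
        ← Finset.prod_mul_distrib]
      simp [pow_add]
    · rw [if_neg h', mul_zero, if_neg]
      exact fun H => h' fun s hs => (Nat.add_eq_zero_iff.1 (H s hs)).2
  · rw [if_neg h, zero_mul, if_neg]
    exact fun H => h fun s hs => (Nat.add_eq_zero_iff.1 (H s hs)).1

/-- Every annulus of width one contains an `X`, so that no contribution to `∂⁻ ∘ ∂⁻` remains. -/
theorem diff_diff (z : g.CF) : g.diff (g.diff z) = 0 := by
  have := sum_rectMap_comp (Finset.univ : Finset Unit) (fun _ => g.diffCoeff)
    (fun _ => g.diffCoeff) g.diffCoeff (fun D D' => by simp [diffCoeff_add]) z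
  rw [diff_eq_rectMap]
  simp only [Finset.univ_unique, Finset.sum_singleton] at this
  rw [this, Finset.sum_eq_zero, Finset.sum_eq_zero, add_zero, zero_smul]
  · intro l _
    obtain ⟨k, hk⟩ := g.X_row l
    exact if_neg fun h => by simpa [rowDomain] using h _ hk
  · intro k _
    obtain ⟨l, hl⟩ := g.X_col k
    exact if_neg fun h => by simpa [columnDomain] using h _ hl

end Differential

/-! ### Decomposition of the differential at one marking of each kind -/

section SelectedCoefficients

variable {N : ℕ} (g : GraphGrid N) (t : Fin N × Fin N) (a : Fin N)

open Classical in
/-- The coefficient of a rectangle whose domain has multiplicity `p` at the square `t`, multiplicity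
`q` at the `O` in column `a`, and contains no `X` outside `t`. The variable of the `O` in column
`a` is left out. -/
def selCoeff (p q : ℕ) (D : Fin N × Fin N → ℕ) : MvPolynomial (Fin N) (ZMod 2) :=
  if (∀ s ∈ g.X, s ≠ t → D s = 0) ∧ D t = p ∧ D (a, g.O a) = q then
    ∏ k with k ≠ a, MvPolynomial.X k ^ D (k, g.O k) else 0

/-- The contribution of the annuli of width one to the compositions of maps that count the
rectangles selected by `selCoeff`. -/
def selAnnuli (p q : ℕ) : MvPolynomial (Fin N) (ZMod 2) :=
  ∑ k, g.selCoeff t a p q (columnDomain k) + ∑ l, g.selCoeff t a p q (rowDomain l)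

theorem sum_selCoeff_mul (p q : ℕ) (D D' : Fin N × Fin N → ℕ) :
    ∑ e ∈ Finset.HasAntidiagonal.antidiagonal p ×ˢ Finset.HasAntidiagonal.antidiagonal q,
      g.selCoeff t a e.1.1 e.2.1 D * g.selCoeff t a e.1.2 e.2.2 D' =
      g.selCoeff t a p q (D + D') := by
  by_cases h : (∀ s ∈ g.X, s ≠ t → (D + D') s = 0) ∧ (D + D') t = p ∧ (D + D') (a, g.O a) = q
  · obtain ⟨h1, h2, h3⟩ := h
    rw [Finset.sum_eq_single ((D t, D' t), (D (a, g.O a), D' (a, g.O a)))]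
    · simp only [Pi.add_apply] at h1 h2 h3
      rw [selCoeff, selCoeff, selCoeff,
        if_pos ⟨fun s hs ht => (Nat.add_eq_zero_iff.1 (h1 s hs ht)).1, rfl, rfl⟩,
        if_pos ⟨fun s hs ht => (Nat.add_eq_zero_iff.1 (h1 s hs ht)).2, rfl, rfl⟩,
        if_pos ⟨h1, h2, h3⟩, ← Finset.prod_mul_distrib]
      simp [pow_add]
    · rintro ⟨⟨p1, p2⟩, ⟨q1, q2⟩⟩ - hne
      simp only [selCoeff]
      split_ifs with h4 h5
      · exact absurd (by rw [h4.2.1, h4.2.2, h5.2.1, h5.2.2]) hne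
      all_goals simp
    · intro hn
      exact absurd (Finset.mem_product.2
        ⟨Finset.HasAntidiagonal.mem_antidiagonal.2 h2,
          Finset.HasAntidiagonal.mem_antidiagonal.2 h3⟩) hn
  · rw [selCoeff, if_neg h]
    refine Finset.sum_eq_zero ?_
    rintro ⟨⟨p1, p2⟩, ⟨q1, q2⟩⟩ he
    rw [Finset.mem_product, Finset.HasAntidiagonal.mem_antidiagonal,
      Finset.HasAntidiagonal.mem_antidiagonal] at he
    simp only at he
    simp only [selCoeff]
    split_ifs with h4 h5
    · refine absurd ⟨fun s hs ht => ?_, ?_, ?_⟩ h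
      · simp [h4.1 s hs ht, h5.1 s hs ht]
      · rw [Pi.add_apply, h4.2.1, h5.2.1, he.1]
      · rw [Pi.add_apply, h4.2.2, h5.2.2, he.2]
    all_goals simp

/-- The map that counts the rectangles selected by `selCoeff`. -/
def selMap (p q : ℕ) : g.CF →ₗ[MvPolynomial (Fin N) (ZMod 2)] g.CF :=
  rectMap (g.selCoeff t a p q)

/-- Juxtaposed rectangles with total multiplicities `p` at `t` and `q` at the `O` in column `a`
cancel in pairs, except for the annuli of width one. -/
theorem sum_selMap_selMap (p q : ℕ) (z : g.CF) :
    ∑ e ∈ Finset.HasAntidiagonal.antidiagonal p ×ˢ Finset.HasAntidiagonal.antidiagonal q,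
      g.selMap t a e.1.2 e.2.2 (g.selMap t a e.1.1 e.2.1 z) = g.selAnnuli t a p q • z := by
  have h := sum_rectMap_comp
    (Finset.HasAntidiagonal.antidiagonal p ×ˢ Finset.HasAntidiagonal.antidiagonal q)
    (fun e => g.selCoeff t a e.1.1 e.2.1) (fun e => g.selCoeff t a e.1.2 e.2.2)
    (g.selCoeff t a p q) (g.sum_selCoeff_mul t a p q) z
  exact h

theorem rectDomain_le_one (x : Equiv.Perm (Fin N)) (r s : Fin N × Fin N) :
    rectDomain x r s ≤ 1 := by
  unfold rectDomain arc
  split_ifs <;> simp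

variable {t} in
/-- The differential counts the rectangles avoiding all `X`; those through the `O` in column `a`
come with its variable. -/
theorem diff_eq_selMap (ht : t ∈ g.X) (z : g.CF) :
    g.diff z = g.selMap t a 0 0 z + (MvPolynomial.X a : MvPolynomial (Fin N) (ZMod 2)) •
      g.selMap t a 0 1 z := by
  classical
  have : g.diff = g.selMap t a 0 0 + (MvPolynomial.X a : MvPolynomial (Fin N) (ZMod 2)) •
      g.selMap t a 0 1 := by
    refine Finsupp.lhom_ext' fun x => LinearMap.ext_ring ?_
    simp only [LinearMap.comp_apply, LinearMap.add_apply, LinearMap.smul_apply, diff_eq_rectMap,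
      selMap, Finsupp.lsingle_apply, rectMap_single, Finset.smul_sum, Finsupp.smul_single,
      smul_eq_mul, one_mul]
    rw [← Finset.sum_add_distrib]
    refine Finset.sum_congr rfl fun r _ => ?_
    rw [← Finsupp.single_add]
    congr 1
    set D := rectDomain x r
    have hD : D (a, g.O a) ≤ 1 := rectDomain_le_one x r _
    have hX : (∀ s ∈ g.X, D s = 0) ↔ (∀ s ∈ g.X, s ≠ t → D s = 0) ∧ D t = 0 := by
      refine ⟨fun h => ⟨fun s hs _ => h s hs, h t ht⟩, fun h s hs => ?_⟩
      by_cases hst : s = t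
      · rw [hst, h.2]
      · exact h.1 s hs hst
    have hprod : ∏ k, (MvPolynomial.X k : MvPolynomial (Fin N) (ZMod 2)) ^ D (k, g.O k) =
        MvPolynomial.X a ^ D (a, g.O a) * ∏ k with k ≠ a, MvPolynomial.X k ^ D (k, g.O k) := by
      rw [← Finset.mul_prod_erase _ _ (Finset.mem_univ a)]
      congr 2
      ext k; simp
    rw [diffCoeff, selCoeff, selCoeff, hprod]
    simp only [← and_assoc, ← hX]
    rcases Nat.le_one_iff_eq_zero_or_eq_one.1 hD with h | h <;> rw [h] <;>
      by_cases h' : ∀ s ∈ g.X, D s = 0 <;> simp only [h'] <;> simp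
  rw [this]
  simp

variable {t a}

theorem selAnnuli_zero (q : ℕ) : g.selAnnuli t a 0 q = 0 := by
  unfold selAnnuli selCoeff
  rw [Finset.sum_eq_zero, Finset.sum_eq_zero, add_zero]
  · intro l _
    obtain ⟨k, hk⟩ := g.X_row l
    refine if_neg fun h => ?_
    by_cases hkt : (k, l) = t
    · have := h.2.1
      subst hkt
      simp [rowDomain] at this
    · simpa [rowDomain] using h.1 _ hk hkt
  · intro k _
    obtain ⟨l, hl⟩ := g.X_col k
    refine if_neg fun h => ?_
    by_cases hkt : (k, l) = t
    · have := h.2.1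
      subst hkt
      simp [columnDomain] at this
    · simpa [columnDomain] using h.1 _ hl hkt

/-- The square `t` contains the only `X` in the row, or the only `X` in the column, of the `O` in
column `a`. -/
def IsOnlyX (t : Fin N × Fin N) (a : Fin N) : Prop :=
  t ∈ g.X ∧ ((t.2 = g.O a ∧ ∀ k, (k, g.O a) ∈ g.X → (k, g.O a) = t) ∨
    (t.1 = a ∧ ∀ l, (a, l) ∈ g.X → (a, l) = t))

variable {g}

/-- The only annulus of width one that contains the `X` in `t`, no other `X`, and the `O` in column
`a` is the line through both of them. -/
theorem IsOnlyX.selAnnuli_one_one (h : g.IsOnlyX t a) : g.selAnnuli t a 1 1 = 1 := by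
  obtain ⟨ht, h⟩ := h
  have hne : ¬ (t.1 = a ∧ t.2 = g.O a) := by
    rintro ⟨h1, h2⟩
    refine g.disj a ?_
    rw [← h1] at h2 ⊢
    rw [← h2]
    exact ht
  unfold selAnnuli
  rcases h with ⟨h1, h2⟩ | ⟨h1, h2⟩
  · have h3 : t.1 ≠ a := fun h => hne ⟨h, h1⟩
    rw [Finset.sum_eq_zero, zero_add, Finset.sum_eq_single (g.O a)]
    · rw [selCoeff, if_pos, Finset.prod_eq_one]
      · intro k hk
        have : k ≠ a := by simpa using hk
        simp [rowDomain, this]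
      · refine ⟨fun s hs hst => ?_, ?_, ?_⟩
        · refine if_neg fun h4 => hst ?_
          have := h2 s.1 (by rw [← h4]; exact hs)
          rwa [← h4] at this
        · simp [rowDomain, h1]
        · simp [rowDomain]
    · intro l _ hl
      refine if_neg fun h4 => ?_
      simpa [rowDomain, Ne.symm hl] using h4.2.2
    · simp
    · intro k _
      refine if_neg fun h4 => h3 ?_
      have h5 := h4.2.1
      have h6 := h4.2.2
      simp only [columnDomain, ite_eq_left_iff, zero_ne_one, imp_false, not_not] at h5 h6
      rw [h5, h6]
  · have h3 : t.2 ≠ g.O a := fun h => hne ⟨h1, h⟩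
    rw [add_comm, Finset.sum_eq_zero, zero_add, Finset.sum_eq_single a]
    · rw [selCoeff, if_pos, Finset.prod_eq_one]
      · intro k hk
        have : k ≠ a := by simpa using hk
        simp [columnDomain, this]
      · refine ⟨fun s hs hst => ?_, ?_, ?_⟩
        · refine if_neg fun h4 => hst ?_
          have := h2 s.2 (by rw [← h4]; exact hs)
          rwa [← h4] at this
        · simp [columnDomain, h1]
        · simp [columnDomain]
    · intro l _ hl
      refine if_neg fun h4 => ?_
      simpa [columnDomain, Ne.symm hl] using h4.2.2
    · simp
    · intro k _
      refine if_neg fun h4 => h3 ?_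
      have h5 := h4.2.1
      have h6 := h4.2.2
      simp only [rowDomain, ite_eq_left_iff, zero_ne_one, imp_false, not_not] at h5 h6
      rw [h5, h6]

variable (g t a)

theorem selMap_comp_zero_one (z : g.CF) :
    g.selMap t a 0 1 (g.selMap t a 0 0 z) + g.selMap t a 0 0 (g.selMap t a 0 1 z) = 0 := by
  have := g.sum_selMap_selMap t a 0 1 z
  rw [selAnnuli_zero, zero_smul] at this
  simpa [Finset.sum_product, Finset.Nat.antidiagonal_succ] using this

theorem selMap_comp_one_zero (z : g.CF) :
    g.selMap t a 1 0 (g.selMap t a 0 0 z) + g.selMap t a 0 0 (g.selMap t a 1 0 z) =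
      g.selAnnuli t a 1 0 • z := by
  have := g.sum_selMap_selMap t a 1 0 z
  simpa [Finset.sum_product, Finset.Nat.antidiagonal_succ] using this

variable {g t a} in
theorem IsOnlyX.selMap_comp_one_one (h : g.IsOnlyX t a) (z : g.CF) :
    g.selMap t a 1 1 (g.selMap t a 0 0 z) + g.selMap t a 1 0 (g.selMap t a 0 1 z) +
      (g.selMap t a 0 1 (g.selMap t a 1 0 z) + g.selMap t a 0 0 (g.selMap t a 1 1 z)) = z := by
  have := g.sum_selMap_selMap t a 1 1 z
  rw [h.selAnnuli_one_one, one_smul] at this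
  simpa [Finset.sum_product, Finset.Nat.antidiagonal_succ] using this

end SelectedCoefficients

/-! ### Rectangles near the distinguished intersection point -/

section Block

variable {n : ℕ} (i j : Fin n)

theorem between_castSucc_succ_iff {a b : Fin (n + 1)} (h : a ≠ b) :
    (Between a b j.castSucc ∧ ¬ Between a b j.succ ↔ b = j.succ) ∧
    (¬ Between a b j.castSucc ∧ Between a b j.succ ↔ a = j.succ) := by
  have := Fin.val_ne_of_ne h
  have := j.2
  have := a.2
  have := b.2
  simp only [between_iff, Fin.ext_iff, Fin.val_castSucc, Fin.val_succ]
  omega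

/-- The state contains the intersection point at the centre of the block. -/
def IsInner (x : Equiv.Perm (Fin (n + 1))) : Prop := x j.succ = i.succ

/-- The squares to the left and right of `β_{j+1}` and those below and above `α_{i+1}`
inside a rectangle determine whether its initial and final states contain the centre of the
block. -/
theorem isInner_cases (x : Equiv.Perm (Fin (n + 1))) {r : Fin (n + 1) × Fin (n + 1)}
    (hr : r.1 ≠ r.2) :
    ∃ S₀ S₁ T₀ T₁ : Prop,
      ((rectDomain x r (j.castSucc, i.castSucc) = 0 ↔ ¬ (S₀ ∧ T₀)) ∧
        (rectDomain x r (j.castSucc, i.succ) = 0 ↔ ¬ (S₀ ∧ T₁)) ∧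
        (rectDomain x r (j.succ, i.castSucc) = 0 ↔ ¬ (S₁ ∧ T₀)) ∧
        (rectDomain x r (j.succ, i.succ) = 0 ↔ ¬ (S₁ ∧ T₁))) ∧
      ((S₀ ∧ ¬ S₁ ∧ T₀ ∧ ¬ T₁ ∨ ¬ S₀ ∧ S₁ ∧ ¬ T₀ ∧ T₁) ∧
          IsInner i j x ∧ ¬ IsInner i j (x * Equiv.swap r.1 r.2) ∨
        (¬ S₀ ∧ S₁ ∧ T₀ ∧ ¬ T₁ ∨ S₀ ∧ ¬ S₁ ∧ ¬ T₀ ∧ T₁) ∧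
          ¬ IsInner i j x ∧ IsInner i j (x * Equiv.swap r.1 r.2) ∨
        (S₀ ↔ S₁) ∧ (T₀ ↔ T₁) ∧ IsInner i j x ∧ IsInner i j (x * Equiv.swap r.1 r.2) ∨
        ¬ ((S₀ ∧ ¬ S₁ ∨ ¬ S₀ ∧ S₁) ∧ (T₀ ∧ ¬ T₁ ∨ ¬ T₀ ∧ T₁)) ∧
          ¬ IsInner i j x ∧ ¬ IsInner i j (x * Equiv.swap r.1 r.2)) := by
  obtain ⟨a, b⟩ := r
  simp only at hr
  refine ⟨Between a b j.castSucc, Between a b j.succ, Between (x a) (x b) i.castSucc,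
    Between (x a) (x b) i.succ, ?_, ?_⟩
  · simp only [rectDomain_eq_zero_iff, RectHas]
    simp
  · obtain ⟨h1, h2⟩ := between_castSucc_succ_iff j hr
    obtain ⟨h3, h4⟩ := between_castSucc_succ_iff i (x.injective.ne hr)
    simp only [IsInner]
    by_cases ha : a = j.succ
    · rw [show (x * Equiv.swap a b) j.succ = x b by rw [← ha, swap_mul_apply_left],
        show x j.succ = x a by rw [ha]]
      have := x.injective.ne hr
      generalize x a = p at *
      generalize x b = q at *
      grind only
    by_cases hb : b = j.succ
    · rw [show (x * Equiv.swap a b) j.succ = x a by rw [← hb, swap_mul_apply_right],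
        show x j.succ = x b by rw [hb]]
      have := x.injective.ne hr
      generalize x a = p at *
      generalize x b = q at *
      grind only
    rw [swap_mul_apply_of_ne x (Ne.symm ha) (Ne.symm hb)]
    have ha' := x.injective.ne ha
    have hb' := x.injective.ne hb
    generalize x a = p at *
    generalize x b = q at *
    generalize x j.succ = m at *
    grind only

variable {i j}

/-- The square `t` is the upper left or the lower right square of the block and `t'` is the other
one of these two. -/
def IsDiagonal (i j : Fin n) (t t' : Fin (n + 1) × Fin (n + 1)) : Prop :=
  (t = (j.castSucc, i.succ) ∧ t' = (j.succ, i.castSucc)) ∨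
    (t = (j.succ, i.castSucc) ∧ t' = (j.castSucc, i.succ))

/-- The square `A` is the lower left or the upper right square of the block. -/
def IsAntidiagonal (i j : Fin n) (A : Fin (n + 1) × Fin (n + 1)) : Prop :=
  A = (j.castSucc, i.castSucc) ∨ A = (j.succ, i.succ)

variable {x : Equiv.Perm (Fin (n + 1))} {r t t' A : Fin (n + 1) × Fin (n + 1)}

theorem isInner_of_swap (hr : r.1 ≠ r.2) (hd : IsDiagonal i j t t') (ht : rectDomain x r t = 0)
    (ht' : rectDomain x r t' = 0) (hy : IsInner i j (x * Equiv.swap r.1 r.2)) : IsInner i j x := by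
  obtain ⟨S₀, S₁, T₀, T₁, ⟨h1, h2, h3, h4⟩, h'⟩ := isInner_cases i j x hr
  rcases hd with ⟨rfl, rfl⟩ | ⟨rfl, rfl⟩ <;> grind only

theorem isInner_of_mem_antidiagonal (hr : r.1 ≠ r.2) (hd : IsDiagonal i j t t')
    (hA : IsAntidiagonal i j A) (h0 : rectDomain x r A ≠ 0)
    (ht : rectDomain x r t = 0) (ht' : rectDomain x r t' = 0) :
    IsInner i j x ∧ ¬ IsInner i j (x * Equiv.swap r.1 r.2) := by
  obtain ⟨S₀, S₁, T₀, T₁, ⟨h1, h2, h3, h4⟩, h'⟩ := isInner_cases i j x hr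
  rcases hA with rfl | rfl <;> rcases hd with ⟨rfl, rfl⟩ | ⟨rfl, rfl⟩ <;> grind only

theorem not_isInner_of_mem_diagonal (hr : r.1 ≠ r.2) (hd : IsDiagonal i j t t')
    (ht : rectDomain x r t ≠ 0) (ht' : rectDomain x r t' = 0) : ¬ IsInner i j x := by
  obtain ⟨S₀, S₁, T₀, T₁, ⟨h1, h2, h3, h4⟩, h'⟩ := isInner_cases i j x hr
  rcases hd with ⟨rfl, rfl⟩ | ⟨rfl, rfl⟩ <;> grind only

theorem not_isInner_swap_of_mem (hr : r.1 ≠ r.2) (hd : IsDiagonal i j t t')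
    (hA : IsAntidiagonal i j A) (h0 : rectDomain x r A ≠ 0) (ht : rectDomain x r t ≠ 0)
    (ht' : rectDomain x r t' = 0) : ¬ IsInner i j (x * Equiv.swap r.1 r.2) := by
  obtain ⟨S₀, S₁, T₀, T₁, ⟨h1, h2, h3, h4⟩, h'⟩ := isInner_cases i j x hr
  rcases hA with rfl | rfl <;> rcases hd with ⟨rfl, rfl⟩ | ⟨rfl, rfl⟩ <;> grind only

open Classical in
/-- The projection of `CF⁻(g)` to the span of the states that contain the centre of the block. -/
def innerProj (i j : Fin n) (g : GraphGrid (n + 1)) :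
    g.CF →ₗ[MvPolynomial (Fin (n + 1)) (ZMod 2)] g.CF where
  toFun z := Finsupp.filter (IsInner i j) z
  map_add' _ _ := Finsupp.filter_add
  map_smul' _ _ := Finsupp.filter_smul

variable {g : GraphGrid (n + 1)} {a : Fin (n + 1)}

open Classical in
theorem innerProj_single_of_isInner (hx : IsInner i j x)
    (c : MvPolynomial (Fin (n + 1)) (ZMod 2)) :
    innerProj i j g (Finsupp.single x c) = Finsupp.single x c :=
  Finsupp.filter_single_of_pos _ hx

open Classical in
theorem innerProj_single_of_not_isInner (hx : ¬ IsInner i j x)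
    (c : MvPolynomial (Fin (n + 1)) (ZMod 2)) :
    innerProj i j g (Finsupp.single x c) = 0 :=
  Finsupp.filter_single_of_neg _ hx

open Classical in
theorem innerProj_apply (z : g.CF) (x : g.State) :
    innerProj i j g z x = if IsInner i j x then z x else 0 := by
  simp only [innerProj, LinearMap.coe_mk, AddHom.coe_mk, Finsupp.filter_apply]

theorem innerProj_innerProj (z : g.CF) :
    innerProj i j g (innerProj i j g z) = innerProj i j g z := by
  ext1 x
  simp only [innerProj_apply]
  split_ifs <;> rfl

theorem selCoeff_ne_zero {p q : ℕ} {D : Fin (n + 1) × Fin (n + 1) → ℕ}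
    (h : g.selCoeff t a p q D ≠ 0) :
    (∀ s ∈ g.X, s ≠ t → D s = 0) ∧ D t = p ∧ D (a, g.O a) = q := by
  unfold selCoeff at h
  by_contra H
  exact h (if_neg H)

theorem innerProj_selMap_single {p q : ℕ} (c : MvPolynomial (Fin (n + 1)) (ZMod 2))
    (h : ∀ r : Fin (n + 1) × Fin (n + 1), r.1 ≠ r.2 → g.selCoeff t a p q (rectDomain x r) ≠ 0 →
      ¬ IsInner i j (x * Equiv.swap r.1 r.2)) :
    innerProj i j g (g.selMap t a p q (Finsupp.single x c)) = 0 := by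
  classical
  rw [selMap, rectMap_single, map_sum]
  refine Finset.sum_eq_zero fun r hr => ?_
  by_cases h0 : g.selCoeff t a p q (rectDomain x r) = 0
  · simp [h0]
  · exact innerProj_single_of_not_isInner (h r (Finset.mem_filter.1 hr).2.1 h0) _

theorem selMap_single_eq_zero {p q : ℕ} (c : MvPolynomial (Fin (n + 1)) (ZMod 2))
    (h : ∀ r : Fin (n + 1) × Fin (n + 1), r.1 ≠ r.2 →
      ¬ g.selCoeff t a p q (rectDomain x r) ≠ 0) :
    g.selMap t a p q (Finsupp.single x c) = 0 := by
  classical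
  rw [selMap, rectMap_single]
  refine Finset.sum_eq_zero fun r hr => ?_
  rw [not_not.1 (h r (Finset.mem_filter.1 hr).2.1), mul_zero, Finsupp.single_zero]

variable (g a) in
/-- The marking `A` in column `a`, the `X` in the square `t` and the `X` in the square `t'` are
placed around the intersection point as the move requires. -/
structure IsBlock (i j : Fin n) (t t' : Fin (n + 1) × Fin (n + 1)) : Prop where
  diagonal : IsDiagonal i j t t'
  antidiagonal : IsAntidiagonal i j (a, g.O a)
  mem : t ∈ g.X
  mem' : t' ∈ g.X

theorem IsDiagonal.ne (h : IsDiagonal i j t t') : t' ≠ t := by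
  rcases h with ⟨rfl, rfl⟩ | ⟨rfl, rfl⟩ <;> simp [Fin.ext_iff]

namespace IsBlock

variable (h : IsBlock g a i j t t')
include h

/-- The states that do not contain the centre of the block span a subcomplex. -/
theorem innerProj_selMap_zero_zero (z : g.CF) :
    innerProj i j g (g.selMap t a 0 0 (innerProj i j g z)) =
      innerProj i j g (g.selMap t a 0 0 z) := by
  refine LinearMap.congr_fun (f := innerProj i j g ∘ₗ g.selMap t a 0 0 ∘ₗ innerProj i j g)
    (g := innerProj i j g ∘ₗ g.selMap t a 0 0) (Finsupp.lhom_ext fun x c => ?_) z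
  simp only [LinearMap.comp_apply]
  by_cases hx : IsInner i j x
  · rw [innerProj_single_of_isInner hx]
  · rw [innerProj_single_of_not_isInner hx, map_zero, map_zero, innerProj_selMap_single]
    intro r hr h0 hy
    obtain ⟨h1, h2, -⟩ := selCoeff_ne_zero h0
    exact hx (isInner_of_swap hr h.diagonal h2 (h1 _ h.mem' h.diagonal.ne) hy)

theorem innerProj_selMap_zero_one (z : g.CF) :
    innerProj i j g (g.selMap t a 0 1 z) = 0 := by
  refine LinearMap.congr_fun (f := innerProj i j g ∘ₗ g.selMap t a 0 1)
    (g := 0) (Finsupp.lhom_ext fun x c => ?_) z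
  refine innerProj_selMap_single c fun r hr h0 => ?_
  obtain ⟨h1, h2, h3⟩ := selCoeff_ne_zero h0
  exact (isInner_of_mem_antidiagonal hr h.diagonal h.antidiagonal (h3.trans_ne one_ne_zero) h2
    (h1 _ h.mem' h.diagonal.ne)).2

theorem selMap_zero_one_innerProj (z : g.CF) :
    g.selMap t a 0 1 (innerProj i j g z) = g.selMap t a 0 1 z := by
  refine LinearMap.congr_fun (f := g.selMap t a 0 1 ∘ₗ innerProj i j g)
    (g := g.selMap t a 0 1) (Finsupp.lhom_ext fun x c => ?_) z
  simp only [LinearMap.comp_apply]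
  by_cases hx : IsInner i j x
  · rw [innerProj_single_of_isInner hx]
  · rw [innerProj_single_of_not_isInner hx, map_zero, selMap_single_eq_zero]
    intro r hr h0
    obtain ⟨h1, h2, h3⟩ := selCoeff_ne_zero h0
    exact hx (isInner_of_mem_antidiagonal hr h.diagonal h.antidiagonal (h3.trans_ne one_ne_zero) h2
      (h1 _ h.mem' h.diagonal.ne)).1

theorem selMap_one_zero_innerProj (z : g.CF) :
    g.selMap t a 1 0 (innerProj i j g z) = 0 := by
  refine LinearMap.congr_fun (f := g.selMap t a 1 0 ∘ₗ innerProj i j g)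
    (g := 0) (Finsupp.lhom_ext fun x c => ?_) z
  simp only [LinearMap.comp_apply]
  by_cases hx : IsInner i j x
  · rw [innerProj_single_of_isInner hx, selMap_single_eq_zero, LinearMap.zero_apply]
    intro r hr h0
    obtain ⟨h1, h2, h3⟩ := selCoeff_ne_zero h0
    exact not_isInner_of_mem_diagonal hr h.diagonal (h2.trans_ne one_ne_zero)
      (h1 _ h.mem' h.diagonal.ne) hx
  · rw [innerProj_single_of_not_isInner hx, map_zero, LinearMap.zero_apply]

theorem innerProj_selMap_one_one (z : g.CF) :
    innerProj i j g (g.selMap t a 1 1 z) = 0 := by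
  refine LinearMap.congr_fun (f := innerProj i j g ∘ₗ g.selMap t a 1 1)
    (g := 0) (Finsupp.lhom_ext fun x c => ?_) z
  refine innerProj_selMap_single c fun r hr h0 => ?_
  obtain ⟨h1, h2, h3⟩ := selCoeff_ne_zero h0
  exact not_isInner_swap_of_mem hr h.diagonal h.antidiagonal (h3.trans_ne one_ne_zero)
    (h2.trans_ne one_ne_zero) (h1 _ h.mem' h.diagonal.ne)

end IsBlock

end Block

/-! ### The algebra of the destabilization map -/

section Algebra

variable {n : ℕ} {i j : Fin n} {t t' : Fin (n + 1) × Fin (n + 1)} {g : GraphGrid (n + 1)}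
  {a : Fin (n + 1)}

theorem add_self_eq_zero_of_CF {N : ℕ} {g : GraphGrid N} (z : g.CF) : z + z = 0 := by
  ext1 x
  exact CharTwo.add_self_eq_zero _

theorem eq_of_add_eq_zero_of_CF {N : ℕ} {g : GraphGrid N} {z w : g.CF} (h : z + w = 0) :
    z = w := by
  rw [← add_left_inj w, h, add_self_eq_zero_of_CF]

namespace IsBlock

variable (h : IsBlock g a i j t t')
include h

theorem innerProj_diff_innerProj (z : g.CF) :
    innerProj i j g (g.diff (innerProj i j g z)) = innerProj i j g (g.diff z) := by
  simp only [g.diff_eq_selMap a h.mem, map_add, map_smul, h.innerProj_selMap_zero_one,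
    h.innerProj_selMap_zero_zero]

/-- Counting the rectangles through `A` is a chain map from the quotient complex of the states
containing the centre of the block. -/
theorem diff_selMap_zero_one (z : g.CF) :
    g.diff (g.selMap t a 0 1 z) = g.selMap t a 0 1 (innerProj i j g (g.diff z)) := by
  have h1 : ∀ w, g.selMap t a 0 1 (g.selMap t a 0 1 w) = 0 := fun w => by
    rw [← h.selMap_zero_one_innerProj, h.innerProj_selMap_zero_one, map_zero]
  rw [h.selMap_zero_one_innerProj, g.diff_eq_selMap a h.mem, g.diff_eq_selMap a h.mem, h1,
    map_add, map_smul, h1, smul_zero, add_zero, add_zero]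
  exact (eq_of_add_eq_zero_of_CF (g.selMap_comp_zero_one t a z)).symm

/-- Up to states not containing the centre of the block, the rectangles through `t` undo those
through `A`: together they form the annulus through `t` and `A`. -/
theorem innerProj_selMap_selMap (ho : g.IsOnlyX t a) (z : g.CF) :
    innerProj i j g (g.selMap t a 1 0 (g.selMap t a 0 1 z)) = innerProj i j g z := by
  have h1 := congrArg (innerProj i j g) (ho.selMap_comp_one_one (innerProj i j g z))
  rw [map_add, map_add, map_add, h.innerProj_selMap_one_one, zero_add,
    h.innerProj_selMap_zero_one, zero_add, ← h.innerProj_selMap_zero_zero,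
    h.innerProj_selMap_one_one, map_zero, map_zero, add_zero, innerProj_innerProj,
    h.selMap_zero_one_innerProj] at h1
  exact h1

/-- Counting the rectangles through `t` is a chain map to the quotient complex, up to the
multiplication by `U_a + u`, where `u` stands for the annuli through `t` that avoid `A`. -/
theorem innerProj_selMap_diff (ho : g.IsOnlyX t a) (z : g.CF) :
    innerProj i j g (g.selMap t a 1 0 (g.diff z)) =
      innerProj i j g (g.diff (innerProj i j g (g.selMap t a 1 0 z))) +
        (MvPolynomial.X a + g.selAnnuli t a 1 0) • innerProj i j g z := by
  have h1 := congrArg (innerProj i j g) (g.selMap_comp_one_zero t a z)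
  have h2 : g.selMap t a 1 0 (g.selMap t a 0 0 z) =
      g.selMap t a 0 0 (g.selMap t a 1 0 z) + g.selAnnuli t a 1 0 • z := by
    rw [← g.selMap_comp_one_zero t a z, add_left_comm, add_self_eq_zero_of_CF, add_zero]
  rw [h.innerProj_diff_innerProj, g.diff_eq_selMap a h.mem, g.diff_eq_selMap a h.mem, map_add,
    map_smul, h2, map_add, map_add, map_add, map_smul, map_smul, map_smul,
    h.innerProj_selMap_selMap ho, h.innerProj_selMap_zero_one, smul_zero, add_zero, add_smul]
  abel

/-- The rectangles through both `t` and `A` provide a nullhomotopy on the cycles on which the maps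
through `t` and through `A` vanish. -/
theorem eq_diff_of_innerProj_eq_zero (ho : g.IsOnlyX t a) {z : g.CF}
    (hz : g.diff z = 0) (hp : innerProj i j g z = 0)
    (hf : innerProj i j g (g.selMap t a 1 0 z) = 0) : z = g.diff (g.selMap t a 1 1 z) := by
  have h1 : ∀ w, innerProj i j g w = 0 → g.selMap t a 0 1 w = 0 := fun w hw => by
    rw [← h.selMap_zero_one_innerProj, hw, map_zero]
  have h2 : g.selMap t a 0 0 z = 0 := by
    rwa [g.diff_eq_selMap a h.mem, h1 z hp, smul_zero, add_zero] at hz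
  have h3 := ho.selMap_comp_one_one z
  rw [h2, map_zero, zero_add, h1 z hp, map_zero, zero_add, h1 _ hf, zero_add] at h3
  rw [g.diff_eq_selMap a h.mem, h1 _ (h.innerProj_selMap_one_one z), smul_zero, add_zero, h3]

end IsBlock

end Algebra

/-! ### States through the centre of the block and states of the smaller diagram -/

section InsertInner

variable {n : ℕ}

theorem val_succAbove (p : Fin (n + 1)) (k : Fin n) :
    (p.succAbove k).1 = if k.1 < p.1 then k.1 else k.1 + 1 := by
  unfold Fin.succAbove
  split_ifs with h h' h' <;> simp only [Fin.lt_def, Fin.val_castSucc, Fin.val_succ] at * <;> omega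

theorem val_predAbove (j : Fin n) (k : Fin (n + 1)) :
    (j.predAbove k).1 = if k.1 ≤ j.1 then k.1 else k.1 - 1 := by
  rcases lt_or_ge j.castSucc k with h | h
  · rw [Fin.predAbove_of_castSucc_lt _ _ h, Fin.val_pred]
    rw [Fin.lt_def, Fin.val_castSucc] at h
    rw [if_neg (not_le.2 h)]
  · rw [Fin.predAbove_of_le_castSucc _ _ h, Fin.coe_castPred]
    rw [Fin.le_def, Fin.val_castSucc] at h
    rw [if_pos h]

theorem predAbove_succ_succAbove (j k : Fin n) : j.predAbove (j.succ.succAbove k) = k := by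
  rw [Fin.ext_iff, val_predAbove, val_succAbove, Fin.val_succ]
  split_ifs <;> omega

/-- Removing the circle between two adjacent strips and merging these strips is compatible with
`Between`. -/
theorem between_succAbove_iff (j a b : Fin n) (k : Fin (n + 1)) :
    Between (j.succ.succAbove a) (j.succ.succAbove b) k ↔ Between a b (j.predAbove k) := by
  have := k.2
  rw [between_iff, between_iff, val_predAbove, val_succAbove, val_succAbove, Fin.val_succ]
  split_ifs <;> omega

theorem arc_succAbove (j a b : Fin n) (k : Fin (n + 1)) :
    arc (j.succ.succAbove a) (j.succ.succAbove b) k = arc a b (j.predAbove k) := by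
  classical
  exact if_congr (between_succAbove_iff j a b k) rfl rfl

variable (i j : Fin n)

/-- The state obtained from a state of the smaller diagram by adding the centre of the block. -/
def insertInner (y : Equiv.Perm (Fin n)) : Equiv.Perm (Fin (n + 1)) :=
  ((finSuccEquiv' j.succ).trans (Equiv.optionCongr y)).trans (finSuccEquiv' i.succ).symm

@[simp]
theorem insertInner_succAbove (y : Equiv.Perm (Fin n)) (k : Fin n) :
    insertInner i j y (j.succ.succAbove k) = i.succ.succAbove (y k) := by
  simp [insertInner]

@[simp]
theorem insertInner_succ (y : Equiv.Perm (Fin n)) : insertInner i j y j.succ = i.succ := by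
  simp [insertInner]

theorem isInner_insertInner (y : Equiv.Perm (Fin n)) : IsInner i j (insertInner i j y) :=
  insertInner_succ i j y

theorem insertInner_injective : Function.Injective (insertInner i j) := by
  intro y y' h
  ext1 k
  have := Equiv.congr_fun h (j.succ.succAbove k)
  simpa using this

variable {i j} in
theorem exists_insertInner_eq {x : Equiv.Perm (Fin (n + 1))} (hx : IsInner i j x) :
    ∃ y, insertInner i j y = x := by
  let σ : Option (Fin n) ≃ Option (Fin n) :=
    ((finSuccEquiv' j.succ).symm.trans x).trans (finSuccEquiv' i.succ)
  have hσ : σ none = none := by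
    have : x j.succ = i.succ := hx
    simp [σ, this]
  refine ⟨Equiv.removeNone σ, ?_⟩
  ext1 k
  obtain rfl | ⟨k, rfl⟩ := Fin.eq_self_or_eq_succAbove j.succ k
  · rw [insertInner_succ, show x j.succ = i.succ from hx]
  · rw [insertInner_succAbove]
    have h1 : ∃ l, σ (some k) = some l := by
      rw [← Option.isSome_iff_exists, ← Option.ne_none_iff_isSome, ← hσ]
      exact σ.injective.ne (by simp)
    have h2 := Equiv.removeNone_some σ h1
    simp only [σ, Equiv.trans_apply, finSuccEquiv'_symm_some] at h2
    have h3 := congrArg (finSuccEquiv' i.succ).symm h2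
    rwa [Equiv.symm_apply_apply, finSuccEquiv'_symm_some] at h3

theorem insertInner_mul_swap (y : Equiv.Perm (Fin n)) (a b : Fin n) :
    insertInner i j (y * Equiv.swap a b) =
      insertInner i j y * Equiv.swap (j.succ.succAbove a) (j.succ.succAbove b) := by
  ext1 k
  obtain rfl | ⟨k, rfl⟩ := Fin.eq_self_or_eq_succAbove j.succ k
  · rw [Equiv.Perm.mul_apply, Equiv.swap_apply_of_ne_of_ne, insertInner_succ, insertInner_succ]
    · exact (Fin.succAbove_ne _ _).symm
    · exact (Fin.succAbove_ne _ _).symm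
  · rw [insertInner_succAbove, Equiv.Perm.mul_apply, Equiv.Perm.mul_apply,
      (Fin.succAbove_right_injective).swap_apply, insertInner_succAbove]

theorem rectDomain_insertInner (y : Equiv.Perm (Fin n)) (r : Fin n × Fin n)
    (s : Fin (n + 1) × Fin (n + 1)) :
    rectDomain (insertInner i j y) (j.succ.succAbove r.1, j.succ.succAbove r.2) s =
      rectDomain y r (j.predAbove s.1, i.predAbove s.2) := by
  simp only [rectDomain, insertInner_succAbove, arc_succAbove]

theorem isEmptyRect_insertInner_iff (y : Equiv.Perm (Fin n)) (r : Fin n × Fin n) :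
    IsEmptyRect (insertInner i j y) (j.succ.succAbove r.1, j.succ.succAbove r.2) ↔
      IsEmptyRect y r ∧ rectDomain y r (j, i) = 0 := by
  rw [rectDomain_eq_zero_iff]
  unfold IsEmptyRect RectHas
  simp only [insertInner_succAbove, between_succAbove_iff, ne_eq,
    (Fin.succAbove_right_injective).eq_iff, and_assoc]
  refine and_congr_right fun _ => ⟨fun h => ⟨fun k h1 h2 => ?_, ?_⟩, fun h k => ?_⟩
  · have := h (j.succ.succAbove k)
    simp only [(Fin.succAbove_right_injective).eq_iff, predAbove_succ_succAbove,
      insertInner_succAbove] at this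
    exact this h1 h2
  · have := h j.succ (Fin.succAbove_ne _ _).symm (Fin.succAbove_ne _ _).symm
    simpa using this
  · obtain rfl | ⟨k, rfl⟩ := Fin.eq_self_or_eq_succAbove j.succ k
    · intro _ _
      simpa using h.2
    · simp only [(Fin.succAbove_right_injective).eq_iff, predAbove_succ_succAbove,
        insertInner_succAbove]
      exact h.1 k

end InsertInner

/-! ### The destabilization map -/

/-- A chain map with a right inverse that commutes with the differentials is a quasi-isomorphism
once all cycles in its kernel are boundaries. -/
theorem isQuasiIso_of_rightInverse {C C' : Type*} [AddCommGroup C] [AddCommGroup C']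
    {d : C →+ C} {d' : C' →+ C'} {f : C →+ C'} {Ψ : C' → C} (hd : ∀ z, d (d z) = 0)
    (hf : ∀ z, f (d z) = d' (f z)) (hΨ0 : Ψ 0 = 0) (hΨ : ∀ w, f (Ψ w) = w)
    (hΨd : ∀ w, d (Ψ w) = Ψ (d' w)) (hinj : ∀ z, d z = 0 → f z = 0 → ∃ w, d w = z) :
    IsQuasiIso d d' f := by
  refine ⟨hf, ?_, ?_⟩
  · rw [injective_iff_map_eq_zero]
    intro z h0
    obtain ⟨⟨z, hz⟩, rfl⟩ := QuotientAddGroup.mk_surjective z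
    have hz' : d z = 0 := hz
    have h0 := (QuotientAddGroup.eq_zero_iff _).1 h0
    rw [AddSubgroup.mem_addSubgroupOf] at h0
    obtain ⟨w, hw⟩ := h0
    have hw : d' w = f z := hw
    obtain ⟨v, hv⟩ := hinj (z - d (Ψ w)) (by rw [map_sub, hz', hd, sub_zero])
      (by rw [map_sub, hf, hΨ, hw, sub_self])
    refine (QuotientAddGroup.eq_zero_iff _).2 ?_
    rw [AddSubgroup.mem_addSubgroupOf]
    refine ⟨v + Ψ w, ?_⟩
    change d (v + Ψ w) = z
    rw [map_add, hv, sub_add_cancel]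
  · intro w
    obtain ⟨⟨w, hw⟩, rfl⟩ := QuotientAddGroup.mk_surjective w
    have hw' : d' w = 0 := hw
    refine ⟨QuotientAddGroup.mk ⟨Ψ w, ?_⟩, ?_⟩
    · change d (Ψ w) = 0
      rw [hΨd, hw', hΨ0]
    · exact congrArg QuotientAddGroup.mk (Subtype.ext (hΨ w))

section Comparison

variable {n : ℕ} (g : GraphGrid (n + 1)) (g' : GraphGrid n) (i j : Fin n) (a : Fin (n + 1))
  (u : MvPolynomial (Fin n) (ZMod 2))

/-- The inclusion of the coefficient ring of the smaller diagram: the variable of the `O` in column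
`a` does not occur in the image. -/
abbrev inclVar : MvPolynomial (Fin n) (ZMod 2) →ₐ[ZMod 2] MvPolynomial (Fin (n + 1)) (ZMod 2) :=
  MvPolynomial.rename a.succAbove

/-- The ring homomorphism that sends the variable of the `O` in column `a` to `u` and all other
variables to the corresponding variables of the smaller diagram. -/
def substVar : MvPolynomial (Fin (n + 1)) (ZMod 2) →ₐ[ZMod 2] MvPolynomial (Fin n) (ZMod 2) :=
  MvPolynomial.aeval (a.insertNth u MvPolynomial.X : Fin (n + 1) → MvPolynomial (Fin n) (ZMod 2))

theorem substVar_X_self : substVar a u (MvPolynomial.X a) = u := by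
  simp [substVar]

theorem substVar_X_succAbove (k : Fin n) :
    substVar a u (MvPolynomial.X (a.succAbove k)) = MvPolynomial.X k := by
  simp [substVar]

theorem substVar_inclVar (p : MvPolynomial (Fin n) (ZMod 2)) :
    substVar a u (inclVar a p) = p := by
  have : (substVar a u).comp (inclVar a) = AlgHom.id _ _ :=
    MvPolynomial.algHom_ext fun k => by simp [substVar]
  exact DFunLike.congr_fun this p

/-- The kernel of the substitution `U_a ↦ u` consists of multiples of `U_a + u`. -/
theorem dvd_of_substVar_eq_zero {p : MvPolynomial (Fin (n + 1)) (ZMod 2)}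
    (hp : substVar a u p = 0) : MvPolynomial.X a + inclVar a u ∣ p := by
  let I := Ideal.span {(MvPolynomial.X a + inclVar a u : MvPolynomial (Fin (n + 1)) (ZMod 2))}
  have : ((Ideal.Quotient.mkₐ (ZMod 2) I).comp (inclVar a)).comp (substVar a u) =
      Ideal.Quotient.mkₐ (ZMod 2) I := by
    refine MvPolynomial.algHom_ext fun k => ?_
    obtain rfl | ⟨k, rfl⟩ := Fin.eq_self_or_eq_succAbove a k
    · simp only [AlgHom.comp_apply, substVar_X_self, Ideal.Quotient.mkₐ_eq_mk]
      rw [Ideal.Quotient.eq, CharTwo.sub_eq_add, add_comm (inclVar k u)]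
      exact Ideal.mem_span_singleton_self _
    · simp only [AlgHom.comp_apply, substVar_X_succAbove, MvPolynomial.rename_X]
  have h := DFunLike.congr_fun this p
  simp only [AlgHom.comp_apply, hp, map_zero, Ideal.Quotient.mkₐ_eq_mk] at h
  exact Ideal.mem_span_singleton.1 (Ideal.Quotient.eq_zero_iff_mem.1 h.symm)

/-- The map `CF⁻(g) → CF⁻(g')` that kills the states not containing the centre of the block and
substitutes `u` for the variable of the `O` in column `a`. -/
def restrictInner : g.CF →+ g'.CF where
  toFun z := Finsupp.equivFunOnFinite.symm fun y => substVar a u (z (insertInner i j y))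
  map_zero' := by ext1 y; simp
  map_add' z w := by ext1 y; simp

/-- The map `CF⁻(g') → CF⁻(g)` that adds the centre of the block to each state. -/
def extendInner : g'.CF →+ g.CF :=
  Finsupp.liftAddHom fun y =>
    (Finsupp.singleAddHom (insertInner i j y)).comp (inclVar a).toRingHom.toAddMonoidHom

theorem restrictInner_apply (z : g.CF) (y : g'.State) :
    restrictInner g g' i j a u z y = substVar a u (z (insertInner i j y)) := rfl

theorem extendInner_single (y : g'.State) (p : MvPolynomial (Fin n) (ZMod 2)) :
    extendInner g g' i j a (Finsupp.single y p) =
      Finsupp.single (insertInner i j y) (inclVar a p) := by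
  simp [extendInner]

theorem restrictInner_smul (p : MvPolynomial (Fin (n + 1)) (ZMod 2)) (z : g.CF) :
    restrictInner g g' i j a u (p • z) = substVar a u p • restrictInner g g' i j a u z := by
  ext1 y
  simp [restrictInner_apply]

theorem extendInner_smul (p : MvPolynomial (Fin n) (ZMod 2)) (w : g'.CF) :
    extendInner g g' i j a (p • w) = inclVar a p • extendInner g g' i j a w := by
  induction w using Finsupp.induction_linear with
  | zero => simp
  | add w w' h h' => rw [smul_add, map_add, h, h', map_add, smul_add]
  | single y q =>
    rw [Finsupp.smul_single, extendInner_single, extendInner_single, Finsupp.smul_single,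
      smul_eq_mul, smul_eq_mul, map_mul]

theorem restrictInner_innerProj (z : g.CF) :
    restrictInner g g' i j a u (innerProj i j g z) = restrictInner g g' i j a u z := by
  ext1 y
  rw [restrictInner_apply, restrictInner_apply, innerProj_apply,
    if_pos (isInner_insertInner i j y)]

theorem restrictInner_single (y : g'.State) (q : MvPolynomial (Fin (n + 1)) (ZMod 2)) :
    restrictInner g g' i j a u (Finsupp.single (insertInner i j y) q) =
      Finsupp.single y (substVar a u q) := by
  ext1 y'
  rw [restrictInner_apply]
  by_cases hy : y = y'
  · rw [hy, Finsupp.single_eq_same, Finsupp.single_eq_same]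
  · rw [Finsupp.single_eq_of_ne' hy, Finsupp.single_eq_of_ne' fun h =>
      hy (insertInner_injective i j h), map_zero]

theorem restrictInner_extendInner (w : g'.CF) :
    restrictInner g g' i j a u (extendInner g g' i j a w) = w := by
  induction w using Finsupp.induction_linear with
  | zero => simp
  | add w w' h h' => rw [map_add, map_add, h, h']
  | single y q => rw [extendInner_single, restrictInner_single, substVar_inclVar]

/-- Elements killed by `restrictInner` are divisible by `U_a + u` on the states containing the
centre of the block. -/
theorem exists_smul_of_restrictInner_eq_zero {z : g.CF}
    (hz : restrictInner g g' i j a u z = 0) :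
    ∃ v : g.CF, innerProj i j g v = v ∧
      innerProj i j g z = (MvPolynomial.X a + inclVar a u) • v := by
  have h : ∀ x : g.State, ∃ q, IsInner i j x → z x = (MvPolynomial.X a + inclVar a u) * q := by
    intro x
    by_cases hx : IsInner i j x
    · obtain ⟨y, rfl⟩ := exists_insertInner_eq hx
      obtain ⟨q, hq⟩ := dvd_of_substVar_eq_zero a u (DFunLike.congr_fun hz y)
      exact ⟨q, fun _ => hq⟩
    · exact ⟨0, fun h => absurd h hx⟩
  choose q hq using h
  refine ⟨innerProj i j g (Finsupp.equivFunOnFinite.symm q), innerProj_innerProj _, ?_⟩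
  ext1 x
  rw [Finsupp.smul_apply, innerProj_apply, innerProj_apply]
  split_ifs with hx
  · rw [hq x hx]
    rfl
  · rw [smul_zero]

variable {g g' i j a}

theorem IsDestabilization.predAbove_O (hg : IsDestabilization g g' i j a) :
    (j.predAbove a, i.predAbove (g.O a)) = (j, i) := by
  rcases hg.posA with ⟨h1, h2⟩ | ⟨h1, h2⟩ <;> rw [h2, h1] <;> simp

theorem IsDestabilization.predAbove_succAbove (hg : IsDestabilization g g' i j a) (k : Fin n) :
    j.predAbove (a.succAbove k) = k := by
  rcases hg.posA with ⟨h1, -⟩ | ⟨h1, -⟩ <;> rw [h1]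
  · exact Fin.predAbove_succAbove j k
  · exact predAbove_succ_succAbove j k

theorem IsDestabilization.mem_X (hg : IsDestabilization g g' i j a) : (j, i) ∈ g'.X := by
  rw [hg.X_eq, Finset.mem_image]
  exact ⟨_, hg.upperLeft, by simp⟩

/-- A rectangle between states containing the centre of the block does not meet the block, unless
it contains all of it. -/
theorem IsDestabilization.diffCoeff_insertInner (hg : IsDestabilization g g' i j a)
    {D : Fin (n + 1) × Fin (n + 1) → ℕ} {D' : Fin n × Fin n → ℕ}
    (hD : ∀ s, D s = D' (j.predAbove s.1, i.predAbove s.2)) :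
    g.diffCoeff D = inclVar a (g'.diffCoeff D') := by
  classical
  have hX : (∀ s ∈ g.X, D s = 0) ↔ ∀ s ∈ g'.X, D' s = 0 := by
    rw [hg.X_eq, Finset.forall_mem_image]
    simp only [hD]
  unfold diffCoeff
  by_cases h : ∀ s ∈ g'.X, D' s = 0
  · rw [if_pos h, if_pos (hX.2 h), map_prod, Fin.prod_univ_succAbove _ a, hD]
    simp only [hg.predAbove_O, h _ hg.mem_X, pow_zero, one_mul, map_pow, MvPolynomial.rename_X]
    refine Finset.prod_congr rfl fun k _ => ?_
    rw [hD, hg.O_eq]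
    simp only [hg.predAbove_succAbove]
  · rw [if_neg h, if_neg (hX.not.2 h), map_zero]

/-- Rectangles between states containing the centre of the block correspond to the rectangles of the
smaller diagram that avoid the `X` in the merged block. -/
theorem IsDestabilization.innerProj_diff_single (hg : IsDestabilization g g' i j a)
    (y : g'.State) :
    innerProj i j g (g.diff (Finsupp.single (insertInner i j y) 1)) =
      extendInner g g' i j a (g'.diff (Finsupp.single y 1)) := by
  classical
  rw [diff_eq_rectMap, diff_eq_rectMap, rectMap_single, rectMap_single, map_sum, map_sum]
  have h1 : ∑ r with IsEmptyRect y r, extendInner g g' i j a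
        (Finsupp.single (y * Equiv.swap r.1 r.2) (1 * g'.diffCoeff (rectDomain y r))) =
      ∑ r with IsEmptyRect y r ∧ rectDomain y r (j, i) = 0, extendInner g g' i j a
        (Finsupp.single (y * Equiv.swap r.1 r.2) (1 * g'.diffCoeff (rectDomain y r))) := by
    rw [← Finset.filter_filter]
    refine (Finset.sum_filter_of_ne fun r _ hr => ?_).symm
    by_contra h0
    refine hr ?_
    rw [diffCoeff, if_neg fun h => h0 (h _ hg.mem_X), mul_zero, Finsupp.single_zero, map_zero]
  rw [h1]
  refine (Finset.sum_of_injOn (fun r => (j.succ.succAbove r.1, j.succ.succAbove r.2)) ?_ ?_ ?_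
    ?_).symm
  · intro r _ r' _ h
    simp only [Prod.mk.injEq, (Fin.succAbove_right_injective).eq_iff] at h
    exact Prod.ext h.1 h.2
  · intro r hr
    rw [Finset.mem_coe, Finset.mem_filter] at hr ⊢
    exact ⟨Finset.mem_univ _, (isEmptyRect_insertInner_iff i j y r).2 hr.2⟩
  · rintro ⟨b, c⟩ hr hr'
    have hr := (Finset.mem_filter.1 hr).2
    obtain rfl | ⟨b, rfl⟩ := Fin.eq_self_or_eq_succAbove j.succ b
    · refine innerProj_single_of_not_isInner (fun h => hr.1 ?_) _
      rw [IsInner, swap_mul_apply_left, ← insertInner_succ i j y] at h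
      exact ((insertInner i j y).injective h).symm
    obtain rfl | ⟨c, rfl⟩ := Fin.eq_self_or_eq_succAbove j.succ c
    · refine innerProj_single_of_not_isInner (fun h => hr.1 ?_) _
      rw [IsInner, swap_mul_apply_right, ← insertInner_succ i j y] at h
      exact (insertInner i j y).injective h
    refine absurd ⟨(b, c), ?_, rfl⟩ hr'
    rw [Finset.mem_coe, Finset.mem_filter]
    exact ⟨Finset.mem_univ _, (isEmptyRect_insertInner_iff i j y (b, c)).1 hr⟩
  · intro r hr
    simp only [one_mul]
    rw [extendInner_single, ← insertInner_mul_swap,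
      innerProj_single_of_isInner (isInner_insertInner i j _),
      hg.diffCoeff_insertInner (rectDomain_insertInner i j y r)]

theorem IsDestabilization.innerProj_diff_extendInner (hg : IsDestabilization g g' i j a)
    (w : g'.CF) :
    innerProj i j g (g.diff (extendInner g g' i j a w)) =
      extendInner g g' i j a (g'.diff w) := by
  induction w using Finsupp.induction_linear with
  | zero => simp
  | add w w' h h' => rw [map_add, map_add, map_add, map_add, map_add, h, h']
  | single y q =>
    rw [← mul_one q, ← smul_eq_mul, ← Finsupp.smul_single, extendInner_smul,
      LinearMap.map_smul g.diff, LinearMap.map_smul, LinearMap.map_smul g'.diff, extendInner_smul,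
      ← hg.innerProj_diff_single, extendInner_single, map_one]

theorem IsDestabilization.restrictInner_diff (hg : IsDestabilization g g' i j a) (z : g.CF) :
    restrictInner g g' i j a u (g.diff (innerProj i j g z)) =
      g'.diff (restrictInner g g' i j a u z) := by
  induction z using Finsupp.induction_linear with
  | zero => simp
  | add w w' h h' => rw [map_add, map_add, map_add, map_add, map_add, h, h']
  | single x q =>
    by_cases hx : IsInner i j x
    · obtain ⟨y, rfl⟩ := exists_insertInner_eq hx
      have h1 : (Finsupp.single (insertInner i j y) q : g.CF) =
          q • extendInner g g' i j a (Finsupp.single y 1) := by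
        rw [extendInner_single, map_one, Finsupp.smul_single, smul_eq_mul, mul_one]
      rw [innerProj_single_of_isInner hx, h1, map_smul, restrictInner_smul, restrictInner_smul,
        map_smul, restrictInner_extendInner, ← restrictInner_innerProj,
        hg.innerProj_diff_extendInner, restrictInner_extendInner]
    · rw [← restrictInner_innerProj _ _ _ _ _ _ (Finsupp.single x q),
        innerProj_single_of_not_isInner hx]
      simp

variable (g g' i j a) in
/-- The destabilization map: it counts the rectangles that contain the `X` in the square `t`, no
other `X`, and end at a state containing the centre of the block. -/
def destabMap (t : Fin (n + 1) × Fin (n + 1)) : g.CF →+ g'.CF :=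
  (restrictInner g g' i j a u).comp (g.selMap t a 1 0).toAddMonoidHom

variable {t t' : Fin (n + 1) × Fin (n + 1)} {u}

theorem destabMap_apply (z : g.CF) :
    destabMap g g' i j a u t z = restrictInner g g' i j a u (g.selMap t a 1 0 z) := rfl

theorem destabMap_smul (p : MvPolynomial (Fin n) (ZMod 2)) (z : g.CF) :
    destabMap g g' i j a u t (inclVar a p • z) = p • destabMap g g' i j a u t z := by
  rw [destabMap_apply, map_smul, restrictInner_smul, substVar_inclVar, destabMap_apply]

theorem IsDestabilization.destabMap_diff (hg : IsDestabilization g g' i j a)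
    (hb : IsBlock g a i j t t') (ho : g.IsOnlyX t a) (hu : inclVar a u = g.selAnnuli t a 1 0)
    (z : g.CF) :
    destabMap g g' i j a u t (g.diff z) = g'.diff (destabMap g g' i j a u t z) := by
  rw [destabMap_apply, destabMap_apply, ← restrictInner_innerProj, hb.innerProj_selMap_diff ho,
    map_add, restrictInner_smul, map_add, substVar_X_self, ← hu, substVar_inclVar,
    CharTwo.add_self_eq_zero, zero_smul, add_zero, restrictInner_innerProj, hg.restrictInner_diff]

theorem X_add_inclVar_ne_zero :
    (MvPolynomial.X a + inclVar a u : MvPolynomial (Fin (n + 1)) (ZMod 2)) ≠ 0 := by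
  intro h0
  have h1 := congrArg (substVar a (u + 1)) h0
  rw [map_add, substVar_X_self, substVar_inclVar, map_zero, add_right_comm,
    CharTwo.add_self_eq_zero, zero_add] at h1
  exact one_ne_zero h1

theorem eq_zero_of_smul_eq_zero {c : MvPolynomial (Fin (n + 1)) (ZMod 2)} (hc : c ≠ 0) {z : g.CF}
    (h : c • z = 0) : z = 0 := by
  ext1 x
  have := DFunLike.congr_fun h x
  rw [Finsupp.smul_apply, smul_eq_mul, Finsupp.zero_apply] at this
  exact (mul_eq_zero.1 this).resolve_left hc

/-- A cycle in the kernel of the destabilization map is changed by a boundary until it lies in the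
span of the states not containing the centre of the block and is killed by the count of rectangles,
after which it is a boundary. -/
theorem IsBlock.exists_diff_eq (hb : IsBlock g a i j t t') (ho : g.IsOnlyX t a)
    (hu : inclVar a u = g.selAnnuli t a 1 0) {z : g.CF} (hz : g.diff z = 0)
    (hz0 : destabMap g g' i j a u t z = 0) : ∃ w, g.diff w = z := by
  rw [destabMap_apply] at hz0
  obtain ⟨v, hv, hvz⟩ := exists_smul_of_restrictInner_eq_zero g g' i j a u hz0
  have hvz : innerProj i j g (g.selMap t a 1 0 z) =
      (MvPolynomial.X a + g.selAnnuli t a 1 0) • v := hu ▸ hvz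
  have hfv : g.selMap t a 1 0 v = 0 := by rw [← hv, hb.selMap_one_zero_innerProj]
  have h1 : innerProj i j g (g.selMap t a 1 0 (z + g.diff v)) = 0 := by
    have h2 := hb.innerProj_selMap_diff ho v
    rw [hfv, hv, LinearMap.map_zero, LinearMap.map_zero, LinearMap.map_zero, zero_add] at h2
    rw [LinearMap.map_add, LinearMap.map_add, hvz, h2, add_self_eq_zero_of_CF]
  have h2 : g.diff (z + g.diff v) = 0 := by rw [LinearMap.map_add, hz, diff_diff, add_zero]
  have h3 : innerProj i j g (z + g.diff v) = 0 := by
    have h4 := hb.innerProj_selMap_diff ho (z + g.diff v)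
    rw [h2, h1, LinearMap.map_zero, LinearMap.map_zero, LinearMap.map_zero, LinearMap.map_zero,
      zero_add, ← hu] at h4
    exact eq_zero_of_smul_eq_zero (X_add_inclVar_ne_zero (a := a) (u := u)) h4.symm
  have h4 := hb.eq_diff_of_innerProj_eq_zero ho h2 h3 h1
  refine ⟨v + g.selMap t a 1 1 (z + g.diff v), ?_⟩
  rw [LinearMap.map_add, ← h4, add_left_comm, add_self_eq_zero_of_CF, add_zero]

/-- The destabilization map has the count of the rectangles containing `A` as a right inverse. -/
theorem IsDestabilization.isQuasiIso (hg : IsDestabilization g g' i j a)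
    (hb : IsBlock g a i j t t') (ho : g.IsOnlyX t a) (hu : inclVar a u = g.selAnnuli t a 1 0) :
    IsQuasiIso g.diff.toAddMonoidHom g'.diff.toAddMonoidHom (destabMap g g' i j a u t) := by
  refine isQuasiIso_of_rightInverse (Ψ := fun w => g.selMap t a 0 1 (extendInner g g' i j a w))
    g.diff_diff (hg.destabMap_diff hb ho hu) ?_ (fun w => ?_) (fun w => ?_)
    (fun z hz hz0 => hb.exists_diff_eq ho hu hz hz0)
  · rw [map_zero, map_zero]
  · rw [destabMap_apply, ← restrictInner_innerProj, hb.innerProj_selMap_selMap ho,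
      restrictInner_innerProj, restrictInner_extendInner]
  · exact (hb.diff_selMap_zero_one _).trans (by rw [hg.innerProj_diff_extendInner]; rfl)

end Comparison

/-! ### The gradings of the states -/

section Gradings

variable {N : ℕ}

/-- The pairing `𝓘` as a bilinear map. -/
def pairingI : ((ℤ × ℤ) →₀ ℤ) →ₗ[ℤ] ((ℤ × ℤ) →₀ ℤ) →ₗ[ℤ] ℤ :=
  Finsupp.linearCombination ℤ fun p =>
    Finsupp.linearCombination ℤ fun q => if p.1 < q.1 ∧ p.2 < q.2 then 1 else 0

theorem countI_eq_pairingI (A B : (ℤ × ℤ) →₀ ℤ) : countI A B = pairingI A B := by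
  unfold countI pairingI
  rw [Finsupp.linearCombination_apply, Finsupp.sum, Finsupp.sum, LinearMap.sum_apply]
  refine Finset.sum_congr rfl fun p _ => ?_
  rw [LinearMap.smul_apply, Finsupp.linearCombination_apply, Finsupp.sum, Finsupp.sum,
    Finset.smul_sum]
  refine Finset.sum_congr rfl fun q _ => ?_
  split_ifs <;> simp

theorem pairingI_single (p q : ℤ × ℤ) (m k : ℤ) :
    pairingI (Finsupp.single p m) (Finsupp.single q k) =
      m * (k * if p.1 < q.1 ∧ p.2 < q.2 then 1 else 0) := by
  simp [pairingI, Finsupp.linearCombination_single]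

/-- In the picture cut along the circle `c`, the circle `a` lies before the circle `b`. -/
def prec (c a b : Fin N) : ℤ := arc c b a

theorem prec_eq_ite (c a b : Fin N) : prec c a b = if (a - c).val < (b - c).val then 1 else 0 := by
  classical
  unfold prec arc
  rw [Nat.cast_ite, Nat.cast_one, Nat.cast_zero]
  exact if_congr Iff.rfl rfl rfl

theorem prec_add_prec (c a b : Fin N) :
    prec c a b + prec c b a + (if a = b then 1 else 0) = 1 := by
  unfold prec arc
  simp only [between_iff, Fin.ext_iff]
  split_ifs <;> first | rfl | omega

theorem arc_eq_prec (c : Fin N) {a b : Fin N} (hab : a ≠ b) (k : Fin N) :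
    (arc a b k : ℤ) = prec c k b - prec c k a + prec c b a := by
  have := Fin.val_ne_of_ne hab
  unfold prec arc
  simp only [between_iff]
  split_ifs <;> first | rfl | omega

theorem pairingI_lattice_lattice (c p q : Fin N × Fin N) (m k : ℤ) :
    pairingI (Finsupp.single (latticePt c p) m) (Finsupp.single (latticePt c q) k) =
      m * (k * (prec c.1 p.1 q.1 * prec c.2 p.2 q.2)) := by
  rw [pairingI_single, prec_eq_ite, prec_eq_ite, ite_zero_mul_ite_zero, mul_one]
  refine congrArg (m * ·) (congrArg (k * ·) (if_congr ?_ rfl rfl))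
  simp only [latticePt]
  omega

theorem pairingI_square_square (c p q : Fin N × Fin N) (m k : ℤ) :
    pairingI (Finsupp.single (squarePt c p) m) (Finsupp.single (squarePt c q) k) =
      m * (k * (prec c.1 p.1 q.1 * prec c.2 p.2 q.2)) := by
  rw [pairingI_single, prec_eq_ite, prec_eq_ite, ite_zero_mul_ite_zero, mul_one]
  refine congrArg (m * ·) (congrArg (k * ·) (if_congr ?_ rfl rfl))
  simp only [squarePt]
  omega

theorem pairingI_square_lattice (c p q : Fin N × Fin N) (m k : ℤ) :
    pairingI (Finsupp.single (squarePt c p) m) (Finsupp.single (latticePt c q) k) =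
      m * (k * (prec c.1 p.1 q.1 * prec c.2 p.2 q.2)) := by
  rw [pairingI_single, prec_eq_ite, prec_eq_ite, ite_zero_mul_ite_zero, mul_one]
  refine congrArg (m * ·) (congrArg (k * ·) (if_congr ?_ rfl rfl))
  simp only [squarePt, latticePt]
  omega

theorem pairingI_lattice_square (c p q : Fin N × Fin N) (m k : ℤ) :
    pairingI (Finsupp.single (latticePt c p) m) (Finsupp.single (squarePt c q) k) =
      m * (k * ((1 - prec c.1 q.1 p.1) * (1 - prec c.2 q.2 p.2))) := by
  have h : (latticePt c p).1 < (squarePt c q).1 ∧ (latticePt c p).2 < (squarePt c q).2 ↔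
      ¬ (q.1 - c.1).val < (p.1 - c.1).val ∧ ¬ (q.2 - c.2).val < (p.2 - c.2).val := by
    simp only [latticePt, squarePt]
    omega
  rw [pairingI_single, prec_eq_ite, prec_eq_ite, if_congr h rfl rfl]
  by_cases h1 : (q.1 - c.1).val < (p.1 - c.1).val <;>
    by_cases h2 : (q.2 - c.2).val < (p.2 - c.2).val <;> simp [h1, h2]

/-- The number of pairs of a point of `x` and a point of `y` that lies strictly to the right and
above, in the picture cut along the circles `c`. -/
def crossings (c : Fin N × Fin N) (x y : Equiv.Perm (Fin N)) : ℤ :=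
  ∑ l, ∑ k, prec c.1 k l * prec c.2 (x k) (y l)

theorem sum_prec (c : Fin N) : 2 * ∑ l, ∑ k, prec c k l = (N : ℤ) * N - N := by
  have h : ∑ l, ∑ k, (prec c k l + prec c l k + if k = l then 1 else 0) = (N : ℤ) * N := by
    simp only [prec_add_prec]
    simp
  simp only [Finset.sum_add_distrib] at h
  rw [Finset.sum_comm (f := fun l k => prec c l k)] at h
  simp only [Finset.sum_ite_eq', Finset.mem_univ, if_true, Finset.sum_const, Finset.card_univ,
    Fintype.card_fin, nsmul_eq_mul, mul_one] at h
  linarith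

theorem maslov_eq_crossings (g : GraphGrid N) (c : Fin N × Fin N) (x : g.State) :
    g.maslov c x = crossings c x x - 2 * crossings c g.O x + crossings c g.O g.O + 1 - N := by
  have h1 : pairingI (g.stateSum c x) (g.stateSum c x) = crossings c x x := by
    simp only [stateSum, map_sum, LinearMap.sum_apply, pairingI_lattice_lattice, one_mul]
    rfl
  have h2 : pairingI (g.oSum c) (g.stateSum c x) = crossings c g.O x := by
    simp only [stateSum, oSum, map_sum, LinearMap.sum_apply, pairingI_square_lattice, one_mul]
    rfl
  have h3 : pairingI (g.oSum c) (g.oSum c) = crossings c g.O g.O := by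
    simp only [oSum, map_sum, LinearMap.sum_apply, pairingI_square_square, one_mul]
    rfl
  have h4 : pairingI (g.stateSum c x) (g.oSum c) = crossings c g.O x + N := by
    simp only [stateSum, oSum, map_sum, LinearMap.sum_apply, pairingI_lattice_square, one_mul]
    rw [Finset.sum_comm]
    have e1 := sum_prec c.1
    have e2 := sum_prec c.2
    have e3 : ∑ l, ∑ k, prec c.2 (g.O k) (x l) = ∑ l, ∑ k, prec c.2 k l := by
      rw [← Equiv.sum_comp x fun l => ∑ k, prec c.2 k l]
      exact Finset.sum_congr rfl fun l _ => Equiv.sum_comp g.O fun k => prec c.2 k (x l)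
    have e4 : ∀ l k, (1 - prec c.1 k l) * (1 - prec c.2 (g.O k) (x l)) =
        1 - prec c.1 k l - prec c.2 (g.O k) (x l) + prec c.1 k l * prec c.2 (g.O k) (x l) :=
      fun l k => by ring
    simp only [e4, Finset.sum_add_distrib, Finset.sum_sub_distrib, e3, Finset.sum_const,
      Finset.card_univ, Fintype.card_fin, nsmul_eq_mul, mul_one, crossings]
    linarith
  rw [maslov, countI_eq_pairingI]
  simp only [map_sub, LinearMap.sub_apply, h1, h2, h3, h4]
  ring

/-- The effect of a transposition on a sum over the points of a state. -/
theorem sum_sub_sum_swap (f : Fin N → Fin N → ℤ) (x : Equiv.Perm (Fin N)) {a b : Fin N}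
    (hab : a ≠ b) :
    ∑ k, f k (x k) - ∑ k, f k ((x * Equiv.swap a b) k) =
      f a (x a) + f b (x b) - f a (x b) - f b (x a) := by
  rw [← Finset.sum_sub_distrib, Fintype.sum_eq_add a b hab]
  · rw [swap_mul_apply_left, swap_mul_apply_right]
    ring
  · rintro k ⟨ha, hb⟩
    rw [swap_mul_apply_of_ne x ha hb, sub_self]

/-- The mixed difference of the numbers of pairs that arises from a transposition. -/
def mixedSum (c : Fin N × Fin N) (x : Equiv.Perm (Fin N)) (a b : Fin N)
    (z : Equiv.Perm (Fin N)) : ℤ :=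
  ∑ k, (prec c.1 k b - prec c.1 k a) * (prec c.2 (z k) (x b) - prec c.2 (z k) (x a))

theorem crossings_sub_swap_right (c : Fin N × Fin N) (x z : Equiv.Perm (Fin N)) {a b : Fin N}
    (hab : a ≠ b) :
    crossings c z x - crossings c z (x * Equiv.swap a b) = mixedSum c x a b z := by
  have := sum_sub_sum_swap (fun l m => ∑ k, prec c.1 k l * prec c.2 (z k) m) x hab
  unfold crossings mixedSum
  rw [this, ← Finset.sum_add_distrib, ← Finset.sum_sub_distrib, ← Finset.sum_sub_distrib]
  exact Finset.sum_congr rfl fun k _ => by ring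

theorem mixedSum_sub_swap (c : Fin N × Fin N) (x : Equiv.Perm (Fin N)) {a b : Fin N}
    (hab : a ≠ b) :
    mixedSum c x a b x - mixedSum c x a b (x * Equiv.swap a b) = 1 := by
  have h := sum_sub_sum_swap (fun k m => (prec c.1 k b - prec c.1 k a) *
    (prec c.2 m (x b) - prec c.2 m (x a))) x hab
  unfold mixedSum
  rw [h]
  have h1 := prec_add_prec c.1 a b
  have h2 := prec_add_prec c.2 (x a) (x b)
  have h3 := prec_add_prec c.1 a a
  have h4 := prec_add_prec c.1 b b
  have h5 := prec_add_prec c.2 (x a) (x a)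
  have h6 := prec_add_prec c.2 (x b) (x b)
  rw [if_neg hab] at h1
  rw [if_neg (x.injective.ne hab)] at h2
  rw [if_pos rfl] at h3 h4 h5 h6
  have e1 : prec c.1 a b = 1 - prec c.1 b a := by linarith
  have e2 : prec c.2 (x a) (x b) = 1 - prec c.2 (x b) (x a) := by linarith
  have e3 : prec c.1 a a = 0 := by linarith
  have e4 : prec c.1 b b = 0 := by linarith
  have e5 : prec c.2 (x a) (x a) = 0 := by linarith
  have e6 : prec c.2 (x b) (x b) = 0 := by linarith
  rw [e1, e2, e3, e4, e5, e6]
  ring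

theorem crossings_swap_sub_swap (c : Fin N × Fin N) (x : Equiv.Perm (Fin N)) {a b : Fin N}
    (hab : a ≠ b) :
    crossings c x (x * Equiv.swap a b) - crossings c (x * Equiv.swap a b) (x * Equiv.swap a b) =
      mixedSum c x a b (x * Equiv.swap a b) := by
  set y := x * Equiv.swap a b with hy
  have h := sum_sub_sum_swap (fun k m => ∑ l, prec c.1 k l * prec c.2 m (y l)) x hab
  have e0 : ∀ z, crossings c z y = ∑ k, ∑ l, prec c.1 k l * prec c.2 (z k) (y l) := fun z =>
    Finset.sum_comm
  rw [e0, e0, h, ← Finset.sum_add_distrib, ← Finset.sum_sub_distrib, ← Finset.sum_sub_distrib]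
  have hya : y a = x b := swap_mul_apply_left x a b
  have hyb : y b = x a := swap_mul_apply_right x a b
  -- reversing the order of a pair changes each factor by a correction at the two columns
  have h1 : ∀ l, prec c.1 b l - prec c.1 a l = -(prec c.1 l b - prec c.1 l a) +
      ((if l = a then 1 else 0) - if l = b then 1 else 0) := fun l => by
    have h2 := prec_add_prec c.1 l b
    have h3 := prec_add_prec c.1 l a
    linarith
  have h2 : ∀ l, prec c.2 (x b) (y l) - prec c.2 (x a) (y l) =
      -(prec c.2 (y l) (x b) - prec c.2 (y l) (x a)) -
      ((if l = a then 1 else 0) - if l = b then 1 else 0) := fun l => by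
    have h2 := prec_add_prec c.2 (y l) (x b)
    have h3 := prec_add_prec c.2 (y l) (x a)
    rw [← hya] at h2
    rw [← hyb] at h3
    simp only [y.injective.eq_iff] at h2 h3
    rw [← hya, ← hyb]
    linarith
  have h3 : ∀ l, prec c.1 a l * prec c.2 (x a) (y l) + prec c.1 b l * prec c.2 (x b) (y l) -
      prec c.1 a l * prec c.2 (x b) (y l) - prec c.1 b l * prec c.2 (x a) (y l) =
      (prec c.1 l b - prec c.1 l a) * (prec c.2 (y l) (x b) - prec c.2 (y l) (x a)) +
      ((if l = a then 1 else 0) - if l = b then 1 else 0) *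
        ((prec c.1 l b - prec c.1 l a) - (prec c.2 (y l) (x b) - prec c.2 (y l) (x a)) -
          ((if l = a then 1 else 0) - if l = b then 1 else 0)) := fun l => by
    have : prec c.1 a l * prec c.2 (x a) (y l) + prec c.1 b l * prec c.2 (x b) (y l) -
      prec c.1 a l * prec c.2 (x b) (y l) - prec c.1 b l * prec c.2 (x a) (y l) =
      (prec c.1 b l - prec c.1 a l) * (prec c.2 (x b) (y l) - prec c.2 (x a) (y l)) := by ring
    rw [this, h1, h2]
    ring
  simp only [h3]
  rw [Finset.sum_add_distrib]
  change mixedSum c x a b y + _ = _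
  rw [add_eq_left, Fintype.sum_eq_add a b hab]
  · rw [if_pos rfl, if_neg hab, if_neg hab.symm, if_pos rfl, hya, hyb]
    have h1 := prec_add_prec c.1 a b
    have h2 := prec_add_prec c.2 (x a) (x b)
    have h3 := prec_add_prec c.1 a a
    have h4 := prec_add_prec c.1 b b
    have h5 := prec_add_prec c.2 (x a) (x a)
    have h6 := prec_add_prec c.2 (x b) (x b)
    rw [if_neg hab] at h1
    rw [if_neg (x.injective.ne hab)] at h2
    rw [if_pos rfl] at h3 h4 h5 h6
    linarith
  · rintro l ⟨ha, hb⟩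
    rw [if_neg ha, if_neg hb, sub_self, zero_mul]

theorem mixedSum_eq (c : Fin N × Fin N) (x : Equiv.Perm (Fin N)) {a b : Fin N} (hab : a ≠ b)
    (z w : Equiv.Perm (Fin N)) :
    mixedSum c x a b z - mixedSum c x a b w =
      ∑ k, (rectDomain x (a, b) (k, z k) : ℤ) - ∑ k, (rectDomain x (a, b) (k, w k) : ℤ) := by
  have key : ∀ z : Equiv.Perm (Fin N), mixedSum c x a b z =
      ∑ k, (rectDomain x (a, b) (k, z k) : ℤ) -
      (prec c.1 b a * ∑ l, (arc (x a) (x b) l : ℤ) + prec c.2 (x b) (x a) * ∑ k, (arc a b k : ℤ) -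
        N * (prec c.1 b a * prec c.2 (x b) (x a))) := by
    intro z
    have h1 : ∀ k, (prec c.1 k b - prec c.1 k a) * (prec c.2 (z k) (x b) - prec c.2 (z k) (x a)) =
        (rectDomain x (a, b) (k, z k) : ℤ) - (prec c.1 b a * (arc (x a) (x b) (z k) : ℤ) +
          prec c.2 (x b) (x a) * (arc a b k : ℤ) - prec c.1 b a * prec c.2 (x b) (x a)) := by
      intro k
      rw [rectDomain]
      push_cast
      rw [arc_eq_prec c.1 hab, arc_eq_prec c.2 (x.injective.ne hab)]
      ring
    unfold mixedSum
    simp only [h1, Finset.sum_sub_distrib, Finset.sum_add_distrib, ← Finset.mul_sum,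
      Finset.sum_const, Finset.card_univ, Fintype.card_fin, nsmul_eq_mul]
    rw [Equiv.sum_comp z fun l => (arc (x a) (x b) l : ℤ)]
    ring
  rw [key z, key w]
  ring

/-- The change of the Maslov grading along an arbitrary rectangle on the torus. -/
theorem maslov_sub_maslov_swap (g : GraphGrid N) (c : Fin N × Fin N) (x : g.State) {a b : Fin N}
    (hab : a ≠ b) :
    g.maslov c x - g.maslov c (x * Equiv.swap a b) =
      2 * ∑ k, (rectDomain x (a, b) (k, x k) : ℤ) - 1 -
        2 * ∑ k, (rectDomain x (a, b) (k, g.O k) : ℤ) := by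
  rw [maslov_eq_crossings, maslov_eq_crossings]
  have h1 := crossings_sub_swap_right c x x hab
  have h2 := crossings_swap_sub_swap c x hab
  have h3 := crossings_sub_swap_right c x g.O hab
  have h4 := mixedSum_sub_swap c x hab
  have h5 := mixedSum_eq c x hab x g.O
  linarith

theorem sum_rectDomain_of_isEmptyRect {x : Equiv.Perm (Fin N)} {r : Fin N × Fin N}
    (h : IsEmptyRect x r) : ∑ k, (rectDomain x r (k, x k) : ℤ) = 1 := by
  rw [Finset.sum_eq_single r.1]
  · simp [rectDomain, arc, between_left h.1, between_left (x.injective.ne h.1)]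
  · intro k _ hk
    rw [Nat.cast_eq_zero, rectDomain_eq_zero_iff]
    rintro ⟨h1, h2⟩
    refine h.2 k hk ?_ ⟨h1, h2⟩
    rintro rfl
    exact not_between_right _ _ h1
  · simp

theorem maslov_swap_of_isEmptyRect (g : GraphGrid N) (c : Fin N × Fin N) {x : g.State}
    {r : Fin N × Fin N} (h : IsEmptyRect x r) :
    g.maslov c (x * Equiv.swap r.1 r.2) =
      g.maslov c x - 1 + 2 * ∑ k, (rectDomain x r (k, g.O k) : ℤ) := by
  have h1 := maslov_sub_maslov_swap g c x h.1
  have h2 := sum_rectDomain_of_isEmptyRect h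
  simp only [Prod.mk.eta] at h1
  linarith

/-- The weights of all markings as a function on the squares; those of the `O`'s and `O*`'s are
counted negatively. -/
def weightFun {g : GraphGrid N} (ω : g.Weight) (s : Fin N × Fin N) : ℤ :=
  ω.onX s - if s.2 = g.O s.1 then ω.onO s.1 else 0

variable {g : GraphGrid N} (ω : g.Weight)

theorem sum_weightFun_col (k : Fin N) : ∑ l, weightFun ω (k, l) = 0 := by
  simp only [weightFun, Finset.sum_sub_distrib, Finset.sum_ite_eq', Finset.mem_univ, if_true,
    ω.col_balance, sub_self]

theorem sum_weightFun_row (l : Fin N) : ∑ k, weightFun ω (k, l) = 0 := by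
  obtain ⟨m, rfl⟩ := g.O.surjective l
  simp only [weightFun, Finset.sum_sub_distrib, g.O.injective.eq_iff, Finset.sum_ite_eq,
    Finset.mem_univ, if_true, ω.row_balance, sub_self]

theorem weightSum_eq (c : Fin N × Fin N) :
    g.weightSum ω c = ∑ s, Finsupp.single (squarePt c s) (weightFun ω s) := by
  have h1 : ∑ s ∈ g.X, Finsupp.single (squarePt c s) (ω.onX s) =
      ∑ s, Finsupp.single (squarePt c s) (ω.onX s) :=
    Finset.sum_subset (Finset.subset_univ _) fun s _ hs => by
      rw [ω.supp s hs, Finsupp.single_zero]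
  have h2 : ∑ s : Fin N × Fin N, Finsupp.single (squarePt c s)
      (if s.2 = g.O s.1 then ω.onO s.1 else 0) =
      ∑ k, Finsupp.single (squarePt c (k, g.O k)) (ω.onO k) := by
    rw [Fintype.sum_prod_type]
    refine Finset.sum_congr rfl fun k _ => ?_
    rw [Finset.sum_eq_single (g.O k)]
    · simp
    · intro l _ hl
      rw [if_neg hl, Finsupp.single_zero]
    · simp
  unfold weightSum weightFun
  simp only [Finsupp.single_sub, Finset.sum_sub_distrib, h1, h2]

/-- The total weight to the lower left of a lattice point. -/
def weightBelow (c p : Fin N × Fin N) : ℤ :=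
  ∑ s, weightFun ω s * (prec c.1 s.1 p.1 * prec c.2 s.2 p.2)

theorem alexander_eq_weightBelow (c : Fin N × Fin N) (x : g.State) :
    g.alexander ω c x = ((∑ k, weightBelow ω c (k, x k) : ℤ) : ℚ) := by
  have h1 : pairingI (g.weightSum ω c) (g.stateSum c x) = ∑ k, weightBelow ω c (k, x k) := by
    rw [weightSum_eq]
    simp only [stateSum, map_sum, LinearMap.sum_apply, pairingI_square_lattice, one_mul]
    rfl
  have h2 : pairingI (g.stateSum c x) (g.weightSum ω c) = ∑ k, weightBelow ω c (k, x k) := by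
    rw [weightSum_eq]
    simp only [stateSum, map_sum, LinearMap.sum_apply, pairingI_lattice_square, one_mul]
    rw [Finset.sum_comm]
    refine Finset.sum_congr rfl fun k _ => ?_
    have e1 : ∑ s : Fin N × Fin N, weightFun ω s = 0 := by
      rw [Fintype.sum_prod_type]
      simp [sum_weightFun_col]
    have e2 : ∑ s : Fin N × Fin N, weightFun ω s * prec c.1 s.1 k = 0 := by
      rw [Fintype.sum_prod_type]
      simp [← Finset.sum_mul, sum_weightFun_col]
    have e3 : ∑ s : Fin N × Fin N, weightFun ω s * prec c.2 s.2 (x k) = 0 := by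
      rw [Fintype.sum_prod_type_right]
      simp [← Finset.sum_mul, sum_weightFun_row]
    have e4 : ∀ s : Fin N × Fin N, weightFun ω s *
        ((1 - prec c.1 s.1 k) * (1 - prec c.2 s.2 (x k))) = weightFun ω s -
        weightFun ω s * prec c.1 s.1 k - weightFun ω s * prec c.2 s.2 (x k) +
        weightFun ω s * (prec c.1 s.1 k * prec c.2 s.2 (x k)) := fun s => by ring
    simp only [e4, Finset.sum_add_distrib, Finset.sum_sub_distrib, e1, e2, e3]
    simp [weightBelow]
  rw [alexander, countJ, countI_eq_pairingI, countI_eq_pairingI, h1, h2]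
  ring

/-- The change of the Alexander grading along an arbitrary rectangle on the torus. -/
theorem alexander_sub_alexander_swap (c : Fin N × Fin N) (x : g.State) {a b : Fin N}
    (hab : a ≠ b) :
    g.alexander ω c x - g.alexander ω c (x * Equiv.swap a b) =
      ((∑ s, weightFun ω s * (rectDomain x (a, b) s : ℤ) : ℤ) : ℚ) := by
  rw [alexander_eq_weightBelow, alexander_eq_weightBelow, ← Int.cast_sub]
  congr 1
  have h := sum_sub_sum_swap (fun k l => weightBelow ω c (k, l)) x hab
  rw [h]
  unfold weightBelow
  rw [← Finset.sum_add_distrib, ← Finset.sum_sub_distrib, ← Finset.sum_sub_distrib]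
  have e1 : ∑ s : Fin N × Fin N, weightFun ω s = 0 := by
    rw [Fintype.sum_prod_type]
    simp [sum_weightFun_col]
  have e2 : ∑ s : Fin N × Fin N, weightFun ω s * (arc a b s.1 : ℤ) = 0 := by
    rw [Fintype.sum_prod_type]
    simp [← Finset.sum_mul, sum_weightFun_col]
  have e3 : ∑ s : Fin N × Fin N, weightFun ω s * (arc (x a) (x b) s.2 : ℤ) = 0 := by
    rw [Fintype.sum_prod_type_right]
    simp [← Finset.sum_mul, sum_weightFun_row]
  have e4 : ∀ s : Fin N × Fin N,
      weightFun ω s * (prec c.1 s.1 a * prec c.2 s.2 (x a)) +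
        weightFun ω s * (prec c.1 s.1 b * prec c.2 s.2 (x b)) -
        weightFun ω s * (prec c.1 s.1 a * prec c.2 s.2 (x b)) -
        weightFun ω s * (prec c.1 s.1 b * prec c.2 s.2 (x a)) =
      weightFun ω s * (rectDomain x (a, b) s : ℤ) -
        weightFun ω s * (arc a b s.1 : ℤ) * prec c.2 (x b) (x a) -
        weightFun ω s * (arc (x a) (x b) s.2 : ℤ) * prec c.1 b a +
        weightFun ω s * (prec c.1 b a * prec c.2 (x b) (x a)) := fun s => by
    rw [rectDomain]
    push_cast
    rw [arc_eq_prec c.1 hab, arc_eq_prec c.2 (x.injective.ne hab)]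
    ring
  simp only [e4, Finset.sum_add_distrib, Finset.sum_sub_distrib, ← Finset.sum_mul, e1, e2, e3]
  ring

end Gradings

/-! ### The bigrading of the chain complex -/

section Bigrading

variable {N : ℕ} {g : GraphGrid N} (ω : g.Weight) (c : Fin N × Fin N)

/-- The negative bidegree `(2, ω(O_k))` of the variable `U_k`. -/
def gradeWeight {σ : Type*} (w : σ → ℤ) (k : σ) : ℤ × ℚ := (2, (w k : ℚ))

theorem nsmul_gradeWeight {σ : Type*} (w : σ → ℤ) (k : σ) (b : ℕ) :
    b • gradeWeight w k = (2 * (b : ℤ), (b : ℚ) * (w k : ℚ)) := by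
  ext
  · exact (nsmul_eq_mul _ _).trans (mul_comm _ _)
  · exact nsmul_eq_mul _ _

theorem weight_gradeWeight (w : Fin N → ℤ) (e : Fin N →₀ ℕ) :
    Finsupp.weight (gradeWeight w) e =
      (2 * ∑ k, (e k : ℤ), ∑ k, (e k : ℚ) * (w k : ℚ)) := by
  rw [Finsupp.weight_apply, Finsupp.sum_fintype _ _ (by simp)]
  ext
  · simp only [Prod.fst_sum, nsmul_gradeWeight, Finset.mul_sum]
  · simp only [Prod.snd_sum, nsmul_gradeWeight]

/-- A state times a homogeneous polynomial is homogeneous. -/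
theorem single_mem_graded (x : g.State) {p : MvPolynomial (Fin N) (ZMod 2)} {m : ℤ} {s : ℚ}
    (hp : p.IsWeightedHomogeneous (gradeWeight ω.onO) (g.maslov c x - m, g.alexander ω c x - s)) :
    Finsupp.single x p ∈ g.graded ω c m s := by
  classical
  rw [p.as_sum, Finsupp.single_finsetSum]
  refine Submodule.sum_mem _ fun e he => ?_
  rw [MvPolynomial.mem_support_iff] at he
  have h := hp he
  rw [weight_gradeWeight, Prod.mk.injEq] at h
  have h1 : MvPolynomial.coeff e p = 1 := by
    generalize MvPolynomial.coeff e p = b at he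
    revert he b
    decide
  rw [h1]
  exact Submodule.subset_span ⟨x, e, by linarith [h.1], by linarith [h.2], rfl⟩

/-- Additive maps may be checked on states with homogeneous coefficients to be compatible
with gradings. -/
theorem map_mem_of_mem_graded {C : Type*} [AddCommGroup C] [Module (ZMod 2) C] (f : g.CF →+ C)
    {S : Submodule (ZMod 2) C} {m : ℤ} {s : ℚ}
    (h : ∀ (x : g.State) (p : MvPolynomial (Fin N) (ZMod 2)),
      p.IsWeightedHomogeneous (gradeWeight ω.onO) (g.maslov c x - m, g.alexander ω c x - s) →
      f (Finsupp.single x p) ∈ S) {z : g.CF} (hz : z ∈ g.graded ω c m s) : f z ∈ S := by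
  induction hz using Submodule.span_induction with
  | mem z hz =>
    obtain ⟨x, e, rfl, rfl, rfl⟩ := hz
    refine h x _ (MvPolynomial.isWeightedHomogeneous_monomial _ _ _ ?_)
    rw [weight_gradeWeight, sub_sub_cancel, sub_sub_cancel]
  | zero => rw [map_zero]; exact S.zero_mem
  | add z w _ _ hz hw => rw [map_add]; exact S.add_mem hz hw
  | smul b z _ hz =>
    have hb : b = 0 ∨ b = 1 := by revert b; decide
    obtain rfl | rfl := hb
    · rw [zero_smul, map_zero]; exact S.zero_mem
    · rwa [one_smul]

/-- The basis of `CF⁻(g)` over `ℤ/2` that consists of the elements `U^e · x`. -/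
def monomialBasis (g : GraphGrid N) :
    Module.Basis (Σ _ : g.State, Fin N →₀ ℕ) (ZMod 2) g.CF :=
  Finsupp.basis fun _ => MvPolynomial.basisMonomials (Fin N) (ZMod 2)

theorem monomialBasis_apply (g : GraphGrid N) (x : g.State) (e : Fin N →₀ ℕ) :
    g.monomialBasis ⟨x, e⟩ = Finsupp.single x (MvPolynomial.monomial e 1) := by
  simp [monomialBasis]

/-- The bidegree of the element `U^e · x`. -/
def bidegree (b : Σ _ : g.State, Fin N →₀ ℕ) : ℤ × ℚ :=
  (g.maslov c b.1 - 2 * ∑ k, (b.2 k : ℤ),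
    g.alexander ω c b.1 - ∑ k, (b.2 k : ℚ) * (ω.onO k : ℚ))

theorem graded_eq_span (d : ℤ × ℚ) :
    g.graded ω c d.1 d.2 =
      Submodule.span (ZMod 2) (g.monomialBasis '' (bidegree ω c ⁻¹' {d})) := by
  unfold graded
  congr 1
  ext z
  constructor
  · rintro ⟨x, e, h1, h2, rfl⟩
    exact ⟨⟨x, e⟩, Prod.ext h1 h2, monomialBasis_apply g x e⟩
  · rintro ⟨⟨x, e⟩, h, rfl⟩
    exact ⟨x, e, congrArg Prod.fst h, congrArg Prod.snd h, monomialBasis_apply g x e⟩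

theorem isInternal_graded :
    DirectSum.IsInternal (fun d : ℤ × ℚ => g.graded ω c d.1 d.2) := by
  rw [DirectSum.isInternal_submodule_iff_iSupIndep_and_iSup_eq_top]
  simp only [graded_eq_span]
  constructor
  · intro d
    simp only [← Submodule.span_iUnion, ← Set.image_iUnion]
    refine g.monomialBasis.linearIndependent.disjoint_span_image ?_
    rw [Set.disjoint_left]
    intro b hb hb'
    simp only [Set.mem_iUnion] at hb'
    obtain ⟨d', hd', hb'⟩ := hb'
    exact hd' (hb'.symm.trans hb)
  · rw [← Submodule.span_iUnion, ← Set.image_iUnion, eq_top_iff, ← g.monomialBasis.span_eq]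
    refine Submodule.span_mono ?_
    rintro _ ⟨b, rfl⟩
    exact ⟨b, Set.mem_iUnion.2 ⟨_, rfl⟩, rfl⟩

/-- The weights of the `O`'s and `O*`'s in a domain, minus the weights of the `X`'s. -/
theorem sum_weightFun_mul (D : Fin N × Fin N → ℤ) :
    ∑ s, weightFun ω s * D s = ∑ s ∈ g.X, ω.onX s * D s - ∑ k, ω.onO k * D (k, g.O k) := by
  have h1 : ∑ s ∈ g.X, ω.onX s * D s = ∑ s, ω.onX s * D s :=
    Finset.sum_subset (Finset.subset_univ _) fun s _ hs => by rw [ω.supp s hs, zero_mul]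
  have h2 : ∑ s : Fin N × Fin N, (if s.2 = g.O s.1 then ω.onO s.1 else 0) * D s =
      ∑ k, ω.onO k * D (k, g.O k) := by
    rw [Fintype.sum_prod_type]
    refine Finset.sum_congr rfl fun k _ => ?_
    rw [Finset.sum_eq_single (g.O k)]
    · simp
    · intro l _ hl
      rw [if_neg hl, zero_mul]
    · simp
  simp only [weightFun, sub_mul, Finset.sum_sub_distrib, h1, h2]

theorem alexander_swap_of_isEmptyRect {x : g.State} {r : Fin N × Fin N} (h : IsEmptyRect x r) :
    g.alexander ω c (x * Equiv.swap r.1 r.2) = g.alexander ω c x -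
      ((∑ s ∈ g.X, ω.onX s * (rectDomain x r s : ℤ) -
        ∑ k, ω.onO k * (rectDomain x r (k, g.O k) : ℤ) : ℤ) : ℚ) := by
  have h1 := alexander_sub_alexander_swap ω c x h.1
  rw [sum_weightFun_mul ω fun s => (rectDomain x (r.1, r.2) s : ℤ)] at h1
  rw [← h1]
  ring

theorem isWeightedHomogeneous_prod_X_pow (w : Fin N → ℤ) (T : Finset (Fin N)) (f : Fin N → ℕ) :
    (∏ k ∈ T, MvPolynomial.X k ^ f k : MvPolynomial (Fin N) (ZMod 2)).IsWeightedHomogeneous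
      (gradeWeight w) (2 * ∑ k ∈ T, (f k : ℤ), ((∑ k ∈ T, w k * f k : ℤ) : ℚ)) := by
  have h := MvPolynomial.IsWeightedHomogeneous.prod T
    (fun k => (MvPolynomial.X k ^ f k : MvPolynomial (Fin N) (ZMod 2)))
    (fun k => f k • gradeWeight w k)
    fun k _ => (MvPolynomial.isWeightedHomogeneous_X (ZMod 2) (gradeWeight w) k).pow (f k)
  convert h using 1
  ext
  · simp only [Prod.fst_sum, nsmul_gradeWeight, Finset.mul_sum]
  · simp only [Prod.snd_sum, nsmul_gradeWeight, Int.cast_sum, Int.cast_mul, Int.cast_natCast,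
      mul_comm]

theorem diff_mem_graded {m : ℤ} {s : ℚ} {z : g.CF} (hz : z ∈ g.graded ω c m s) :
    g.diff z ∈ g.graded ω c (m - 1) s := by
  classical
  refine map_mem_of_mem_graded ω c g.diff.toAddMonoidHom (fun x p hp => ?_) hz
  change g.diff (Finsupp.single x p) ∈ _
  rw [diff_eq_rectMap, rectMap_single]
  refine Submodule.sum_mem _ fun r hr => ?_
  have hr := (Finset.mem_filter.1 hr).2
  by_cases hX : ∀ s ∈ g.X, rectDomain x r s = 0
  · rw [diffCoeff, if_pos hX]
    refine single_mem_graded ω c _ ?_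
    rw [maslov_swap_of_isEmptyRect g c hr, alexander_swap_of_isEmptyRect ω c hr,
      Finset.sum_eq_zero (s := g.X) fun s hs => by rw [hX s hs, Nat.cast_zero, mul_zero]]
    convert hp.mul (isWeightedHomogeneous_prod_X_pow ω.onO Finset.univ
      fun k => rectDomain x r (k, g.O k)) using 1
    ext
    · simp only [Prod.fst_add]
      ring
    · simp only [Prod.snd_add]
      push_cast
      ring
  · rw [diffCoeff, if_neg hX, mul_zero, Finsupp.single_zero]
    exact Submodule.zero_mem _

theorem isBigradedComplex : IsBigradedComplex g.diff (g.graded ω c) ω.onO where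
  splits := isInternal_graded ω c
  smul_mem k m s z hz := by
    refine map_mem_of_mem_graded ω c (DistribSMul.toAddMonoidHom g.CF (MvPolynomial.X k))
      (fun x p hp => ?_) hz
    rw [DistribSMul.toAddMonoidHom_apply, Finsupp.smul_single, smul_eq_mul]
    refine single_mem_graded ω c _ ?_
    convert (MvPolynomial.isWeightedHomogeneous_X (ZMod 2) (gradeWeight ω.onO) k).mul hp using 1
    ext
    · simp only [Prod.fst_add, gradeWeight]
      ring
    · simp only [Prod.snd_add, gradeWeight]
      ring
  sq_zero := g.diff_diff
  d_mem _ _ _ hz := diff_mem_graded ω c hz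

end Bigrading

/-! ### Comparison of the gradings of the two diagrams -/

/-- A function of the states that does not change along rectangles is constant. -/
theorem eq_of_forall_mul_swap {N : ℕ} {G : Type*} (f : Equiv.Perm (Fin N) → G)
    (h : ∀ x a b, a ≠ b → f (x * Equiv.swap a b) = f x) (x y : Equiv.Perm (Fin N)) :
    f x = f y := by
  have key : ∀ τ : Equiv.Perm (Fin N), f (y * τ) = f y := by
    intro τ
    induction τ using Equiv.Perm.swap_induction_on' with
    | one => rw [mul_one]
    | mul_swap τ a b hab hτ => rw [← mul_assoc, h _ a b hab, hτ]
  simpa using key (y⁻¹ * x)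

/-- The state formed by the lower left corners of the `O`'s has Maslov grading `1 - N` for every
cut. -/
theorem maslov_O {N : ℕ} (g : GraphGrid N) (c : Fin N × Fin N) : g.maslov c g.O = 1 - N := by
  rw [maslov_eq_crossings]
  ring

section GradingComparison

variable {n : ℕ} {g : GraphGrid (n + 1)} {g' : GraphGrid n} {i j : Fin n} {a : Fin (n + 1)}

theorem succ_succAbove_predAbove {i : Fin n} {l : Fin (n + 1)} (h : l ≠ i.succ) :
    i.succ.succAbove (i.predAbove l) = l := by
  rw [Fin.ne_iff_vne, Fin.val_succ] at h
  rw [Fin.ext_iff, val_succAbove, val_predAbove, Fin.val_succ]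
  split_ifs <;> omega

theorem predAbove_eq_iff {i : Fin n} {l : Fin (n + 1)} :
    i.predAbove l = i ↔ l = i.castSucc ∨ l = i.succ := by
  simp only [Fin.ext_iff, val_predAbove, Fin.val_castSucc, Fin.val_succ]
  split_ifs <;> omega

/-- The state of the larger diagram that corresponds to the `O`'s of the smaller one is that of the
`O`'s of the larger one, up to at most two rectangles. -/
theorem IsDestabilization.maslov_insertInner_O (hg : IsDestabilization g g' i j a)
    (c : Fin (n + 1) × Fin (n + 1)) : g.maslov c (insertInner i j g'.O) = -n := by
  have hO : ∀ k, k ≠ a → insertInner i j g'.O (j.succ.succAbove (j.predAbove k)) =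
      i.succ.succAbove (i.predAbove (g.O k)) := by
    intro k hk
    obtain ⟨k, rfl⟩ := Fin.exists_succAbove_eq hk
    rw [insertInner_succAbove, hg.O_eq, hg.predAbove_succAbove]
  rcases hg.posA with ⟨ha, ha'⟩ | ⟨ha, ha'⟩
  · have hm : g.O j.succ ≠ i.castSucc := by
      rw [← ha', ha]
      exact g.O.injective.ne (Fin.castSucc_lt_succ).ne'
    -- an `O` in the upper right square of the block would end up in the square of the merged `X`
    have hm' : g.O j.succ ≠ i.succ := by
      intro h
      have h1 := hg.O_eq j
      rw [ha, Fin.succAbove_castSucc_self, h, Fin.predAbove_succ_self] at h1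
      refine g'.disj j ?_
      rw [h1]
      exact hg.mem_X
    obtain ⟨k₀, hk₀⟩ := g.O.surjective i.succ
    have hk₁ : k₀ ≠ j.succ := fun h => hm' (h ▸ hk₀)
    have hk₂ : k₀ ≠ j.castSucc := by
      rintro rfl
      rw [← ha, ha'] at hk₀
      exact (Fin.castSucc_lt_succ).ne hk₀
    have hj : j.castSucc ≠ j.succ := (Fin.castSucc_lt_succ).ne
    rw [ha] at ha' hO
    have e1 : (g.O * Equiv.swap j.castSucc j.succ) j.castSucc = g.O j.succ :=
      swap_mul_apply_left _ _ _
    have e2 : (g.O * Equiv.swap j.castSucc j.succ) j.succ = i.castSucc :=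
      (swap_mul_apply_right _ _ _).trans ha'
    have e3 : (g.O * Equiv.swap j.castSucc j.succ) k₀ = i.succ :=
      (swap_mul_apply_of_ne _ hk₂ hk₁).trans hk₀
    have hx : insertInner i j g'.O =
        g.O * Equiv.swap j.castSucc j.succ * Equiv.swap j.succ k₀ := by
      ext1 k
      by_cases h1 : k = j.succ
      · rw [h1, insertInner_succ, swap_mul_apply_left, e3]
      by_cases h2 : k = k₀
      · have := hO k₀ hk₂
        rw [succ_succAbove_predAbove hk₁, hk₀, Fin.predAbove_succ_self,
          Fin.succAbove_succ_self] at this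
        rw [h2, swap_mul_apply_right, e2, this]
      by_cases h3 : k = j.castSucc
      · have := hO j.succ hj.symm
        rw [Fin.predAbove_succ_self, Fin.succAbove_succ_self,
          succ_succAbove_predAbove hm'] at this
        rw [h3, swap_mul_apply_of_ne _ hj (h3 ▸ h2), e1, this]
      · have := hO k h3
        rw [succ_succAbove_predAbove h1, succ_succAbove_predAbove] at this
        · rw [swap_mul_apply_of_ne _ h1 h2, swap_mul_apply_of_ne _ h3 h1, this]
        · rw [← hk₀]
          exact g.O.injective.ne h2
    have h1 := maslov_sub_maslov_swap g c g.O hj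
    have h2 := maslov_sub_maslov_swap g c (g.O * Equiv.swap j.castSucc j.succ) hk₁.symm
    have h3 := sum_sub_sum_swap (fun k l =>
      (rectDomain (g.O * Equiv.swap j.castSucc j.succ) (j.succ, k₀) (k, l) : ℤ)) g.O hj
    have h4 : arc j.succ k₀ j.castSucc = 0 := by
      refine if_neg fun h => ?_
      rw [between_iff] at h
      rw [Fin.ne_iff_vne] at hk₁
      simp only [Fin.val_succ, Fin.val_castSucc] at h hk₁
      omega
    have h5 : arc i.castSucc i.succ (g.O j.succ) = 0 := by
      refine if_neg fun h => ?_
      rw [between_iff] at h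
      rw [Fin.ne_iff_vne] at hm
      simp only [Fin.val_succ, Fin.val_castSucc] at h hm
      omega
    have h6 : arc j.succ k₀ j.succ = 1 := if_pos (between_left hk₁.symm)
    have h7 : arc i.castSucc i.succ i.castSucc = 1 :=
      if_pos (between_left (Fin.castSucc_lt_succ).ne)
    simp only [rectDomain, e2, e3, ha', h4, h5, h6, h7] at h2 h3
    rw [maslov_O] at h1
    rw [hx]
    push_cast at h1 h2 h3 ⊢
    linarith
  · have : insertInner i j g'.O = g.O := by
      ext1 k
      by_cases hk : k = j.succ
      · rw [hk, insertInner_succ, ← ha, ha']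
      · have h1 := hO k (ha ▸ hk)
        rw [succ_succAbove_predAbove hk, succ_succAbove_predAbove] at h1
        · exact h1
        · rw [← ha']
          exact g.O.injective.ne (ha ▸ hk)
    rw [this, maslov_O]
    push_cast
    ring

/-- Adding the centre of the block to a state decreases the Maslov grading by one: the changes along
a rectangle agree because the centre of the block and `A` cancel. -/
theorem IsDestabilization.maslov_insertInner (hg : IsDestabilization g g' i j a)
    (c : Fin (n + 1) × Fin (n + 1)) (c' : Fin n × Fin n) (y : g'.State) :
    g.maslov c (insertInner i j y) = g'.maslov c' y - 1 := by
  have h := eq_of_forall_mul_swap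
    (fun y => g.maslov c (insertInner i j y) - g'.maslov c' y) (fun y b d hbd => ?_) y g'.O
  · rw [hg.maslov_insertInner_O, maslov_O] at h
    linarith
  · have h1 := maslov_sub_maslov_swap g c (insertInner i j y)
      ((Fin.succAbove_right_injective (p := j.succ)).ne hbd)
    have h2 := maslov_sub_maslov_swap g' c' y hbd
    rw [← insertInner_mul_swap, Fin.sum_univ_succAbove _ j.succ, Fin.sum_univ_succAbove _ a] at h1
    have h3 := rectDomain_insertInner i j y (b, d)
    obtain ⟨hp1, hp2⟩ := Prod.mk.inj hg.predAbove_O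
    simp only at h3
    simp only [h3, insertInner_succ, insertInner_succAbove, predAbove_succ_succAbove,
      hg.predAbove_succAbove, ← hg.O_eq, Fin.predAbove_succ_self,
      hp1, hp2] at h1
    linarith

variable {ω : g.Weight} {ω' : g'.Weight}

/-- No two `X`'s become equal outside the block. -/
theorem eq_of_predAbove_eq
    (hrows : ∀ k, k ≠ j.castSucc → k ≠ j.succ →
      ¬ ((k, i.castSucc) ∈ g.X ∧ (k, i.succ) ∈ g.X))
    (hcols : ∀ l, l ≠ i.castSucc → l ≠ i.succ →
      ¬ ((j.castSucc, l) ∈ g.X ∧ (j.succ, l) ∈ g.X))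
    {s r : Fin (n + 1) × Fin (n + 1)} (hs : s ∈ g.X) (hr : r ∈ g.X)
    (h1 : j.predAbove s.1 = j.predAbove r.1) (h2 : i.predAbove s.2 = i.predAbove r.2)
    (h : ¬ (j.predAbove s.1 = j ∧ i.predAbove s.2 = i)) : s = r := by
  have key : ∀ (p : Fin n) (k l : Fin (n + 1)), p.predAbove k = p.predAbove l →
      k = l ∨ (p.predAbove k = p ∧
        (k = p.castSucc ∧ l = p.succ ∨ k = p.succ ∧ l = p.castSucc)) := by
    intro p k l
    simp only [Fin.ext_iff, val_predAbove, Fin.val_castSucc, Fin.val_succ]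
    split_ifs <;> omega
  obtain ⟨s1, s2⟩ := s
  obtain ⟨r1, r2⟩ := r
  simp only at h1 h2 h
  rcases key j s1 r1 h1 with rfl | ⟨e1, f1⟩ <;> rcases key i s2 r2 h2 with rfl | ⟨e2, f2⟩
  · rfl
  · have h3 : ¬ (s1 = j.castSucc ∨ s1 = j.succ) := fun h3 => h ⟨predAbove_eq_iff.2 h3, e2⟩
    rw [not_or] at h3
    rcases f2 with ⟨rfl, rfl⟩ | ⟨rfl, rfl⟩
    · exact absurd ⟨hs, hr⟩ (hrows _ h3.1 h3.2)
    · exact absurd ⟨hr, hs⟩ (hrows _ h3.1 h3.2)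
  · have h3 : ¬ (s2 = i.castSucc ∨ s2 = i.succ) := fun h3 => h ⟨e1, predAbove_eq_iff.2 h3⟩
    rw [not_or] at h3
    rcases f1 with ⟨rfl, rfl⟩ | ⟨rfl, rfl⟩
    · exact absurd ⟨hs, hr⟩ (hcols _ h3.1 h3.2)
    · exact absurd ⟨hr, hs⟩ (hcols _ h3.1 h3.2)
  · exact absurd ⟨e1, e2⟩ h

theorem IsDestabilization.sum_fiber_of_ne (hg : IsDestabilization g g' i j a)
    (hω : IsInducedWeight i j a ω ω')
    (hrows : ∀ k, k ≠ j.castSucc → k ≠ j.succ →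
      ¬ ((k, i.castSucc) ∈ g.X ∧ (k, i.succ) ∈ g.X))
    (hcols : ∀ l, l ≠ i.castSucc → l ≠ i.succ →
      ¬ ((j.castSucc, l) ∈ g.X ∧ (j.succ, l) ∈ g.X))
    {r : Fin n × Fin n} (hr : r ≠ (j, i)) :
    ∑ s, (if (j.predAbove s.1, i.predAbove s.2) = r then weightFun ω s else 0) =
      weightFun ω' r := by
  have hX : ∑ s, (if (j.predAbove s.1, i.predAbove s.2) = r then ω.onX s else 0) = ω'.onX r := by
    by_cases h : r ∈ g'.X
    · rw [hg.X_eq, Finset.mem_image] at h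
      obtain ⟨s, hs, rfl⟩ := h
      rw [Finset.sum_eq_single s, if_pos rfl, hω.onX_eq s hs hr]
      · intro q _ hq
        rw [ite_eq_right_iff]
        intro he
        refine ω.supp q fun hqX => hq ?_
        rw [Prod.mk.injEq] at he
        rw [ne_eq, Prod.mk.injEq, ← he.1, ← he.2] at hr
        exact eq_of_predAbove_eq hrows hcols hqX hs he.1 he.2 hr
      · exact fun h => absurd (Finset.mem_univ _) h
    · rw [ω'.supp r h]
      refine Finset.sum_eq_zero fun q _ => ?_
      rw [ite_eq_right_iff]
      rintro rfl
      refine ω.supp q fun hq => h ?_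
      rw [hg.X_eq]
      exact Finset.mem_image_of_mem _ hq
  have hO : ∑ s : Fin (n + 1) × Fin (n + 1), (if (j.predAbove s.1, i.predAbove s.2) = r then
      (if s.2 = g.O s.1 then ω.onO s.1 else 0) else 0) =
      if r.2 = g'.O r.1 then ω'.onO r.1 else 0 := by
    rw [Fintype.sum_prod_type]
    have h1 : ∀ k : Fin (n + 1), ∑ l, (if (j.predAbove k, i.predAbove l) = r then
        (if l = g.O k then ω.onO k else 0) else 0) =
        if (j.predAbove k, i.predAbove (g.O k)) = r then ω.onO k else 0 := by
      intro k
      rw [Finset.sum_eq_single (g.O k)]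
      · rw [if_pos rfl]
      · intro l _ hl
        rw [if_neg hl, ite_self]
      · simp
    simp only [h1]
    rw [Fin.sum_univ_succAbove _ a, hg.predAbove_O, if_neg hr.symm, zero_add]
    simp only [hg.predAbove_succAbove, ← hg.O_eq, ← hω.onO_eq]
    rw [Finset.sum_eq_single r.1]
    · refine if_congr ?_ rfl rfl
      rw [Prod.ext_iff]
      simp [eq_comm]
    · intro k _ hk
      rw [if_neg]
      rintro rfl
      exact hk rfl
    · simp
  rw [weightFun, ← hX, ← hO, ← Finset.sum_sub_distrib]
  refine Finset.sum_congr rfl fun s _ => ?_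
  rw [weightFun]
  split_ifs <;> simp

/-- Merging rows and columns takes the weights of `g` to those of `g'`. Outside the block this holds
by assumption; in the block it follows as the weights in a column add up to zero. -/
theorem IsDestabilization.sum_fiber (hg : IsDestabilization g g' i j a)
    (hω : IsInducedWeight i j a ω ω')
    (hrows : ∀ k, k ≠ j.castSucc → k ≠ j.succ →
      ¬ ((k, i.castSucc) ∈ g.X ∧ (k, i.succ) ∈ g.X))
    (hcols : ∀ l, l ≠ i.castSucc → l ≠ i.succ →
      ¬ ((j.castSucc, l) ∈ g.X ∧ (j.succ, l) ∈ g.X)) (r : Fin n × Fin n) :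
    ∑ s, (if (j.predAbove s.1, i.predAbove s.2) = r then weightFun ω s else 0) =
      weightFun ω' r := by
  by_cases hr : r = (j, i)
  · subst hr
    have h1 : ∑ l, ∑ s, (if (j.predAbove s.1, i.predAbove s.2) = (j, l) then weightFun ω s else 0)
        = 0 := by
      rw [Finset.sum_comm, Fintype.sum_prod_type]
      refine Finset.sum_eq_zero fun k _ => ?_
      by_cases hk : j.predAbove k = j
      · simp only [hk, Prod.mk.injEq, true_and, Finset.sum_ite_eq, Finset.mem_univ, if_true]
        exact sum_weightFun_col ω k
      · simp [hk]
    have h2 := sum_weightFun_col ω' j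
    rw [← Finset.add_sum_erase _ _ (Finset.mem_univ i)] at h1 h2
    have h3 := Finset.sum_congr (rfl : Finset.univ.erase i = _) fun l hl =>
      hg.sum_fiber_of_ne hω hrows hcols (r := (j, l))
        fun h => Finset.ne_of_mem_erase hl (congrArg Prod.snd h)
    linarith
  · exact hg.sum_fiber_of_ne hω hrows hcols hr

/-- Adding the centre of the block to a state changes the Alexander grading by a constant, since the
changes along a rectangle are given by the total weights of the markings it contains. -/
theorem IsDestabilization.alexander_insertInner (hg : IsDestabilization g g' i j a)
    (hω : IsInducedWeight i j a ω ω')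
    (hrows : ∀ k, k ≠ j.castSucc → k ≠ j.succ →
      ¬ ((k, i.castSucc) ∈ g.X ∧ (k, i.succ) ∈ g.X))
    (hcols : ∀ l, l ≠ i.castSucc → l ≠ i.succ →
      ¬ ((j.castSucc, l) ∈ g.X ∧ (j.succ, l) ∈ g.X))
    (c : Fin (n + 1) × Fin (n + 1)) (c' : Fin n × Fin n) :
    ∃ b : ℚ, ∀ y : g'.State,
      g.alexander ω c (insertInner i j y) = g'.alexander ω' c' y - b := by
  refine ⟨g'.alexander ω' c' 1 - g.alexander ω c (insertInner i j 1), fun y => ?_⟩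
  have h := eq_of_forall_mul_swap (fun y : g'.State =>
    g'.alexander ω' c' y - g.alexander ω c (insertInner i j y)) (fun y b d hbd => ?_) y 1
  · rw [← h, sub_sub_cancel]
  · have h1 := alexander_sub_alexander_swap ω c (insertInner i j y)
      ((Fin.succAbove_right_injective (p := j.succ)).ne hbd)
    have h2 := alexander_sub_alexander_swap ω' c' y hbd
    have h3 := rectDomain_insertInner i j y (b, d)
    simp only at h3
    have h4 : ∑ s, weightFun ω s *
        (rectDomain y (b, d) (j.predAbove s.1, i.predAbove s.2) : ℤ) =
        ∑ s, weightFun ω' s * (rectDomain y (b, d) s : ℤ) := by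
      simp only [← hg.sum_fiber hω hrows hcols, Finset.sum_mul]
      rw [Finset.sum_comm]
      refine Finset.sum_congr rfl fun s _ => ?_
      simp
    simp only [h3, ← insertInner_mul_swap, h4] at h1
    linarith

end GradingComparison

/-! ### The substituted element and the gradings of the destabilization map -/

section DestabGrading

variable {n : ℕ} {g : GraphGrid (n + 1)} {g' : GraphGrid n} {i j : Fin n} {a : Fin (n + 1)}
  {ω : g.Weight} {ω' : g'.Weight} {t t' : Fin (n + 1) × Fin (n + 1)}

open Classical in
/-- The coefficient `selCoeff`, which does not involve the variable of the `O` in column `a`, as an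
element of the smaller coefficient ring. -/
def redCoeff (g : GraphGrid (n + 1)) (t : Fin (n + 1) × Fin (n + 1)) (a : Fin (n + 1)) (p q : ℕ)
    (D : Fin (n + 1) × Fin (n + 1) → ℕ) : MvPolynomial (Fin n) (ZMod 2) :=
  if (∀ s ∈ g.X, s ≠ t → D s = 0) ∧ D t = p ∧ D (a, g.O a) = q then
    ∏ k, MvPolynomial.X k ^ D (a.succAbove k, g.O (a.succAbove k)) else 0

theorem inclVar_redCoeff (p q : ℕ) (D : Fin (n + 1) × Fin (n + 1) → ℕ) :
    inclVar a (g.redCoeff t a p q D) = g.selCoeff t a p q D := by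
  unfold redCoeff selCoeff
  split_ifs
  · rw [Finset.prod_filter, Fin.prod_univ_succAbove _ a, if_neg (not_not.2 rfl), one_mul, map_prod]
    refine Finset.prod_congr rfl fun k _ => ?_
    rw [if_pos (Fin.succAbove_ne a k), map_pow, MvPolynomial.rename_X]
  · rw [map_zero]

/-- By balance the `X` alone in its line has the weight of the `O` in that line. -/
theorem IsOnlyX.onX_eq (h : g.IsOnlyX t a) : ω.onX t = ω.onO a := by
  obtain ⟨ht, ⟨h1, h2⟩ | ⟨h1, h2⟩⟩ := h
  · rw [ω.row_balance, Finset.sum_eq_single t.1]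
    · rw [← h1]
    · exact fun k _ hk => ω.supp _ fun hX => hk (congrArg Prod.fst (h2 k hX))
    · simp
  · rw [ω.col_balance, Finset.sum_eq_single t.2]
    · rw [← h1]
    · exact fun l _ hl => ω.supp _ fun hX => hl (congrArg Prod.snd (h2 l hX))
    · simp

/-- The coefficient of an annulus of width one that contains the `X` in the square `t` is
homogeneous of the same degree as the variable of the `O` in column `a`. -/
theorem isWeightedHomogeneous_redCoeff (hω : IsInducedWeight i j a ω ω') (ho : g.IsOnlyX t a)
    {D : Fin (n + 1) × Fin (n + 1) → ℕ} (h1 : ∑ k, D (k, g.O k) = 1)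
    (h2 : ∑ s, weightFun ω s * (D s : ℤ) = 0) :
    (g.redCoeff t a 1 0 D).IsWeightedHomogeneous (gradeWeight ω'.onO)
      (gradeWeight ω.onO a) := by
  unfold redCoeff
  split_ifs with h
  · obtain ⟨hX, ht, ha⟩ := h
    rw [sum_weightFun_mul ω fun s => (D s : ℤ), Finset.sum_eq_single_of_mem t ho.1, ht,
      Fin.sum_univ_succAbove _ a, ha, ho.onX_eq] at h2
    · rw [Fin.sum_univ_succAbove _ a, ha, zero_add] at h1
      convert isWeightedHomogeneous_prod_X_pow ω'.onO Finset.univ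
        fun k => D (a.succAbove k, g.O (a.succAbove k)) using 1
      refine Prod.ext ?_ ?_
      · simp only [gradeWeight]
        rw [← Nat.cast_sum, h1]
        rfl
      · simp only [gradeWeight, hω.onO_eq]
        congr 1
        push_cast at h2
        linarith
    · intro s hs hst
      rw [hX s hs hst, Nat.cast_zero, mul_zero]
  · exact MvPolynomial.isWeightedHomogeneous_zero _ _ _

/-- The annuli through `t` that avoid `A` contribute an element `u` of the smaller coefficient ring,
which has the degree of the variable for which it is substituted. -/
theorem exists_inclVar_eq_selAnnuli (hω : IsInducedWeight i j a ω ω') (ho : g.IsOnlyX t a) :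
    ∃ u : MvPolynomial (Fin n) (ZMod 2), inclVar a u = g.selAnnuli t a 1 0 ∧
      u.IsWeightedHomogeneous (gradeWeight ω'.onO) (gradeWeight ω.onO a) := by
  refine ⟨∑ k, g.redCoeff t a 1 0 (columnDomain k) + ∑ l, g.redCoeff t a 1 0 (rowDomain l), ?_, ?_⟩
  · simp only [map_add, map_sum, inclVar_redCoeff]
    rfl
  · refine .add (.sum _ _ _ fun k _ => isWeightedHomogeneous_redCoeff hω ho ?_ ?_)
      (.sum _ _ _ fun l _ => isWeightedHomogeneous_redCoeff hω ho ?_ ?_)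
    · simp [columnDomain]
    · rw [Fintype.sum_prod_type]
      simp [columnDomain, sum_weightFun_col]
    · exact (Equiv.sum_comp g.O fun m => if m = l then 1 else 0).trans (by simp)
    · rw [Fintype.sum_prod_type_right]
      simp [rowDomain, sum_weightFun_row]

theorem isWeightedHomogeneous_substVar {u : MvPolynomial (Fin n) (ZMod 2)}
    (hω : IsInducedWeight i j a ω ω')
    (hu : u.IsWeightedHomogeneous (gradeWeight ω'.onO) (gradeWeight ω.onO a))
    {p : MvPolynomial (Fin (n + 1)) (ZMod 2)} {d : ℤ × ℚ}
    (hp : p.IsWeightedHomogeneous (gradeWeight ω.onO) d) :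
    (substVar a u p).IsWeightedHomogeneous (gradeWeight ω'.onO) d := by
  have hk : ∀ k, (substVar a u (MvPolynomial.X k)).IsWeightedHomogeneous (gradeWeight ω'.onO)
      (gradeWeight ω.onO k) := by
    intro k
    obtain rfl | ⟨k, rfl⟩ := Fin.eq_self_or_eq_succAbove a k
    · rwa [substVar_X_self]
    · rw [substVar_X_succAbove]
      convert MvPolynomial.isWeightedHomogeneous_X (ZMod 2) (gradeWeight ω'.onO) k using 1
      simp only [gradeWeight, hω.onO_eq]
  rw [p.as_sum, map_sum]
  refine .sum _ _ _ fun e he => ?_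
  rw [MvPolynomial.monomial_eq, map_mul, MvPolynomial.algHom_C, Finsupp.prod, map_prod,
    ← hp (MvPolynomial.mem_support_iff.1 he), Finsupp.weight_apply, Finsupp.sum,
    ← zero_add (∑ k ∈ e.support, _)]
  refine (MvPolynomial.isWeightedHomogeneous_C _ _).mul (.prod _ _ _ fun k _ => ?_)
  rw [map_pow]
  exact (hk k).pow _

/-- The destabilization map counts rectangles that contain the `X` in `t` and avoid all other `X`'s
and `A`. The drop of the Maslov grading by one is made up for by the removal of the centre of the
block, and the Alexander grading drops by the weight of the `X` in `t`. -/
theorem IsDestabilization.destabMap_mem_graded (hg : IsDestabilization g g' i j a)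
    (hω : IsInducedWeight i j a ω ω') (ho : g.IsOnlyX t a)
    {u : MvPolynomial (Fin n) (ZMod 2)}
    (hu : u.IsWeightedHomogeneous (gradeWeight ω'.onO) (gradeWeight ω.onO a))
    (c : Fin (n + 1) × Fin (n + 1)) (c' : Fin n × Fin n) {b : ℚ}
    (hA : ∀ y : g'.State, g.alexander ω c (insertInner i j y) = g'.alexander ω' c' y - b)
    {m : ℤ} {s : ℚ} {z : g.CF} (hz : z ∈ g.graded ω c m s) :
    destabMap g g' i j a u t z ∈ g'.graded ω' c' m (s + (b - ω.onX t)) := by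
  classical
  refine map_mem_of_mem_graded ω c (destabMap g g' i j a u t) (fun x p hp => ?_) hz
  rw [destabMap_apply, selMap, rectMap_single, map_sum]
  refine Submodule.sum_mem _ fun r hr => ?_
  have hr := (Finset.mem_filter.1 hr).2
  by_cases hD : (∀ s ∈ g.X, s ≠ t → rectDomain x r s = 0) ∧ rectDomain x r t = 1 ∧
      rectDomain x r (a, g.O a) = 0
  swap
  · rw [selCoeff, if_neg hD, mul_zero, Finsupp.single_zero, map_zero]
    exact Submodule.zero_mem _
  rw [selCoeff, if_pos hD]
  obtain ⟨hX, ht, ha⟩ := hD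
  by_cases hx : IsInner i j (x * Equiv.swap r.1 r.2)
  swap
  · rw [← restrictInner_innerProj, innerProj_single_of_not_isInner hx, map_zero]
    exact Submodule.zero_mem _
  have hM := maslov_swap_of_isEmptyRect g c hr
  have hA' := alexander_swap_of_isEmptyRect ω c hr
  rw [Finset.sum_eq_single_of_mem t ho.1 fun s hs hst => by
    rw [hX s hs hst, Nat.cast_zero, mul_zero], ht] at hA'
  obtain ⟨y, hy⟩ := exists_insertInner_eq hx
  rw [← hy, hg.maslov_insertInner c c'] at hM
  rw [← hy, hA] at hA'
  rw [← hy]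
  rw [restrictInner_single]
  refine single_mem_graded ω' c' y (isWeightedHomogeneous_substVar hω hu ?_)
  have h1 := isWeightedHomogeneous_prod_X_pow ω.onO (Finset.univ.filter fun k => k ≠ a)
    fun k => rectDomain x r (k, g.O k)
  rw [Finset.sum_filter_of_ne, Finset.sum_filter_of_ne] at h1
  · convert hp.mul h1 using 1
    ext
    · simp only [Prod.fst_add]
      linarith
    · simp only [Prod.snd_add]
      push_cast at hA' ⊢
      linarith
  · rintro k - hk rfl
    exact hk (by rw [ha, Nat.cast_zero, mul_zero])
  · rintro k - hk rfl
    exact hk (by rw [ha, Nat.cast_zero])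

/-- The condition on the line through `A` singles out one of the two `X`'s of the block. -/
theorem IsDestabilization.exists_isBlock (hg : IsDestabilization g g' i j a)
    (hA : (∃! k, (k, g.O a) ∈ g.X) ∨ (∃! l, (a, l) ∈ g.X)) :
    ∃ t t', IsBlock g a i j t t' ∧ g.IsOnlyX t a := by
  have hd : IsAntidiagonal i j (a, g.O a) := by
    rcases hg.posA with ⟨h1, h2⟩ | ⟨h1, h2⟩
    · exact Or.inl (by rw [h2, h1])
    · exact Or.inr (by rw [h2, h1])
  have h₁ : IsBlock g a i j (j.castSucc, i.succ) (j.succ, i.castSucc) :=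
    ⟨Or.inl ⟨rfl, rfl⟩, hd, hg.upperLeft, hg.lowerRight⟩
  have h₂ : IsBlock g a i j (j.succ, i.castSucc) (j.castSucc, i.succ) :=
    ⟨Or.inr ⟨rfl, rfl⟩, hd, hg.lowerRight, hg.upperLeft⟩
  have hrow : ∀ t ∈ g.X, t.2 = g.O a → (∃! k, (k, g.O a) ∈ g.X) → g.IsOnlyX t a :=
    fun t ht h hA => ⟨ht, Or.inl ⟨h, fun k hk =>
      Prod.ext (hA.unique hk (h ▸ ht)) h.symm⟩⟩
  have hcol : ∀ t ∈ g.X, t.1 = a → (∃! l, (a, l) ∈ g.X) → g.IsOnlyX t a :=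
    fun t ht h hA => ⟨ht, Or.inr ⟨h, fun l hl =>
      Prod.ext h.symm (hA.unique hl (h ▸ ht))⟩⟩
  rcases hg.posA with ⟨h1, h2⟩ | ⟨h1, h2⟩ <;> rcases hA with hA | hA
  · exact ⟨_, _, h₂, hrow _ hg.lowerRight h2.symm hA⟩
  · exact ⟨_, _, h₁, hcol _ hg.upperLeft h1.symm hA⟩
  · exact ⟨_, _, h₁, hrow _ hg.upperLeft h2.symm hA⟩
  · exact ⟨_, _, h₂, hcol _ hg.lowerRight h1.symm hA⟩

end DestabGrading

end GraphGrid

end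

theorem proposition4p1 {n : ℕ} (g : GraphGrid (n + 1)) (g' : GraphGrid n)
    (i j : Fin n) (a : Fin (n + 1)) (ω : g.Weight) (ω' : g'.Weight)
    (hg : GraphGrid.IsDestabilization g g' i j a)
    (hω : GraphGrid.IsInducedWeight i j a ω ω')
    (hrows : ∀ k, k ≠ j.castSucc → k ≠ j.succ →
      ¬ ((k, i.castSucc) ∈ g.X ∧ (k, i.succ) ∈ g.X))
    (hcols : ∀ l, l ≠ i.castSucc → l ≠ i.succ →
      ¬ ((j.castSucc, l) ∈ g.X ∧ (j.succ, l) ∈ g.X))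
    (hA : (∃! k, (k, g.O a) ∈ g.X) ∨ (∃! l, (a, l) ∈ g.X))
    (c : Fin (n + 1) × Fin (n + 1)) (c' : Fin n × Fin n) :
    IsBigradedComplex g.diff (g.graded ω c) ω.onO ∧
    IsBigradedComplex g'.diff (g'.graded ω' c') ω'.onO ∧
    ∃ Φ : g.CF →+ g'.CF,
      (∀ (p : MvPolynomial (Fin n) (ZMod 2)) (z : g.CF),
        Φ (MvPolynomial.rename a.succAbove p • z) = p • Φ z) ∧
      IsQuasiIso g.diff.toAddMonoidHom g'.diff.toAddMonoidHom Φ ∧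
      ∃ t : ℚ, ∀ (m : ℤ) (s : ℚ), ∀ z ∈ g.graded ω c m s, Φ z ∈ g'.graded ω' c' m (s + t) := by
  refine ⟨GraphGrid.isBigradedComplex ω c, GraphGrid.isBigradedComplex ω' c', ?_⟩
  obtain ⟨t, t', hb, ho⟩ := hg.exists_isBlock hA
  obtain ⟨u, hu, huω⟩ := GraphGrid.exists_inclVar_eq_selAnnuli hω ho
  obtain ⟨b, hAlex⟩ := hg.alexander_insertInner hω hrows hcols c c'
  exact ⟨GraphGrid.destabMap g g' i j a u t, GraphGrid.destabMap_smul,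
    hg.isQuasiIso hb ho hu, _, fun m s z hz =>
      hg.destabMap_mem_graded hω ho huω c c' hAlex hz⟩
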